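/- **Setting.** Inner products are antilinear in the first variable. Let $P\subset\mathbb{R}^d$ be a closed convex cone that is spanning ($P-P=\mathbb{R}^d$) and pointed ($P\cap -P=\{0\}$), with interior $\Omega$, and let $K$ be a separable complex Hilbert space. An *isometric representation* of $P$ on $K$ is a family $V=\{V_x\}_{x\in P}$ of isometries of $K$ with $V_{x+y}=V_xV_y$ such that $x\mapsto V_x\xi$ is continuous for every $\xi\in K$. It is *pure* if $\bigcap_{t\ge 0}V_{ta}K=\{0\}$ for every $a\in\Omega$, and *strictly continuous* if moreover $x\mapsto V_x^*\xi$ is continuous for every $\xi\in K$. Let $\Gamma(K)$ be the symmetric Fock space of $K$, with exponential vectors $e(v)=\sum_{n\ge0}v^{\otimes n}/\sqrt{n!}$. For $u\in K$ let $W(u)$ be the Weyl operator, the unitary on $\Gamma(K)$ with $W(u)e(v)=e^{-\|u\|^2/2-\langle u|v\rangle}e(u+v)$ for all $v\in K$, and for a unitary $U$ on $K$ let $\Gamma(U)$ be the unitary on $\Gamma(K)$ with $\Gamma(U)e(v)=e(Uv)$ for all $v \in K$. The *CCR flow* $\alpha^V=\{\alpha^V_x\}_{x\in P}$ of $V$ is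 given on $B(\Gamma(K))$ by $\alpha^V_x(T)=1_{\Gamma(\ker V_x^*)}\otimes\Gamma(V_x)T\Gamma(V_x)^*$, where $V_x$ is regarded as a unitary $K\to V_xK$ and $\Gamma(K)$ is identified with $\Gamma(\ker V_x^*)\otimes\Gamma(V_xK)$ through $e(a+b)\leftrightarrow e(a)\otimes e(b)$; it satisfies $\alpha^V_x(W(u))=W(V_xu)$. A *gauge cocycle* of $\alpha=\alpha^V$ is a strongly continuous family $\{U_x\}_{x\in P}$ of unitaries on $\Gamma(K)$ with $U_x\alpha_x(U_y)=U_{x+y}$ and $U_x\in\alpha_x(B(\Gamma(K)))'$ for all $x,y\in P$. The *gauge group* $G(\alpha)$ is the set of gauge cocycles with $(UU')_x=U_xU'_x$ and the topology of uniform convergence on compact subsets of $P$, the unitary group carrying the strong operator topology. Let $\mathscr{A}^V(P)$ be the space of *additive cocycles* of $V$, the continuous maps $h:P\to K$ with $h_x\in\ker V_x^*$ and $h_x+V_xh_y=h_{x+y}$ for all $x,y\in P$. Let $M_V=\{V_x,V_x^*:x\in P\}'$, let $\mathcal{U}(M_V)$ be its unitary group, and put $E_x=1-V_xV_x^*$.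 For $h,g\in\mathscr{A}^V(P)$ let $c(h,g)\in\mathbb{C}^d$ be the unique vector with $\langle h_x|g_x\rangle=\langle x|c(h,g)\rangle$ for all $x\in P$. Let $G_V$ be the set $\mathbb{R}^d\times\mathscr{A}^V(P)\times\mathcal{U}(M_V)$ with the group multiplication $$(\lambda,h,u)(\mu,g,v)=\bigl(\lambda+\mu-\operatorname{Im}c(h,ug),\;h+ug,\;uv\bigr),$$ where $(ug)_x=u\,g_x$, and with the product of the usual topology of $\mathbb{R}^d$, the topology of uniform convergence on compact subsets of $P$ on $\mathscr{A}^V(P)$, and the strong operator topology on $\mathcal{U}(M_V)$. **Theorem.** Let $V$ be a pure, strictly continuous isometric representation of $P$ on $K$. Then $$(\lambda,h,u)\longmapsto\bigl\{e^{i\langle\lambda|x\rangle}\,W(h_x)\,\Gamma\bigl(uE_x+1-E_x\bigr)\bigr\}_{x\in P}$$ is an isomorphism of groups and a homeomorphism from $G_V$ onto the gauge group $G(\alpha^V)$ of the CCR flow. -/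

import Mathlib

open scoped TensorProduct
open UniformSpace (Completion)

attribute [-instance] CStarModule.toInner

universe u

/-! ### Hilbert space tensor product -/

section HTensor

variable (E : Type u) [NormedAddCommGroup E] [InnerProductSpace ℂ E]
variable (F : Type u) [NormedAddCommGroup F] [InnerProductSpace ℂ F]

/-- The Hilbert space tensor product: the completion of the algebraic one. -/
def HTensor : Type u := Completion (E ⊗[ℂ] F)

noncomputable instance : NormedAddCommGroup (HTensor E F) :=
  inferInstanceAs (NormedAddCommGroup (Completion (E ⊗[ℂ] F)))

noncomputable instance : InnerProductSpace ℂ (HTensor E F) :=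
  inferInstanceAs (InnerProductSpace ℂ (Completion (E ⊗[ℂ] F)))

instance : CompleteSpace (HTensor E F) :=
  inferInstanceAs (CompleteSpace (Completion (E ⊗[ℂ] F)))

/-- The isometric embedding of the algebraic tensor product. -/
noncomputable def HTensor.emb : E ⊗[ℂ] F →ₗᵢ[ℂ] HTensor E F :=
  (Completion.toComplₗᵢ : E ⊗[ℂ] F →ₗᵢ[ℂ] Completion (E ⊗[ℂ] F))

theorem HTensor.denseRange_emb : DenseRange (HTensor.emb E F) :=
  Completion.denseRange_coe

variable {E F}

/-- The elementary tensor `x ⊗ y`. -/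
noncomputable def htmul (x : E) (y : F) : HTensor E F := HTensor.emb E F (x ⊗ₜ[ℂ] y)

theorem inner_htmul (x x' : E) (y y' : F) :
    inner ℂ (htmul x y) (htmul x' y') = (inner ℂ x x' : ℂ) * inner ℂ y y' := by
  unfold htmul
  rw [LinearIsometry.inner_map_map, TensorProduct.inner_tmul]

end HTensor

/-! ### Symmetric Fock space -/

/-- A bundled complex Hilbert space, used to define tensor powers by recursion. -/
structure HilbertSp where
  carrier : Type u
  [grp : NormedAddCommGroup carrier]
  [ips : InnerProductSpace ℂ carrier]
  [complete : CompleteSpace carrier]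

attribute [instance] HilbertSp.grp HilbertSp.ips HilbertSp.complete

section Fock

variable (K : Type u) [NormedAddCommGroup K] [InnerProductSpace ℂ K]

/-- The Hilbert space tensor power `K ⊗ ⋯ ⊗ K` (`n` factors); the zeroth power is the scalars. -/
noncomputable def tensorPow : ℕ → HilbertSp.{u}
  | 0 => ⟨EuclideanSpace ℂ PUnit.{u + 1}⟩
  | n + 1 => ⟨HTensor K (tensorPow n).carrier⟩

variable {K}

/-- The elementary tensor `v ⊗ ⋯ ⊗ v` (`n` factors). -/
noncomputable def diagTensor (v : K) : (n : ℕ) → (tensorPow K n).carrier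
  | 0 => EuclideanSpace.single PUnit.unit (1 : ℂ)
  | n + 1 => (htmul v (diagTensor v n) : HTensor K (tensorPow K n).carrier)

theorem inner_diagTensor (v w : K) (n : ℕ) :
    inner ℂ (diagTensor v n) (diagTensor w n) = (inner ℂ v w : ℂ) ^ n := by
  induction n with
  | zero =>
    show inner ℂ (EuclideanSpace.single PUnit.unit (1 : ℂ))
      (EuclideanSpace.single PUnit.unit (1 : ℂ)) = _
    simp
  | succ n ih =>
    show inner ℂ (htmul v (diagTensor v n)) (htmul w (diagTensor w n)) = _
    rw [inner_htmul, ih, pow_succ']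

variable (K)

/-- The `n`-particle space: the closed linear span of the tensors `v ⊗ ⋯ ⊗ v` in the Hilbert
space tensor power, that is (by polarization) the space of symmetric `n`-tensors. -/
noncomputable def symPow (n : ℕ) : Submodule ℂ (tensorPow K n).carrier :=
  (Submodule.span ℂ (Set.range fun v : K => diagTensor v n)).topologicalClosure

instance (n : ℕ) : CompleteSpace (symPow K n) :=
  (Submodule.isClosed_topologicalClosure _).completeSpace_coe

/-- The symmetric Fock space `Γ(K)`: the Hilbert space direct sum of all `n`-particle spaces. -/
def Fock : Type u := lp (fun n : ℕ => ↥(symPow K n)) 2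

noncomputable instance : NormedAddCommGroup (Fock K) :=
  inferInstanceAs (NormedAddCommGroup (lp (fun n : ℕ => ↥(symPow K n)) 2))

noncomputable instance : InnerProductSpace ℂ (Fock K) :=
  inferInstanceAs (InnerProductSpace ℂ (lp (fun n : ℕ => ↥(symPow K n)) 2))

instance : CompleteSpace (Fock K) :=
  inferInstanceAs (CompleteSpace (lp (fun n : ℕ => ↥(symPow K n)) 2))

variable {K}

/-- `v ⊗ ⋯ ⊗ v` as an element of the `n`-particle space. -/
noncomputable def diagSym (v : K) (n : ℕ) : symPow K n :=
  ⟨diagTensor v n, Submodule.le_topologicalClosure _ (Submodule.subset_span ⟨v, rfl⟩)⟩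

theorem inner_diagSym (v w : K) (n : ℕ) :
    inner ℂ (diagSym v n) (diagSym w n) = (inner ℂ v w : ℂ) ^ n :=
  inner_diagTensor v w n

theorem norm_diagSym (v : K) (n : ℕ) : ‖diagSym v n‖ = ‖v‖ ^ n := by
  have h : (‖diagSym v n‖ : ℂ) ^ 2 = ((‖v‖ : ℂ) ^ 2) ^ n := by
    have h1 := inner_self_eq_norm_sq_to_K (𝕜 := ℂ) (diagSym v n)
    rw [inner_diagSym, inner_self_eq_norm_sq_to_K] at h1
    exact h1.symm
  have h2 : ‖diagSym v n‖ ^ 2 = (‖v‖ ^ n) ^ 2 := by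
    rw [← pow_mul, mul_comm, pow_mul]
    exact_mod_cast h
  exact (pow_left_inj₀ (norm_nonneg _) (by positivity) two_ne_zero).1 h2

theorem memℓp_exp (v : K) : Memℓp
    (fun n : ℕ => ((Real.sqrt (n.factorial : ℝ) : ℂ)⁻¹ • diagSym v n : symPow K n)) 2 := by
  apply memℓp_gen
  have h := Real.summable_pow_div_factorial (‖v‖ ^ 2)
  refine h.congr fun n => ?_
  rw [norm_smul, norm_diagSym]
  simp only [norm_inv, Complex.norm_real, Real.norm_eq_abs, abs_of_nonneg (Real.sqrt_nonneg _)]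
  norm_num
  rw [mul_pow, inv_pow, Real.sq_sqrt (by positivity)]
  field_simp
  ring

/-- The exponential vector `e(v) = ∑ₙ v^{⊗ n} / √n!`. -/
noncomputable def expVec (v : K) : Fock K :=
  (⟨fun n => (Real.sqrt (n.factorial : ℝ) : ℂ)⁻¹ • diagSym v n, memℓp_exp v⟩ :
    lp (fun n : ℕ => ↥(symPow K n)) 2)

theorem inner_expVec (v w : K) :
    inner ℂ (expVec v) (expVec w) = Complex.exp (inner ℂ v w) := by
  have h := lp.hasSum_inner (𝕜 := ℂ) (G := fun n : ℕ => ↥(symPow K n)) (expVec v) (expVec w)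
  have h2 := NormedSpace.expSeries_div_hasSum_exp (inner ℂ v w : ℂ)
  rw [← Complex.exp_eq_exp_ℂ] at h2
  refine h.unique (h2.congr_fun ?_)
  intro n
  have key : (inner ℂ v w : ℂ) ^ n / (n.factorial : ℂ) =
      inner ℂ ((Real.sqrt (n.factorial : ℝ) : ℂ)⁻¹ • diagSym v n)
        ((Real.sqrt (n.factorial : ℝ) : ℂ)⁻¹ • diagSym w n) := by
    rw [inner_smul_left, inner_smul_right, inner_diagSym, map_inv₀, Complex.conj_ofReal,
      ← mul_assoc, ← mul_inv, ← Complex.ofReal_mul, Real.mul_self_sqrt (by positivity)]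
    push_cast
    field_simp
  exact key.symm

theorem diagTensor_smul (z : ℂ) (v : K) (n : ℕ) :
    diagTensor (z • v) n = z ^ n • diagTensor v n := by
  induction n with
  | zero => rw [pow_zero, one_smul]; rfl
  | succ n ih =>
    show htmul (z • v) (diagTensor (z • v) n) = z ^ (n + 1) • htmul v (diagTensor v n)
    unfold htmul
    rw [ih, TensorProduct.smul_tmul_smul, ← map_smul, pow_succ']

theorem diagSym_smul (z : ℂ) (v : K) (n : ℕ) : diagSym (z • v) n = z ^ n • diagSym v n :=
  Subtype.ext (diagTensor_smul z v n)

theorem span_expVec :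
    (Submodule.span ℂ (Set.range (expVec (K := K)))).topologicalClosure = ⊤ := by
  rw [Submodule.topologicalClosure_eq_top_iff, Submodule.eq_bot_iff]
  intro f hf
  rw [Submodule.mem_orthogonal'] at hf
  let F : lp (fun n : ℕ => ↥(symPow K n)) 2 := f
  have key : ∀ (v : K) (n : ℕ), inner ℂ (F n) (diagSym v n) = 0 := by
    intro v n
    let a : ℕ → ℂ := fun n => (Real.sqrt (n.factorial : ℝ) : ℂ)⁻¹ * inner ℂ (F n) (diagSym v n)
    have hs : ∀ z : ℂ, HasSum (fun n => z ^ n • a n) 0 := by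
      intro z
      have h := lp.hasSum_inner (𝕜 := ℂ) (G := fun n : ℕ => ↥(symPow K n)) F (expVec (z • v))
      have h0 : inner ℂ f (expVec (z • v)) = 0 := hf _ (Submodule.subset_span ⟨_, rfl⟩)
      change HasSum _ (inner ℂ f (expVec (z • v))) at h
      rw [h0] at h
      refine h.congr_fun ?_
      intro n
      have hk : ∀ y : symPow K n, z ^ n • ((Real.sqrt (n.factorial : ℝ) : ℂ)⁻¹ *
          inner ℂ y (diagSym v n)) =
          inner ℂ y ((Real.sqrt (n.factorial : ℝ) : ℂ)⁻¹ • diagSym (z • v) n) := by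
        intro y
        rw [diagSym_smul, inner_smul_right, inner_smul_right, smul_eq_mul]
        ring
      exact hk (F n)
    have hp : HasFPowerSeriesAt (fun _ : ℂ => (0 : ℂ)) (FormalMultilinearSeries.ofScalars ℂ a) 0 := by
      rw [hasFPowerSeriesAt_iff]
      refine Filter.Eventually.of_forall fun z => ?_
      simpa using hs z
    have h3 := congrArg (fun p => FormalMultilinearSeries.coeff p n) hp.eq_zero
    have h4 : a n = 0 := by
      rw [FormalMultilinearSeries.coeff_ofScalars] at h3
      rw [h3]; rfl
    have h5 : (Real.sqrt (n.factorial : ℝ) : ℂ)⁻¹ ≠ 0 := by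
      have : 0 < Real.sqrt (n.factorial : ℝ) := Real.sqrt_pos.2 (by positivity)
      exact inv_ne_zero (by exact_mod_cast this.ne')
    exact (mul_eq_zero.1 h4).resolve_left h5
  have hF : F = 0 := by
    apply lp.ext
    funext n
    have hmem : ((F n : symPow K n) : (tensorPow K n).carrier) ∈
        (symPow K n)ᗮ := by
      unfold symPow
      rw [Submodule.orthogonal_closure, Submodule.mem_orthogonal']
      intro w hw
      induction hw using Submodule.span_induction with
      | mem w hw =>
        obtain ⟨v, rfl⟩ := hw
        exact key v n
      | zero => exact inner_zero_right _
      | add x y _ _ hx hy => rw [inner_add_right, hx, hy, add_zero]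
      | smul c x _ hx => rw [inner_smul_right, hx, mul_zero]
    have h0 := (Submodule.mem_orthogonal _ _).1 hmem _ (F n).2
    apply Subtype.ext
    exact inner_self_eq_zero.1 h0
  exact hF

end Fock

/-! ### Operators on Fock space -/

section Operators

theorem denseRange_of_span_eq_top {ι G : Type*} [NormedAddCommGroup G] [InnerProductSpace ℂ G]
    {k : ι → G} (hk : (Submodule.span ℂ (Set.range k)).topologicalClosure = ⊤) :
    DenseRange (Finsupp.linearCombination ℂ k) := by
  rw [DenseRange, ← LinearMap.coe_range, Finsupp.range_linearCombination]
  exact Submodule.dense_iff_topologicalClosure_eq_top.2 hk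

theorem exists_isometryEquiv {ι : Type*} {E F : Type*}
    [NormedAddCommGroup E] [InnerProductSpace ℂ E] [CompleteSpace E]
    [NormedAddCommGroup F] [InnerProductSpace ℂ F] [CompleteSpace F] (f : ι → E) (g : ι → F)
    (hf : (Submodule.span ℂ (Set.range f)).topologicalClosure = ⊤)
    (hg : (Submodule.span ℂ (Set.range g)).topologicalClosure = ⊤)
    (h : ∀ i j, (inner ℂ (f i) (f j) : ℂ) = inner ℂ (g i) (g j)) :
    ∃ U : E ≃ₗᵢ[ℂ] F, ∀ i, U (f i) = g i := by
  have hn : ∀ x : ι →₀ ℂ, ‖Finsupp.linearCombination ℂ g (LinearEquiv.refl ℂ _ x)‖ =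
      ‖Finsupp.linearCombination ℂ f x‖ := by
    intro x
    have : (inner ℂ (Finsupp.linearCombination ℂ g x) (Finsupp.linearCombination ℂ g x) : ℂ) =
        inner ℂ (Finsupp.linearCombination ℂ f x) (Finsupp.linearCombination ℂ f x) := by
      simp only [Finsupp.linearCombination_apply, Finsupp.sum, sum_inner, inner_sum,
        inner_smul_left, inner_smul_right, h]
    rw [LinearEquiv.refl_apply, norm_eq_sqrt_re_inner (𝕜 := ℂ), this,
      ← norm_eq_sqrt_re_inner (𝕜 := ℂ)]
  refine ⟨(LinearEquiv.refl ℂ (ι →₀ ℂ)).extendOfIsometry _ _ (denseRange_of_span_eq_top hf)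
    (denseRange_of_span_eq_top hg) hn, ?_⟩
  intro i
  have := (LinearEquiv.refl ℂ (ι →₀ ℂ)).extendOfIsometry_eq _ _ (denseRange_of_span_eq_top hf)
    (denseRange_of_span_eq_top hg) hn
    (Finsupp.single i 1)
  simpa using this

variable {K : Type u} [NormedAddCommGroup K] [InnerProductSpace ℂ K]

theorem exists_weyl (u : K) : ∃ W : Fock K ≃ₗᵢ[ℂ] Fock K, ∀ v : K,
    W (expVec v) = Complex.exp (-((‖u‖ : ℂ) ^ 2 / 2) - inner ℂ u v) • expVec (u + v) := by
  refine exists_isometryEquiv _ _ span_expVec ?_ ?_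
  · rw [eq_top_iff, ← span_expVec]
    refine Submodule.topologicalClosure_mono (Submodule.span_le.2 ?_)
    rintro _ ⟨w, rfl⟩
    have hm : Complex.exp (-((‖u‖ : ℂ) ^ 2 / 2) - inner ℂ u (w - u)) • expVec (u + (w - u)) ∈
        Submodule.span ℂ (Set.range fun v : K =>
          Complex.exp (-((‖u‖ : ℂ) ^ 2 / 2) - inner ℂ u v) • expVec (u + v)) :=
      Submodule.subset_span ⟨w - u, rfl⟩
    rw [add_sub_cancel] at hm
    exact (Submodule.smul_mem_iff _ (Complex.exp_ne_zero _)).1 hm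
  · intro v w
    rw [inner_smul_left, inner_smul_right, inner_expVec, inner_expVec, ← Complex.exp_conj,
      ← Complex.exp_add, ← Complex.exp_add]
    congr 1
    have h1 : (inner ℂ u u : ℂ) = (‖u‖ : ℂ) ^ 2 := inner_self_eq_norm_sq_to_K u
    simp only [inner_add_left, inner_add_right, map_sub, map_neg, map_div₀, map_pow,
      Complex.conj_ofReal, inner_conj_symm, h1, map_ofNat]
    ring

/-- The Weyl operator `W(u)`, the unitary operator on `Γ(K)` with
`W(u) e(v) = exp(-‖u‖²/2 - ⟨u|v⟩) e(u + v)`. -/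
noncomputable def weyl (u : K) : Fock K ≃ₗᵢ[ℂ] Fock K := (exists_weyl u).choose

theorem weyl_expVec (u v : K) : weyl u (expVec v) =
    Complex.exp (-((‖u‖ : ℂ) ^ 2 / 2) - inner ℂ u v) • expVec (u + v) :=
  (exists_weyl u).choose_spec v

theorem exists_secondQuant (U : K ≃ₗᵢ[ℂ] K) :
    ∃ G : Fock K ≃ₗᵢ[ℂ] Fock K, ∀ v : K, G (expVec v) = expVec (U v) := by
  refine exists_isometryEquiv _ _ span_expVec ?_ ?_
  · have : Set.range (fun v : K => expVec (U v)) = Set.range (expVec (K := K)) :=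
      U.surjective.range_comp expVec
    rw [this, span_expVec]
  · intro v w
    rw [inner_expVec, inner_expVec, U.inner_map_map]

/-- The second quantization `Γ(U)` of a unitary operator `U`, the unitary operator on `Γ(K)` with
`Γ(U) e(v) = e(U v)`. -/
noncomputable def secondQuant (U : K ≃ₗᵢ[ℂ] K) : Fock K ≃ₗᵢ[ℂ] Fock K :=
  (exists_secondQuant U).choose

theorem secondQuant_expVec (U : K ≃ₗᵢ[ℂ] K) (v : K) :
    secondQuant U (expVec v) = expVec (U v) :=
  (exists_secondQuant U).choose_spec v

end Operators

section IdTensor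

variable (E : Type u) [NormedAddCommGroup E] [InnerProductSpace ℂ E]
variable {F : Type u} [NormedAddCommGroup F] [InnerProductSpace ℂ F]

/-- The operator `1 ⊗ T` on the Hilbert space tensor product. -/
noncomputable def idTensorCLM (T : F →L[ℂ] F) : HTensor E F →L[ℂ] HTensor E F :=
  ContinuousLinearMap.completion (T.lTensor E)

theorem idTensorCLM_emb (T : F →L[ℂ] F) (z : E ⊗[ℂ] F) :
    idTensorCLM E T (HTensor.emb E F z) = HTensor.emb E F (T.lTensor E z) :=
  ContinuousLinearMap.completion_apply_coe _ _

theorem idTensorCLM_htmul (T : F →L[ℂ] F) (x : E) (y : F) :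
    idTensorCLM E T (htmul x y) = htmul x (T y) :=
  idTensorCLM_emb E T _

variable {E} in
theorem HTensor.clm_ext {G : Type*} [NormedAddCommGroup G] [NormedSpace ℂ G]
    {A B : HTensor E F →L[ℂ] G} (h : ∀ x y, A (htmul x y) = B (htmul x y)) : A = B := by
  have h1 : A.toLinearMap ∘ₗ (HTensor.emb E F).toLinearMap =
      B.toLinearMap ∘ₗ (HTensor.emb E F).toLinearMap :=
    TensorProduct.ext' fun x y => h x y
  refine ContinuousLinearMap.coeFn_injective
    ((HTensor.denseRange_emb E F).equalizer A.continuous B.continuous ?_)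
  funext z
  exact LinearMap.congr_fun h1 z

theorem HTensor.span_htmul {ι κ : Type*} {f : ι → E} {g : κ → F}
    (hf : (Submodule.span ℂ (Set.range f)).topologicalClosure = ⊤)
    (hg : (Submodule.span ℂ (Set.range g)).topologicalClosure = ⊤) :
    (Submodule.span ℂ (Set.range fun p : ι × κ => htmul (f p.1) (g p.2))).topologicalClosure =
      ⊤ := by
  rw [Submodule.topologicalClosure_eq_top_iff, Submodule.eq_bot_iff]
  intro z hz
  rw [Submodule.mem_orthogonal] at hz
  have hc : ∀ y : F, Continuous fun x : E => htmul x y := fun y =>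
    (HTensor.emb E F).continuous.comp
      (TensorProduct.continuous_tmul.comp (continuous_id.prodMk continuous_const))
  have hc' : ∀ x : E, Continuous fun y : F => htmul x y := fun x =>
    (HTensor.emb E F).continuous.comp
      (TensorProduct.continuous_tmul.comp (continuous_const.prodMk continuous_id))
  have h1 : ∀ (i : ι) (y : F), inner ℂ (htmul (f i) y) z = 0 := by
    intro i
    let S : Submodule ℂ F := LinearMap.ker (((innerSL ℂ z).toLinearMap ∘ₗ
      (HTensor.emb E F).toLinearMap) ∘ₗ TensorProduct.mk ℂ E F (f i))
    have hS : ∀ y, y ∈ S ↔ inner ℂ (htmul (f i) y) z = 0 := fun y => by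
      rw [← inner_conj_symm, map_eq_zero]; rfl
    have hcl : IsClosed (S : Set F) := by
      have : (S : Set F) = {y | inner ℂ (htmul (f i) y) z = 0} := Set.ext hS
      rw [this]
      exact isClosed_eq ((hc' _).inner continuous_const) continuous_const
    have hle : (⊤ : Submodule ℂ F) ≤ S := by
      rw [← hg]
      refine Submodule.topologicalClosure_minimal _ (Submodule.span_le.2 ?_) hcl
      rintro _ ⟨k, rfl⟩
      exact (hS _).2 (hz _ (Submodule.subset_span ⟨(i, k), rfl⟩))
    exact fun y => (hS y).1 (hle trivial)
  have h2 : ∀ (x : E) (y : F), inner ℂ (htmul x y) z = 0 := by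
    intro x y
    let S : Submodule ℂ E := LinearMap.ker (((innerSL ℂ z).toLinearMap ∘ₗ
      (HTensor.emb E F).toLinearMap) ∘ₗ (TensorProduct.mk ℂ E F).flip y)
    have hS : ∀ x, x ∈ S ↔ inner ℂ (htmul x y) z = 0 := fun x => by
      rw [← inner_conj_symm, map_eq_zero]; rfl
    have hcl : IsClosed (S : Set E) := by
      have : (S : Set E) = {x | inner ℂ (htmul x y) z = 0} := Set.ext hS
      rw [this]
      exact isClosed_eq ((hc y).inner continuous_const) continuous_const
    have hle : (⊤ : Submodule ℂ E) ≤ S := by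
      rw [← hf]
      refine Submodule.topologicalClosure_minimal _ (Submodule.span_le.2 ?_) hcl
      rintro _ ⟨k, rfl⟩
      exact (hS _).2 (h1 k y)
    exact (hS x).1 (hle trivial)
  have h3 : innerSL ℂ z = 0 := HTensor.clm_ext fun x y => by
    rw [innerSL_apply_apply, ← inner_conj_symm, h2, map_zero]; rfl
  have h4 := congrArg (fun A => A z) h3
  exact inner_self_eq_zero.1 h4

/-- The unital `*`-homomorphism `T ↦ 1 ⊗ T`. -/
noncomputable def idTensor [CompleteSpace F] :
    (F →L[ℂ] F) →⋆ₐ[ℂ] (HTensor E F →L[ℂ] HTensor E F) where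
  toFun := idTensorCLM E
  map_one' := HTensor.clm_ext fun x y => idTensorCLM_htmul E _ x y
  map_mul' S T := HTensor.clm_ext fun x y => by
    rw [mul_apply_eq_comp]
    simp only [idTensorCLM_htmul, mul_apply_eq_comp]
  map_zero' := HTensor.clm_ext fun x y => by
    rw [idTensorCLM_htmul]; simp [htmul]
  map_add' S T := HTensor.clm_ext fun x y => by
    rw [add_apply]
    simp only [idTensorCLM_htmul, add_apply]
    simp [htmul, TensorProduct.tmul_add]
  commutes' c := HTensor.clm_ext fun x y => by
    rw [idTensorCLM_htmul]
    simp [Algebra.algebraMap_eq_smul_one, htmul]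
  map_star' T := by
    rw [ContinuousLinearMap.star_eq_adjoint, ContinuousLinearMap.star_eq_adjoint]
    refine HTensor.clm_ext fun x y => ?_
    have h : innerSL ℂ (idTensorCLM E (ContinuousLinearMap.adjoint T) (htmul x y)) =
        innerSL ℂ (ContinuousLinearMap.adjoint (idTensorCLM E T) (htmul x y)) :=
      HTensor.clm_ext fun x' y' => by
        rw [innerSL_apply_apply, innerSL_apply_apply, ContinuousLinearMap.adjoint_inner_left,
          idTensorCLM_htmul, idTensorCLM_htmul, inner_htmul, inner_htmul,
          ContinuousLinearMap.adjoint_inner_left]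
    exact ext_inner_right ℂ fun w => congrArg (fun A => A w) h

end IdTensor

/-! ### Isometric representations of a cone -/

section Cone

variable {d : ℕ}

/-- The standing assumptions on the convex cone: it is closed, spanning and pointed. -/
class IsSolidCone (P : PointedCone ℝ (EuclideanSpace ℝ (Fin d))) : Prop where
  isClosed : IsClosed (P : Set (EuclideanSpace ℝ (Fin d)))
  spanning : ∀ x : EuclideanSpace ℝ (Fin d), ∃ p ∈ P, ∃ q ∈ P, x = p - q
  pointed : ∀ x ∈ P, -x ∈ P → x = 0

variable (P : PointedCone ℝ (EuclideanSpace ℝ (Fin d)))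
variable (K : Type u) [NormedAddCommGroup K] [InnerProductSpace ℂ K]

/-- A (strongly continuous) isometric representation of the cone `P` on `K`. -/
structure IsometricRep where
  toFun : P → K →L[ℂ] K
  isometry' : ∀ x, Isometry (toFun x)
  map_add' : ∀ x y, toFun (x + y) = toFun x * toFun y
  continuous' : ∀ ξ, Continuous fun x => toFun x ξ

namespace IsometricRep

variable {P K}

instance : CoeFun (IsometricRep P K) fun _ => P → K →L[ℂ] K := ⟨toFun⟩

/-- `V` is pure if `⋂_{t ≥ 0} V_{ta} K = {0}` for every `a` in the interior of `P`. -/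
def IsPure (V : IsometricRep P K) : Prop :=
  ∀ a : P, (a : EuclideanSpace ℝ (Fin d)) ∈ interior (P : Set (EuclideanSpace ℝ (Fin d))) →
    ⋂ t : {t : ℝ // 0 ≤ t}, Set.range (V (t • a)) = {0}

theorem map_add (V : IsometricRep P K) (x y : P) : V (x + y) = V x * V y := V.map_add' x y

theorem inner_map_map (V : IsometricRep P K) (x : P) (ξ η : K) :
    (inner ℂ (V x ξ) (V x η) : ℂ) = inner ℂ ξ η :=
  LinearIsometry.inner_map_map
    ⟨(V x).toLinearMap, (AddMonoidHomClass.isometry_iff_norm (V x)).1 (V.isometry' x)⟩ ξ η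

variable [CompleteSpace K] (V : IsometricRep P K)

/-- `V` is strictly continuous if `x ↦ V_x* ξ` is continuous for every `ξ` as well. -/
def IsStrictlyContinuous : Prop :=
  ∀ ξ, Continuous fun x => ContinuousLinearMap.adjoint (V x) ξ

theorem adjoint_map (x : P) (ξ : K) : ContinuousLinearMap.adjoint (V x) (V x ξ) = ξ :=
  ext_inner_right ℂ fun η => by
    rw [ContinuousLinearMap.adjoint_inner_left, V.inner_map_map]

theorem adjoint_mul_self (x : P) : ContinuousLinearMap.adjoint (V x) * V x = 1 :=
  ContinuousLinearMap.ext fun ξ => V.adjoint_map x ξ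

/-- `ker V_x*`. -/
noncomputable def kerAdj (x : P) : Submodule ℂ K :=
  LinearMap.ker (ContinuousLinearMap.adjoint (V x)).toLinearMap

theorem mem_kerAdj (x : P) (ξ : K) : ξ ∈ V.kerAdj x ↔ ContinuousLinearMap.adjoint (V x) ξ = 0 :=
  Iff.rfl

/-! ### The CCR flow -/

theorem exists_fockDecomp (x : P) :
    ∃ U : HTensor (Fock (V.kerAdj x)) (Fock K) ≃ₗᵢ[ℂ] Fock K,
      ∀ (a : V.kerAdj x) (b : K), U (htmul (expVec a) (expVec b)) = expVec ((a : K) + V x b) := by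
  have hr : Set.range (fun p : V.kerAdj x × K => expVec ((p.1 : K) + V x p.2)) =
      Set.range (expVec (K := K)) := by
    refine Set.Subset.antisymm ?_ ?_
    · rintro _ ⟨p, rfl⟩
      exact ⟨_, rfl⟩
    · rintro _ ⟨u, rfl⟩
      refine ⟨(⟨u - V x (ContinuousLinearMap.adjoint (V x) u), ?_⟩,
        ContinuousLinearMap.adjoint (V x) u), ?_⟩
      · rw [mem_kerAdj, map_sub, adjoint_map, sub_self]
      · simp
  obtain ⟨U, hU⟩ := exists_isometryEquiv
    (fun p : V.kerAdj x × K => htmul (expVec p.1) (expVec p.2))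
    (fun p : V.kerAdj x × K => expVec ((p.1 : K) + V x p.2))
    (HTensor.span_htmul _ span_expVec span_expVec) (by rw [hr, span_expVec]) (by
      rintro ⟨a, b⟩ ⟨a', b'⟩
      have h1 : (inner ℂ (a : K) (V x b') : ℂ) = 0 := by
        rw [← ContinuousLinearMap.adjoint_inner_left, (V.mem_kerAdj x _).1 a.2, inner_zero_left]
      have h2 : (inner ℂ (V x b) (a' : K) : ℂ) = 0 := by
        rw [← ContinuousLinearMap.adjoint_inner_right, (V.mem_kerAdj x _).1 a'.2, inner_zero_right]
      simp only [inner_htmul, inner_expVec, inner_add_left, inner_add_right, h1, h2,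
        V.inner_map_map, ← Complex.exp_add, Submodule.coe_inner]
      congr 1
      ring)
  exact ⟨U, fun a b => hU (a, b)⟩

/-- The identification `Γ(ker V_x*) ⊗ Γ(K) ≅ Γ(ker V_x*) ⊗ Γ(V_x K) ≅ Γ(K)`, whose first step is
`1 ⊗ Γ(V_x)`, with `V_x` regarded as a unitary operator from `K` to `V_x K`, and whose second step
is `e(a) ⊗ e(b) ↦ e(a + b)`. -/
noncomputable def fockDecomp (x : P) : HTensor (Fock (V.kerAdj x)) (Fock K) ≃ₗᵢ[ℂ] Fock K :=
  (V.exists_fockDecomp x).choose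

theorem fockDecomp_htmul (x : P) (a : V.kerAdj x) (b : K) :
    V.fockDecomp x (htmul (expVec a) (expVec b)) = expVec ((a : K) + V x b) :=
  (V.exists_fockDecomp x).choose_spec a b

/-- The CCR flow associated to `V`: `α_x(T) = 1_{Γ(ker V_x*)} ⊗ Γ(V_x) T Γ(V_x)*`, acting on
`Γ(ker V_x*) ⊗ Γ(V_x K) = Γ(K)`. -/
noncomputable def ccrFlow (x : P) : (Fock K →L[ℂ] Fock K) →⋆ₐ[ℂ] (Fock K →L[ℂ] Fock K) :=
  (V.fockDecomp x).conjStarAlgEquiv.toStarAlgHom.comp (idTensor (Fock (V.kerAdj x)))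

theorem ccrFlow_fockDecomp (x : P) (T : Fock K →L[ℂ] Fock K)
    (z : HTensor (Fock (V.kerAdj x)) (Fock K)) :
    V.ccrFlow x T (V.fockDecomp x z) =
      V.fockDecomp x (idTensor (Fock (V.kerAdj x)) T z) := by
  show V.fockDecomp x (idTensor (Fock (V.kerAdj x)) T ((V.fockDecomp x).symm (V.fockDecomp x z))) = _
  rw [LinearIsometryEquiv.symm_apply_apply]

/-- The CCR flow satisfies `α_x(W(u)) = W(V_x u)`. -/
theorem ccrFlow_weyl (x : P) (u : K) :
    V.ccrFlow x (weyl u : Fock K →L[ℂ] Fock K) = (weyl (V x u) : Fock K →L[ℂ] Fock K) := by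
  have key : ∀ v : K, V.ccrFlow x (weyl u : Fock K →L[ℂ] Fock K) (expVec v) =
      weyl (V x u) (expVec v) := by
    intro v
    set b := ContinuousLinearMap.adjoint (V x) v with hb
    have ha : v - V x b ∈ V.kerAdj x := by
      rw [mem_kerAdj, map_sub, adjoint_map, sub_self]
    have hv : expVec v = V.fockDecomp x (htmul (expVec ⟨v - V x b, ha⟩) (expVec b)) := by
      rw [fockDecomp_htmul]; simp
    have hn : ‖V x u‖ = ‖u‖ := (AddMonoidHomClass.isometry_iff_norm (V x)).1 (V.isometry' x) u
    have hin : (inner ℂ u b : ℂ) = inner ℂ (V x u) v := by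
      rw [hb, ContinuousLinearMap.adjoint_inner_right]
    have hw := weyl_expVec (V x u) v
    have h1 : idTensor (Fock (V.kerAdj x)) (weyl u : Fock K →L[ℂ] Fock K)
        (htmul (expVec ⟨v - V x b, ha⟩) (expVec b)) =
        Complex.exp (-((‖u‖ : ℂ) ^ 2 / 2) - inner ℂ u b) •
          htmul (expVec (⟨v - V x b, ha⟩ : V.kerAdj x)) (expVec (u + b)) := by
      refine (idTensorCLM_htmul _ _ _ _).trans ?_
      show htmul _ (weyl u (expVec b)) = _
      rw [weyl_expVec]
      simp [htmul]
    rw [hw, hv, ccrFlow_fockDecomp, h1, map_smul, fockDecomp_htmul, hn, _root_.map_add,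
      hin]
    congr 2
    show v - V x b + (V x u + V x b) = V x u + v
    abel
  have hd := (denseRange_of_span_eq_top (span_expVec (K := K)))
  refine ContinuousLinearMap.coeFn_injective (hd.equalizer
    (ContinuousLinearMap.continuous _) (ContinuousLinearMap.continuous _) ?_)
  have : (V.ccrFlow x (weyl u : Fock K →L[ℂ] Fock K)).toLinearMap ∘ₗ
      Finsupp.linearCombination ℂ (expVec (K := K)) =
      (weyl (V x u) : Fock K →L[ℂ] Fock K).toLinearMap ∘ₗ Finsupp.linearCombination ℂ expVec := by
    refine Finsupp.lhom_ext fun v c => ?_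
    simpa using congrArg (c • ·) (key v)
  funext z
  exact LinearMap.congr_fun this z

end IsometricRep

end Cone

/-! ### Gauge groups -/

section Gauge

variable {d : ℕ} {P : PointedCone ℝ (EuclideanSpace ℝ (Fin d))}
variable {H : Type u} [NormedAddCommGroup H] [InnerProductSpace ℂ H] [CompleteSpace H]

/-- Cocycles of a family `α` of `*`-endomorphisms of `B(H)` indexed by `P`: strongly continuous
families of unitaries with `U_x α_x(U_y) = U_{x+y}`. -/
structure IsCocycle (α : P → (H →L[ℂ] H) →⋆ₐ[ℂ] (H →L[ℂ] H))
    (U : P → unitary (H →L[ℂ] H)) : Prop where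
  continuous : ∀ ξ, Continuous fun x => (U x : H →L[ℂ] H) ξ
  mul_map : ∀ x y, (U x : H →L[ℂ] H) * α x (U y) = U (x + y)

/-- Gauge cocycles: cocycles with `U_x ∈ α_x(B(H))'`. -/
structure IsGaugeCocycle (α : P → (H →L[ℂ] H) →⋆ₐ[ℂ] (H →L[ℂ] H))
    (U : P → unitary (H →L[ℂ] H)) : Prop extends IsCocycle α U where
  commute : ∀ x T, (U x : H →L[ℂ] H) * α x T = α x T * U x

/-- The gauge cocycles form a group under `(UV)_x = U_x V_x`. -/
def gaugeSubgroup (α : P → (H →L[ℂ] H) →⋆ₐ[ℂ] (H →L[ℂ] H)) :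
    Subgroup (P → unitary (H →L[ℂ] H)) where
  carrier := {U | IsGaugeCocycle α U}
  one_mem' :=
    { continuous := fun ξ => continuous_const
      mul_map := fun x y => by simp
      commute := fun x T => by simp }
  mul_mem' {U W} hU hW :=
    { continuous := fun ξ => by
        rw [continuous_iff_continuousAt]
        intro x
        rw [ContinuousAt, tendsto_iff_norm_sub_tendsto_zero]
        have h1 : Filter.Tendsto (fun y => ‖(W y : H →L[ℂ] H) ξ - (W x : H →L[ℂ] H) ξ‖ +
            ‖(U y : H →L[ℂ] H) ((W x : H →L[ℂ] H) ξ) -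
              (U x : H →L[ℂ] H) ((W x : H →L[ℂ] H) ξ)‖) (nhds x) (nhds (0 + 0)) :=
          (tendsto_iff_norm_sub_tendsto_zero.1 ((hW.continuous ξ).tendsto x)).add
            (tendsto_iff_norm_sub_tendsto_zero.1
              ((hU.continuous ((W x : H →L[ℂ] H) ξ)).tendsto x))
        rw [add_zero] at h1
        refine squeeze_zero (fun _ => norm_nonneg _) (fun y => ?_) h1
        have h2 : ‖(W y : H →L[ℂ] H) ξ - (W x : H →L[ℂ] H) ξ‖ =
            ‖(U y : H →L[ℂ] H) ((W y : H →L[ℂ] H) ξ - (W x : H →L[ℂ] H) ξ)‖ :=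
          (Unitary.norm_map (U y) _).symm
        rw [h2]
        refine le_trans (le_of_eq ?_) (norm_add_le _ _)
        rw [map_sub]
        simp [mul_apply_eq_comp]
      mul_map := fun x y => by
        have h : (W x : H →L[ℂ] H) * (α x (U y) * α x (W y)) =
            α x (U y) * (W x * α x (W y)) := by
          rw [← mul_assoc, hW.commute, mul_assoc]
        simp only [Pi.mul_apply, Submonoid.coe_mul, map_mul]
        rw [mul_assoc, h, hW.mul_map, ← mul_assoc, hU.mul_map]
      commute := fun x T => by
        simp only [Pi.mul_apply, Submonoid.coe_mul]
        rw [mul_assoc, hW.commute, ← mul_assoc, hU.commute, mul_assoc] }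
  inv_mem' {U} hU :=
    { continuous := fun ξ => by
        rw [continuous_iff_continuousAt]
        intro x
        rw [ContinuousAt, tendsto_iff_norm_sub_tendsto_zero]
        have h1 := tendsto_iff_norm_sub_tendsto_zero.1
          ((hU.continuous (((U x)⁻¹ : unitary (H →L[ℂ] H)).1 ξ)).tendsto x)
        refine h1.congr fun y => ?_
        have h2 : ‖((U y)⁻¹ : unitary (H →L[ℂ] H)).1 ξ - ((U x)⁻¹ : unitary (H →L[ℂ] H)).1 ξ‖ =
            ‖(U y : H →L[ℂ] H) (((U y)⁻¹ : unitary (H →L[ℂ] H)).1 ξ -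
              ((U x)⁻¹ : unitary (H →L[ℂ] H)).1 ξ)‖ := (Unitary.norm_map (U y) _).symm
        have h3 : ∀ z, (U z : H →L[ℂ] H) (((U z)⁻¹ : unitary (H →L[ℂ] H)).1 ξ) = ξ := fun z => by
          rw [← mul_apply_eq_comp, ← Submonoid.coe_mul, mul_inv_cancel]; rfl
        show _ = ‖((U y)⁻¹ : unitary (H →L[ℂ] H)).1 ξ - ((U x)⁻¹ : unitary (H →L[ℂ] H)).1 ξ‖
        rw [h2, map_sub, h3, h3, norm_sub_rev]
      mul_map := fun x y => by
        have e : ∀ z, (((U⁻¹ : P → unitary (H →L[ℂ] H)) z : unitary _) : H →L[ℂ] H) =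
            star (U z : H →L[ℂ] H) := fun z => rfl
        rw [e, e, e, ← hU.mul_map, star_mul, ← map_star]
        have := congrArg star (hU.commute x (U y))
        rw [star_mul, star_mul, ← map_star] at this
        exact this.symm
      commute := fun x T => by
        have e : ∀ z, (((U⁻¹ : P → unitary (H →L[ℂ] H)) z : unitary _) : H →L[ℂ] H) =
            star (U z : H →L[ℂ] H) := fun z => rfl
        have := congrArg star (hU.commute x (star T))
        rw [star_mul, star_mul, ← map_star, star_star] at this
        rw [e]
        exact this.symm }

/-- The gauge group `G(α)`. -/
def GaugeGroup (α : P → (H →L[ℂ] H) →⋆ₐ[ℂ] (H →L[ℂ] H)) : Type u := gaugeSubgroup α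

namespace GaugeGroup

variable {α : P → (H →L[ℂ] H) →⋆ₐ[ℂ] (H →L[ℂ] H)}

noncomputable instance : Group (GaugeGroup α) := inferInstanceAs (Group (gaugeSubgroup α))

/-- The operator `U_x` of a gauge cocycle `U`. -/
def op (U : GaugeGroup α) (x : P) : H →L[ℂ] H :=
  ((show gaugeSubgroup α from U).1 x : unitary (H →L[ℂ] H))

/-- The topology of `G(α)`: uniform convergence on compact subsets of `P`, where the operators
carry the strong operator topology. -/
noncomputable instance : TopologicalSpace (GaugeGroup α) :=
  TopologicalSpace.induced
    (fun U => (UniformOnFun.ofFun {C : Set P | IsCompact C} fun x =>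
      ContinuousLinearMap.toPointwiseConvergenceCLM ℂ (RingHom.id ℂ) H H (U.op x)))
    (UniformOnFun.topologicalSpace P (H →Lₚₜ[ℂ] H) {C : Set P | IsCompact C})

end GaugeGroup

end Gauge

/-! ### Additive cocycles and the group `G_V` -/

section GV

variable {d : ℕ} {P : PointedCone ℝ (EuclideanSpace ℝ (Fin d))}
variable {K : Type u} [NormedAddCommGroup K] [InnerProductSpace ℂ K] [CompleteSpace K]

namespace IsometricRep

variable (V : IsometricRep P K)

/-- The space of additive cocycles of `V`: continuous maps `h : P → K` with `V_x* h_x = 0` and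
`h_x + V_x h_y = h_{x+y}`. As a subspace of `C(P, K)` it carries the topology of uniform
convergence on compact subsets of `P`. -/
def addCocycles : Submodule ℂ C(P, K) where
  carrier := {h | (∀ x, ContinuousLinearMap.adjoint (V x) (h x) = 0) ∧
    ∀ x y, h x + V x (h y) = h (x + y)}
  zero_mem' := ⟨fun x => by simp, fun x y => by simp⟩
  add_mem' {g h} hg hh := ⟨fun x => by simp [hg.1 x, hh.1 x], fun x y => by
    simp only [ContinuousMap.add_apply, ← hg.2 x y, ← hh.2 x y, _root_.map_add]; abel⟩
  smul_mem' c h hh := ⟨fun x => by simp [hh.1 x], fun x y => by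
    simp only [ContinuousMap.smul_apply, ← hh.2 x y, map_smul, smul_add]⟩

/-- The von Neumann algebra `M_V = {V_x, V_x* : x ∈ P}'`. -/
noncomputable def commutant : StarSubalgebra ℂ (K →L[ℂ] K) :=
  StarSubalgebra.centralizer ℂ (Set.range V.toFun)

variable {V}

theorem commutant_apply (T : V.commutant) (x : P) (ξ : K) :
    (T : K →L[ℂ] K) (V x ξ) = V x ((T : K →L[ℂ] K) ξ) :=
  (congrArg (fun A : K →L[ℂ] K => A ξ)
    ((StarSubalgebra.mem_centralizer_iff ℂ).1 T.2 (V x) ⟨x, rfl⟩).1).symm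

theorem commutant_adjoint_apply (T : V.commutant) (x : P) (ξ : K) :
    (T : K →L[ℂ] K) (ContinuousLinearMap.adjoint (V x) ξ) =
      ContinuousLinearMap.adjoint (V x) ((T : K →L[ℂ] K) ξ) :=
  (congrArg (fun A : K →L[ℂ] K => A ξ)
    ((StarSubalgebra.mem_centralizer_iff ℂ).1 T.2 (V x) ⟨x, rfl⟩).2).symm

/-- The operator on `K` underlying a unitary of `M_V`. -/
def opOf (u : unitary V.commutant) : K →L[ℂ] K := ((u : V.commutant) : K →L[ℂ] K)

theorem star_opOf_mul (u : unitary V.commutant) :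
    ContinuousLinearMap.adjoint (opOf u) * opOf u = 1 :=
  congrArg (fun T : V.commutant => (T : K →L[ℂ] K)) (Unitary.coe_star_mul_self u)

theorem opOf_mul_star (u : unitary V.commutant) :
    opOf u * ContinuousLinearMap.adjoint (opOf u) = 1 :=
  congrArg (fun T : V.commutant => (T : K →L[ℂ] K)) (Unitary.coe_mul_star_self u)

theorem inner_opOf (u : unitary V.commutant) (ξ η : K) :
    (inner ℂ (opOf u ξ) (opOf u η) : ℂ) = inner ℂ ξ η := by
  rw [← ContinuousLinearMap.adjoint_inner_right, ← mul_apply_eq_comp, star_opOf_mul]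
  rfl

variable (V)

/-- `E_x = 1 - V_x V_x*`. -/
noncomputable def proj (x : P) : K →L[ℂ] K := 1 - V x * ContinuousLinearMap.adjoint (V x)

theorem gaugeUnitary_mem (u : unitary V.commutant) (x : P) :
    opOf u * V.proj x + (1 - V.proj x) ∈ unitary (K →L[ℂ] K) := by
  have hEE : V.proj x * V.proj x = V.proj x := by
    have h : V x * ContinuousLinearMap.adjoint (V x) * (V x * ContinuousLinearMap.adjoint (V x)) =
        V x * ContinuousLinearMap.adjoint (V x) := by
      rw [mul_assoc, ← mul_assoc (ContinuousLinearMap.adjoint (V x)), V.adjoint_mul_self, one_mul]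
    unfold proj
    rw [mul_sub, sub_mul, sub_mul, h]
    simp
  have hEs : star (V.proj x) = V.proj x := by
    unfold proj
    rw [star_sub, star_one, star_mul, ContinuousLinearMap.star_eq_adjoint,
      ContinuousLinearMap.star_eq_adjoint, ContinuousLinearMap.adjoint_adjoint]
  have hc : ∀ w : unitary V.commutant, V.proj x * opOf w = opOf w * V.proj x := by
    intro w
    refine ContinuousLinearMap.ext fun ξ => ?_
    show opOf w ξ - V x (ContinuousLinearMap.adjoint (V x) (opOf w ξ)) =
      opOf w (ξ - V x (ContinuousLinearMap.adjoint (V x) ξ))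
    rw [map_sub]
    unfold opOf
    rw [commutant_apply, commutant_adjoint_apply]
  have hs : star (opOf u) = opOf (star u) := rfl
  have h1 : star (opOf u) * opOf u = 1 := star_opOf_mul u
  have h2 : opOf u * star (opOf u) = 1 := opOf_mul_star u
  have hc' := hc (star u)
  rw [← hs] at hc'
  have hcu := hc u
  have hst : star (opOf u * V.proj x + (1 - V.proj x)) =
      star (opOf u) * V.proj x + (1 - V.proj x) := by
    rw [star_add, star_sub, star_one, star_mul, hEs, hc']
  have key : ∀ a b : K →L[ℂ] K, V.proj x * a = a * V.proj x → b * a = 1 →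
      (b * V.proj x + (1 - V.proj x)) * (a * V.proj x + (1 - V.proj x)) = 1 := by
    intro a b hca hba
    have e1 : b * V.proj x * (a * V.proj x) = V.proj x := by
      rw [mul_assoc, ← mul_assoc (V.proj x), hca, mul_assoc a, hEE, ← mul_assoc, hba, one_mul]
    have e2 : b * V.proj x * (1 - V.proj x) = 0 := by
      rw [mul_assoc, mul_sub, hEE, mul_one, sub_self, mul_zero]
    have e3 : (1 - V.proj x) * (a * V.proj x) = 0 := by
      rw [sub_mul, one_mul, ← mul_assoc, hca, mul_assoc, hEE, sub_self]
    have e4 : (1 - V.proj x) * (1 - V.proj x) = 1 - V.proj x := by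
      rw [mul_sub, sub_mul, sub_mul, hEE]
      simp
    rw [add_mul, mul_add, mul_add, e1, e2, e3, e4]
    simp
  rw [Unitary.mem_iff, hst]
  exact ⟨key _ _ hcu h1, key _ _ hc' h2⟩

/-- The unitary operator `u_x = u E_x + (1 - E_x)`, for a unitary `u` of `M_V`. -/
noncomputable def gaugeUnitary (u : unitary V.commutant) (x : P) : K ≃ₗᵢ[ℂ] K :=
  Unitary.linearIsometryEquiv ⟨opOf u * V.proj x + (1 - V.proj x), V.gaugeUnitary_mem u x⟩

variable {V}

/-- The additive cocycle `u h`, for a unitary `u` of `M_V` and an additive cocycle `h`. -/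
def actOn (u : unitary V.commutant) (h : V.addCocycles) : V.addCocycles :=
  ⟨⟨fun x => opOf u (h.1 x), (opOf u).continuous.comp h.1.continuous⟩,
    fun x => by
      show ContinuousLinearMap.adjoint (V x) (opOf u (h.1 x)) = 0
      unfold opOf
      rw [← commutant_adjoint_apply, h.2.1 x, map_zero],
    fun x y => by
      show opOf u (h.1 x) + V x (opOf u (h.1 y)) = opOf u (h.1 (x + y))
      rw [← h.2.2 x y, _root_.map_add]
      unfold opOf
      rw [commutant_apply]⟩

theorem actOn_apply (u : unitary V.commutant) (h : V.addCocycles) (x : P) :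
    (actOn u h).1 x = opOf u (h.1 x) := rfl

theorem inner_cocycle_add (g h : V.addCocycles) (x y : P) :
    (inner ℂ (h.1 (x + y)) (g.1 (x + y)) : ℂ) =
      inner ℂ (h.1 x) (g.1 x) + inner ℂ (h.1 y) (g.1 y) := by
  rw [← h.2.2 x y, ← g.2.2 x y, inner_add_left, inner_add_right, inner_add_right, V.inner_map_map,
    ← ContinuousLinearMap.adjoint_inner_left, h.2.1 x, inner_zero_left,
    ← ContinuousLinearMap.adjoint_inner_right, g.2.1 x, inner_zero_right]
  ring

theorem cone_sum_ext [hP : IsSolidCone P] {a b : Fin d → ℂ}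
    (h : ∀ x : P, ∑ i, ((x : EuclideanSpace ℝ (Fin d)) i : ℂ) * a i =
      ∑ i, ((x : EuclideanSpace ℝ (Fin d)) i : ℂ) * b i) : a = b := by
  funext j
  obtain ⟨p, hp, q, hq, hpq⟩ := hP.spanning (EuclideanSpace.single j 1)
  have h1 := h ⟨p, hp⟩
  have h2 := h ⟨q, hq⟩
  have h3 : ∀ c : Fin d → ℂ, c j = ∑ i, (p i : ℂ) * c i - ∑ i, (q i : ℂ) * c i := by
    intro c
    rw [← Finset.sum_sub_distrib]
    have : ∀ i, (p i : ℂ) * c i - (q i : ℂ) * c i = if i = j then c i else 0 := by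
      intro i
      have hi : p i - q i = if i = j then 1 else 0 := by
        have := congrArg (fun z : EuclideanSpace ℝ (Fin d) => z i) hpq
        simp only [PiLp.sub_apply, PiLp.single_apply] at this
        exact this.symm
      rw [← sub_mul, ← Complex.ofReal_sub, hi]
      split_ifs <;> simp
    simp [this]
  rw [h3 a, h3 b]
  simp only at h1 h2
  rw [h1, h2]

/-- A continuous additive map on `P` is homogeneous for nonnegative scalars. -/
theorem additive_smul {f : P → ℂ} (hf : Continuous f) (hadd : ∀ x y, f (x + y) = f x + f y)
    (t : {t : ℝ // 0 ≤ t}) (x : P) : f (t • x) = (t : ℝ) * f x := by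
  let r : ℝ → {t : ℝ // 0 ≤ t} := fun s => ⟨max s 0, le_max_right _ _⟩
  have hr : Continuous r := (continuous_id.max continuous_const).subtype_mk _
  have h0 : f 0 = 0 := by simpa using hadd 0 0
  have hsm : Continuous fun s : {t : ℝ // 0 ≤ t} => s • x :=
    Continuous.subtype_mk (continuous_subtype_val.smul continuous_const) _
  let G : ℝ →+ ℂ :=
    { toFun := fun s => f (r s • x) - f (r (-s) • x)
      map_zero' := by simp
      map_add' := fun s s' => by
        have h1 : r (s + s') + (r (-s) + r (-s')) = r (-(s + s')) + (r s + r s') := by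
          apply Subtype.ext
          show max (s + s') 0 + (max (-s) 0 + max (-s') 0) =
            max (-(s + s')) 0 + (max s 0 + max s' 0)
          have e : ∀ z : ℝ, max z 0 = z + max (-z) 0 := fun z => by
            rcases le_total z 0 with h | h
            · rw [max_eq_right h, max_eq_left (neg_nonneg.2 h)]; ring
            · rw [max_eq_left h, max_eq_right (neg_nonpos.2 h)]; ring
          rw [e (s + s'), e s, e s']
          ring
        have h2 := congrArg (fun z : {t : ℝ // 0 ≤ t} => f (z • x)) h1
        simp only [add_smul, hadd] at h2
        linear_combination h2 }
  have hG : Continuous G := (hf.comp (hsm.comp hr)).sub (hf.comp (hsm.comp (hr.comp continuous_neg)))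
  have h1 := map_real_smul G hG (t : ℝ) 1
  have e1 : ∀ s : ℝ, 0 ≤ s → G s = f ((r s) • x) := by
    intro s hs
    have hz : r (-s) • x = 0 := Subtype.ext (by
      show (max (-s) 0) • (x : EuclideanSpace ℝ (Fin d)) = 0
      rw [max_eq_right (neg_nonpos.2 hs), zero_smul])
    show f (r s • x) - f (r (-s) • x) = _
    rw [hz, h0, sub_zero]
  have e2 : r (t : ℝ) = t := Subtype.ext (max_eq_left t.2)
  have e3 : r 1 = 1 := Subtype.ext (max_eq_left zero_le_one)
  rw [smul_eq_mul, mul_one, e1 _ t.2, e1 _ zero_le_one, e2, e3, one_smul] at h1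
  rw [h1, Complex.real_smul]

theorem exists_pairing [hP : IsSolidCone P] (h g : V.addCocycles) :
    ∃ c : EuclideanSpace ℂ (Fin d), ∀ x : P,
      (inner ℂ (h.1 x) (g.1 x) : ℂ) = ∑ i, ((x : EuclideanSpace ℝ (Fin d)) i : ℂ) * c i := by
  let f : P → ℂ := fun x => inner ℂ (h.1 x) (g.1 x)
  have hf : Continuous f := h.1.continuous.inner g.1.continuous
  have hadd : ∀ x y, f (x + y) = f x + f y := inner_cocycle_add g h
  have h0 : f 0 = 0 := by simpa using hadd 0 0
  have hsum : ∀ F : Fin d → P, f (∑ i, F i) = ∑ i, f (F i) := fun F =>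
    map_sum (⟨⟨f, h0⟩, hadd⟩ : P →+ ℂ) F Finset.univ
  choose p hp q hq hpq using fun i : Fin d => hP.spanning (EuclideanSpace.single i 1)
  refine ⟨WithLp.toLp 2 fun i => f ⟨p i, hp i⟩ - f ⟨q i, hq i⟩, fun x => ?_⟩
  let a : Fin d → {t : ℝ // 0 ≤ t} := fun i =>
    ⟨max ((x : EuclideanSpace ℝ (Fin d)) i) 0, le_max_right _ _⟩
  let b : Fin d → {t : ℝ // 0 ≤ t} := fun i =>
    ⟨max (-(x : EuclideanSpace ℝ (Fin d)) i) 0, le_max_right _ _⟩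
  have hab : ∀ i, ((a i : ℝ)) - (b i : ℝ) = (x : EuclideanSpace ℝ (Fin d)) i := fun i => by
    show max ((x : EuclideanSpace ℝ (Fin d)) i) 0 - max (-(x : EuclideanSpace ℝ (Fin d)) i) 0 = _
    rcases le_total ((x : EuclideanSpace ℝ (Fin d)) i) 0 with h | h
    · rw [max_eq_right h, max_eq_left (neg_nonneg.2 h)]; ring
    · rw [max_eq_left h, max_eq_right (neg_nonpos.2 h)]; ring
  have key : x + ∑ i, (a i • (⟨q i, hq i⟩ : P) + b i • (⟨p i, hp i⟩ : P)) =
      ∑ i, (a i • (⟨p i, hp i⟩ : P) + b i • (⟨q i, hq i⟩ : P)) := by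
    apply Subtype.ext
    rw [Submodule.coe_add, AddSubmonoidClass.coe_finsetSum, AddSubmonoidClass.coe_finsetSum,
      ← sub_eq_zero, add_sub_assoc, ← Finset.sum_sub_distrib]
    have e : ∀ i, (((a i • (⟨q i, hq i⟩ : P) + b i • (⟨p i, hp i⟩ : P) : P) :
        EuclideanSpace ℝ (Fin d)) - ((a i • (⟨p i, hp i⟩ : P) + b i • (⟨q i, hq i⟩ : P) : P) :
        EuclideanSpace ℝ (Fin d))) =
        -((x : EuclideanSpace ℝ (Fin d)) i • EuclideanSpace.single i (1 : ℝ)) := by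
      intro i
      show ((a i : ℝ) • q i + (b i : ℝ) • p i) - ((a i : ℝ) • p i + (b i : ℝ) • q i) = _
      rw [hpq i, ← hab i]
      module
    rw [Finset.sum_congr rfl fun i _ => e i, Finset.sum_neg_distrib]
    have e2 : ∑ i, (x : EuclideanSpace ℝ (Fin d)) i • EuclideanSpace.single i (1 : ℝ) =
        (x : EuclideanSpace ℝ (Fin d)) := by
      simpa using (EuclideanSpace.basisFun (Fin d) ℝ).sum_repr (x : EuclideanSpace ℝ (Fin d))
    rw [e2, add_neg_cancel]
  have hk := congrArg f key
  rw [hadd, hsum, hsum] at hk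
  simp only [hadd, additive_smul hf hadd] at hk
  show f x = _
  have h5 := eq_sub_of_add_eq hk
  rw [h5, ← Finset.sum_sub_distrib]
  refine Finset.sum_congr rfl fun i _ => ?_
  rw [← hab i]
  push_cast
  ring

/-- The vector `c(h, g) ∈ ℂ^d` with `⟨h_x|g_x⟩ = ⟨x|c(h, g)⟩` for all `x ∈ P`. -/
noncomputable def pairing [IsSolidCone P] (h g : V.addCocycles) : EuclideanSpace ℂ (Fin d) :=
  (exists_pairing h g).choose

theorem pairing_spec [IsSolidCone P] (h g : V.addCocycles) (x : P) :
    (inner ℂ (h.1 x) (g.1 x) : ℂ) =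
      ∑ i, ((x : EuclideanSpace ℝ (Fin d)) i : ℂ) * pairing h g i :=
  (exists_pairing h g).choose_spec x

theorem pairing_unique [IsSolidCone P] (h g : V.addCocycles) (c : EuclideanSpace ℂ (Fin d))
    (hc : ∀ x : P, (inner ℂ (h.1 x) (g.1 x) : ℂ) =
      ∑ i, ((x : EuclideanSpace ℝ (Fin d)) i : ℂ) * c i) : pairing h g = c := by
  have := cone_sum_ext (P := P) (a := fun i => pairing h g i) (b := fun i => c i) fun x => by
    rw [← pairing_spec, hc]
  ext i
  exact congrFun this i

theorem pairing_add_left [IsSolidCone P] (h h' g : V.addCocycles) :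
    pairing (h + h') g = pairing h g + pairing h' g :=
  pairing_unique _ _ _ fun x => by
    show (inner ℂ (h.1 x + h'.1 x) (g.1 x) : ℂ) = _
    rw [inner_add_left, pairing_spec, pairing_spec, ← Finset.sum_add_distrib]
    simp [mul_add]

theorem pairing_add_right [IsSolidCone P] (h g g' : V.addCocycles) :
    pairing h (g + g') = pairing h g + pairing h g' :=
  pairing_unique _ _ _ fun x => by
    show (inner ℂ (h.1 x) (g.1 x + g'.1 x) : ℂ) = _
    rw [inner_add_right, pairing_spec, pairing_spec, ← Finset.sum_add_distrib]
    simp [mul_add]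

theorem pairing_actOn [IsSolidCone P] (u : unitary V.commutant) (h g : V.addCocycles) :
    pairing (actOn u h) (actOn u g) = pairing h g :=
  pairing_unique _ _ _ fun x => by
    rw [actOn_apply, actOn_apply, inner_opOf, pairing_spec]

/-- The coordinatewise imaginary part `ℂ^d → ℝ^d`. -/
noncomputable def imVec (c : EuclideanSpace ℂ (Fin d)) : EuclideanSpace ℝ (Fin d) :=
  WithLp.toLp 2 fun i => (c i).im

theorem imVec_add (b c : EuclideanSpace ℂ (Fin d)) : imVec (b + c) = imVec b + imVec c := by
  ext i; simp [imVec]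

theorem imVec_pairing_neg_self [IsSolidCone P] (h : V.addCocycles) :
    imVec (pairing (-h) h) = 0 := by
  have h1 : pairing (-h) h = WithLp.toLp 2 fun i => starRingEnd ℂ (pairing (-h) h i) :=
    pairing_unique _ _ _ fun x => by
      have e := pairing_spec (-h) h x
      have h2 := congrArg (starRingEnd ℂ) e
      rw [map_sum] at h2
      simp only [map_mul, Complex.conj_ofReal] at h2
      rw [← h2]
      show (inner ℂ (-h.1 x) (h.1 x) : ℂ) = starRingEnd ℂ (inner ℂ (-h.1 x) (h.1 x))
      rw [inner_conj_symm, inner_neg_left, inner_neg_right]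
  ext i
  have h2 := congrArg (fun c : EuclideanSpace ℂ (Fin d) => c i) h1
  simpa [imVec] using Complex.conj_eq_iff_im.1 h2.symm

variable (V)

/-- The set `G_V = ℝ^d × 𝒜^V(P) × 𝒰(M_V)`. -/
@[ext]
structure GV where
  lam : EuclideanSpace ℝ (Fin d)
  coc : V.addCocycles
  uni : unitary V.commutant

variable {V}

namespace GV

/-- The group structure of `G_V`:
`(λ, h, u) (μ, g, v) = (λ + μ - Im c(h, u g), h + u g, u v)`. -/
noncomputable instance [IsSolidCone P] : Mul V.GV where
  mul a b := ⟨a.lam + b.lam - imVec (pairing a.coc (actOn a.uni b.coc)),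
    a.coc + actOn a.uni b.coc, a.uni * b.uni⟩

noncomputable instance : One V.GV := ⟨⟨0, 0, 1⟩⟩

noncomputable instance : Inv V.GV :=
  ⟨fun a => ⟨-a.lam, -actOn a.uni⁻¹ a.coc, a.uni⁻¹⟩⟩

theorem actOn_add (u : unitary V.commutant) (g h : V.addCocycles) :
    actOn u (g + h) = actOn u g + actOn u h :=
  Subtype.ext (ContinuousMap.ext fun x => _root_.map_add (opOf u) (g.1 x) (h.1 x))

theorem actOn_mul (u v : unitary V.commutant) (h : V.addCocycles) :
    actOn (u * v) h = actOn u (actOn v h) := rfl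

theorem actOn_one (h : V.addCocycles) : actOn 1 h = h := rfl

theorem pairing_zero_left [IsSolidCone P] (h : V.addCocycles) : pairing 0 h = 0 :=
  pairing_unique _ _ _ fun x => by
    show (inner ℂ (0 : K) (h.1 x) : ℂ) = _
    simp

noncomputable instance [IsSolidCone P] : Group V.GV :=
  Group.ofLeftAxioms
    (fun a b c => by
      refine GV.ext ?_ ?_ (mul_assoc _ _ _)
      · show a.lam + b.lam - imVec (pairing a.coc (actOn a.uni b.coc)) + c.lam -
          imVec (pairing (a.coc + actOn a.uni b.coc) (actOn (a.uni * b.uni) c.coc)) =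
          a.lam + (b.lam + c.lam - imVec (pairing b.coc (actOn b.uni c.coc))) -
          imVec (pairing a.coc (actOn a.uni (b.coc + actOn b.uni c.coc)))
        rw [actOn_add, pairing_add_left, pairing_add_right, actOn_mul, pairing_actOn,
          imVec_add, imVec_add]
        abel
      · show a.coc + actOn a.uni b.coc + actOn (a.uni * b.uni) c.coc =
          a.coc + actOn a.uni (b.coc + actOn b.uni c.coc)
        rw [actOn_add, actOn_mul, add_assoc])
    (fun a => by
      refine GV.ext ?_ ?_ (one_mul _)
      · show 0 + a.lam - imVec (pairing 0 (actOn 1 a.coc)) = a.lam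
        rw [pairing_zero_left]
        ext i
        simp [imVec]
      · show 0 + actOn 1 a.coc = a.coc
        rw [zero_add, actOn_one])
    (fun a => by
      refine GV.ext ?_ ?_ (inv_mul_cancel _)
      · show -a.lam + a.lam - imVec (pairing (-actOn a.uni⁻¹ a.coc) (actOn a.uni⁻¹ a.coc)) = 0
        rw [imVec_pairing_neg_self, neg_add_cancel, sub_zero]
      · show -actOn a.uni⁻¹ a.coc + actOn a.uni⁻¹ a.coc = 0
        rw [neg_add_cancel])

/-- The product topology on `G_V`, where `𝒰(M_V)` carries the strong operator topology. -/
noncomputable instance : TopologicalSpace V.GV :=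
  TopologicalSpace.induced
    (fun a => (a.lam, a.coc,
      ContinuousLinearMap.toPointwiseConvergenceCLM ℂ (RingHom.id ℂ) K K (opOf a.uni)))
    (inferInstanceAs (TopologicalSpace
      (EuclideanSpace ℝ (Fin d) × V.addCocycles × (K →Lₚₜ[ℂ] K))))

end GV

end IsometricRep

end GV

/-!
The point is that every gauge cocycle `U` of a CCR flow is a family of Weyl operators times second
quantizations; everything else is a computation on exponential vectors.

*Shape of a gauge cocycle.* Identify `Γ(K)` with `Γ(ker V_x*) ⊗ Γ(K)`. Since `U_x` commutes with
`1 ⊗ B(Γ(K))`, it acts on the first factor only (`inner_fockDecomp_of_commute`), and the cocycle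
identity makes matrix elements between exponential vectors multiplicative along the cone. The
vacuum expectation `c_x` (`vacEl`) is multiplicative and continuous, hence never `0`. Dividing by
it, the vector `h_x` (`shiftVec`) and the operator `w_x` (`linPart`) read off from the restriction
of `U_x` to vacuum and one-particle space are additive along the cone (`shiftVec_mul`,
`inner_linPart_mul`). Now subdivide `x` into `n` equal steps. A matrix element of `U_x` between
exponential vectors over `ker V_x*` becomes a product of `n` factors, each of which is `c_{x/n}`
times `1` plus a small number determined, up to higher order, by `h_{x/n}` and `w_{x/n}`
(`gauge_step_estimate`); in the limit
`U_x e(η) = c_x exp⟨k_x|η⟩ e(h_x + w_x η)`, where `k_x` is the `h_x` of the adjoint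
(`inner_expVec_proj_gauge`, `gauge_apply_expVec`). Strict continuity enters here: it makes the
components of a vector along the subdivision uniformly small.

*The data.* Because `U_x` is isometric, `w_x` is isometric, `k_x = -w_x* h_x`, and
`c_x exp(‖h_x‖²/2)` is unimodular (`affine_isometry`). The latter is a continuous character of the
cone, hence `e^{i⟨λ|x⟩}` (`exists_character`). By purity `V_{na}* → 0` strongly for an interior
point `a`, so `w_{na}` converges strongly; the limit `u` is a unitary of `M_V` with
`w_x = u E_x + 1 - E_x` (`exists_limit_isometry`, `exists_unitary_commutant`). This gives
surjectivity (`exists_gaugeOp_eq`). The cocycle property and the group law are checked on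
exponential vectors (`gaugeOp_mul_ccrFlow`, `gaugeOp_commute`, `gaugeOp_mul`).

*Topology.* As `P` is locally compact, the topology of the gauge group is governed by joint
continuity of the vectors `U_x f` in `U` and `x` (`GaugeGroup.continuous_of_continuous_op`,
`GaugeGroup.continuous_op`). The explicit formula gives one direction (`continuous_gaugeOp`). In the
other, `h_x`, `u` on `ker V_x*` and the phase `e^{i⟨λ|x⟩}` are continuous expressions in `U_x`
applied to exponential vectors; `u` follows by density of the union of the `ker V_x*`, and `λ`
because a phase `e^{its}` close to `1` for all `t ∈ [0, 1]` has small frequency `s`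
(`continuous_of_gaugeOp`). The same expressions give injectivity (`gaugeOp_injective`).
-/

/-! ### One-particle vectors and exponential vectors -/

/-- Expansion of `⟨e|A f⟩` around `Ω`, for `e = Ω + a + ⋯` and `f = Ω + b + ⋯`: the remainder
terms are of third order if `A Ω` and `A* Ω` are close to `Ω`. -/
theorem inner_expansion {H : Type*} [NormedAddCommGroup H] [InnerProductSpace ℂ H]
    [CompleteSpace H] (A : H →L[ℂ] H) {Ω e f a b : H} (h1 : (inner ℂ (e - Ω - a) Ω : ℂ) = 0)
    (h2 : (inner ℂ Ω (f - Ω - b) : ℂ) = 0) :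
    (inner ℂ e (A f) : ℂ) - (inner ℂ Ω (A Ω) + inner ℂ a (A Ω) + inner ℂ Ω (A b) +
      inner ℂ a (A b)) =
      (inner ℂ (e - Ω - a) (A Ω - Ω) + inner ℂ (e - Ω - a) (A (f - Ω))) +
      (inner ℂ (ContinuousLinearMap.adjoint A Ω - Ω) (f - Ω - b) +
        inner ℂ a (A (f - Ω - b))) := by
  rw [inner_sub_right _ _ Ω, h1, inner_sub_left _ Ω (f - Ω - b), h2,
    ContinuousLinearMap.adjoint_inner_left]
  simp only [_root_.map_sub, inner_sub_right, inner_sub_left]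
  ring

section FockBasics

variable {K : Type u} [NormedAddCommGroup K] [InnerProductSpace ℂ K]

theorem inner_self_eq_ofReal_norm_sq {E : Type*} [NormedAddCommGroup E] [InnerProductSpace ℂ E]
    (f : E) : (inner ℂ f f : ℂ) = ((‖f‖ ^ 2 : ℝ) : ℂ) := by
  rw [inner_self_eq_norm_sq_to_K]
  exact (Complex.ofReal_pow _ _).symm

theorem diagSym_one_add (v w : K) : diagSym (v + w) 1 = diagSym v 1 + diagSym w 1 := by
  apply Subtype.ext
  show htmul (v + w) (diagTensor v 0) = htmul v (diagTensor v 0) + htmul w (diagTensor v 0)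
  unfold htmul
  rw [TensorProduct.add_tmul, _root_.map_add]

theorem diagSym_one_smul (z : ℂ) (v : K) : diagSym (z • v) 1 = z • diagSym v 1 := by
  rw [diagSym_smul, pow_one]

/-- The embedding of `K` into `Γ(K)` as the one-particle space. -/
noncomputable def onePart : K →ₗᵢ[ℂ] Fock K where
  toFun v := (lp.single (E := fun n : ℕ => ↥(symPow K n)) 2 1 (diagSym v 1) :
    lp (fun n : ℕ => ↥(symPow K n)) 2)
  map_add' v w := by
    rw [diagSym_one_add]
    exact lp.single_add (E := fun n : ℕ => ↥(symPow K n)) 2 1 _ _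
  map_smul' z v := by
    rw [diagSym_one_smul]
    exact lp.single_smul (E := fun n : ℕ => ↥(symPow K n)) 2 1 _ _
  norm_map' v := by
    refine (lp.norm_single (E := fun n : ℕ => ↥(symPow K n)) (p := 2) (by norm_num)
      (1 : ℕ) (diagSym v 1)).trans ?_
    rw [norm_diagSym, pow_one]

theorem inner_onePart_expVec (v w : K) :
    (inner ℂ (onePart v) (expVec w) : ℂ) = inner ℂ v w := by
  have h := lp.inner_single_left (𝕜 := ℂ) (G := fun n : ℕ => ↥(symPow K n)) 1 (diagSym v 1)
    (expVec w)
  refine h.trans ?_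
  have h2 : inner ℂ (diagSym v 1) ((Real.sqrt ((1 : ℕ).factorial : ℝ) : ℂ)⁻¹ • diagSym w 1) =
      inner ℂ v w := by
    rw [inner_smul_right, inner_diagSym]
    simp
  exact h2

theorem inner_expVec_onePart (v w : K) :
    (inner ℂ (expVec v) (onePart w) : ℂ) = inner ℂ v w := by
  rw [← inner_conj_symm, inner_onePart_expVec, inner_conj_symm]

theorem inner_onePart (v w : K) : (inner ℂ (onePart v) (onePart w) : ℂ) = inner ℂ v w :=
  onePart.inner_map_map v w

theorem inner_onePart_vac (v : K) : (inner ℂ (onePart v) (expVec (0 : K)) : ℂ) = 0 := by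
  rw [inner_onePart_expVec, inner_zero_right]

theorem inner_vac_onePart (v : K) : (inner ℂ (expVec (0 : K)) (onePart v) : ℂ) = 0 := by
  rw [inner_expVec_onePart, inner_zero_left]

theorem inner_vac_expVec (v : K) : (inner ℂ (expVec (0 : K)) (expVec v) : ℂ) = 1 := by
  rw [inner_expVec, inner_zero_left, Complex.exp_zero]

theorem norm_vac : ‖expVec (0 : K)‖ = 1 := by
  have h := inner_vac_expVec (0 : K)
  rw [inner_self_eq_ofReal_norm_sq] at h
  have h2 : ‖expVec (0 : K)‖ ^ 2 = 1 := by exact_mod_cast h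
  exact (pow_eq_one_iff_of_nonneg (norm_nonneg _) two_ne_zero).1 h2

theorem ext_inner_expVec {f g : Fock K}
    (h : ∀ v : K, (inner ℂ (expVec v) f : ℂ) = inner ℂ (expVec v) g) : f = g := by
  rw [← sub_eq_zero]
  have h1 : f - g ∈ (Submodule.span ℂ (Set.range (expVec (K := K))))ᗮ := by
    rw [Submodule.mem_orthogonal]
    intro w hw
    induction hw using Submodule.span_induction with
    | mem w hw =>
      obtain ⟨v, rfl⟩ := hw
      rw [inner_sub_right, h v, sub_self]
    | zero => exact inner_zero_left _
    | add x y _ _ hx hy => rw [inner_add_left, hx, hy, add_zero]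
    | smul c x _ hx => rw [inner_smul_left, hx, mul_zero]
  rw [← Submodule.orthogonal_closure, span_expVec, Submodule.top_orthogonal_eq_bot] at h1
  exact (Submodule.mem_bot ℂ).1 h1

theorem clm_ext_expVec {G : Type*} [NormedAddCommGroup G] [NormedSpace ℂ G]
    {A B : Fock K →L[ℂ] G} (h : ∀ v, A (expVec v) = B (expVec v)) : A = B :=
  ContinuousLinearMap.ext_on (Submodule.dense_iff_topologicalClosure_eq_top.2 span_expVec)
    (by rintro _ ⟨v, rfl⟩; exact h v)

/-- Distinct exponential vectors are not even proportional. -/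
theorem eq_of_expVec_eq_smul {v w : K} {z : ℂ} (h : expVec v = z • expVec w) : z = 1 ∧ v = w := by
  have h1 := congrArg (fun f => (inner ℂ (expVec (0 : K)) f : ℂ)) h
  simp only [inner_smul_right, inner_vac_expVec, mul_one] at h1
  refine ⟨h1.symm, ext_inner_left ℂ fun ξ => ?_⟩
  have h2 := congrArg (fun f => (inner ℂ (onePart ξ) f : ℂ)) h
  simpa only [inner_smul_right, inner_onePart_expVec, ← h1, one_mul] using h2

theorem norm_sq_expVec_sub_vac (v : K) :
    ‖expVec v - expVec 0‖ ^ 2 = Real.exp (‖v‖ ^ 2) - 1 := by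
  have h : (inner ℂ (expVec v - expVec 0) (expVec v - expVec 0) : ℂ) =
      Complex.exp ((‖v‖ : ℂ) ^ 2) - 1 := by
    have h1 : (inner ℂ v v : ℂ) = (‖v‖ : ℂ) ^ 2 := inner_self_eq_norm_sq_to_K v
    simp only [inner_sub_left, inner_sub_right, inner_expVec, inner_zero_left, inner_zero_right,
      Complex.exp_zero, h1]
    ring
  rw [inner_self_eq_ofReal_norm_sq] at h
  exact_mod_cast h

theorem norm_sq_expVec_sub_vac_sub_onePart (v : K) :
    ‖expVec v - expVec 0 - onePart v‖ ^ 2 = Real.exp (‖v‖ ^ 2) - 1 - ‖v‖ ^ 2 := by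
  have h : (inner ℂ (expVec v - expVec 0 - onePart v) (expVec v - expVec 0 - onePart v) : ℂ) =
      Complex.exp ((‖v‖ : ℂ) ^ 2) - 1 - (‖v‖ : ℂ) ^ 2 := by
    have h1 : (inner ℂ v v : ℂ) = (‖v‖ : ℂ) ^ 2 := inner_self_eq_norm_sq_to_K v
    simp only [inner_sub_left, inner_sub_right, inner_expVec, inner_zero_left, inner_zero_right,
      Complex.exp_zero, inner_onePart_expVec, inner_expVec_onePart, inner_onePart, h1]
    ring
  rw [inner_self_eq_ofReal_norm_sq] at h
  exact_mod_cast h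

theorem norm_expVec_sub_vac_le {v : K} (hv : ‖v‖ ≤ 1) : ‖expVec v - expVec 0‖ ≤ 2 * ‖v‖ := by
  have h1 : |‖v‖ ^ 2| ≤ 1 := by
    rw [abs_of_nonneg (by positivity)]; exact pow_le_one₀ (norm_nonneg _) hv
  have h2 := (le_abs_self _).trans (Real.abs_exp_sub_one_le h1)
  rw [abs_of_nonneg (by positivity), ← norm_sq_expVec_sub_vac] at h2
  refine abs_le_of_sq_le_sq' ?_ (by positivity) |>.2
  nlinarith [sq_nonneg ‖v‖]

theorem norm_expVec_sub_vac_sub_onePart_le {v : K} (hv : ‖v‖ ≤ 1) :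
    ‖expVec v - expVec 0 - onePart v‖ ≤ ‖v‖ ^ 2 := by
  have h1 : |‖v‖ ^ 2| ≤ 1 := by
    rw [abs_of_nonneg (by positivity)]; exact pow_le_one₀ (norm_nonneg _) hv
  have h2 := (le_abs_self _).trans (Real.abs_exp_sub_one_sub_id_le h1)
  rw [← norm_sq_expVec_sub_vac_sub_onePart] at h2
  exact abs_le_of_sq_le_sq' h2 (by positivity) |>.2

/-- Second order expansion of the matrix elements of a contraction between exponential vectors of
small vectors. If `A e(0)` and `A* e(0)` are close to `e(0)`, the error is of third order, which
makes it negligible when summed over a fine partition. -/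
theorem norm_inner_expVec_sub_le (A : Fock K →L[ℂ] Fock K) (hA : ∀ f, ‖A f‖ ≤ ‖f‖) {ε : ℝ}
    (h1 : ‖A (expVec 0) - expVec 0‖ ≤ ε)
    (h2 : ‖ContinuousLinearMap.adjoint A (expVec 0) - expVec 0‖ ≤ ε) {a b : K}
    (ha : ‖a‖ ≤ 1) (hb : ‖b‖ ≤ 1) :
    ‖(inner ℂ (expVec a) (A (expVec b)) : ℂ) - (inner ℂ (expVec 0) (A (expVec 0)) +
      inner ℂ (onePart a) (A (expVec 0)) + inner ℂ (expVec 0) (A (onePart b)) +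
      inner ℂ (onePart a) (A (onePart b)))‖ ≤
      ‖a‖ ^ 2 * (ε + 2 * ‖b‖) + ‖b‖ ^ 2 * (ε + ‖a‖) := by
  have hrv : ∀ v : K, (inner ℂ (expVec v - expVec 0 - onePart v) (expVec (0 : K)) : ℂ) = 0 :=
    fun v => by
      rw [inner_sub_left, inner_sub_left, inner_onePart_vac, inner_expVec, inner_expVec,
        inner_zero_right, inner_zero_right, sub_self, sub_zero]
  rw [inner_expansion A (hrv a) (inner_eq_zero_symm.1 (hrv b))]
  have b1 := norm_expVec_sub_vac_sub_onePart_le ha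
  have b2 := norm_expVec_sub_vac_sub_onePart_le hb
  have b3 := (hA (expVec b - expVec 0)).trans (norm_expVec_sub_vac_le hb)
  have b4 := (hA (expVec b - expVec 0 - onePart b)).trans b2
  have b5 : ‖onePart a‖ = ‖a‖ := onePart.norm_map a
  refine (norm_add_le _ _).trans (add_le_add ?_ ?_)
  · refine (norm_add_le _ _).trans ?_
    rw [mul_add]
    exact add_le_add ((norm_inner_le_norm _ _).trans (by gcongr))
      ((norm_inner_le_norm _ _).trans (by gcongr))
  · refine (norm_add_le _ _).trans ?_
    rw [mul_add]
    refine add_le_add ((norm_inner_le_norm _ _).trans ?_) ((norm_inner_le_norm _ _).trans ?_)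
    · rw [mul_comm]; gcongr
    · rw [mul_comm, b5]; gcongr

end FockBasics

/-! ### Infinite products of small perturbations of one -/

/-- Over a triangular array whose squared norms sum to something negligible, `∏ (1 + zᵢ)` and
`exp (∑ zᵢ)` have the same limit. -/
theorem tendsto_prod_one_add_of_tendsto_sum {z : ℕ → ℕ → ℂ} {s : ℂ}
    (hsq : Filter.Tendsto (fun n => ∑ i ∈ Finset.range n, ‖z n i‖ ^ 2) Filter.atTop (nhds 0))
    (hs : Filter.Tendsto (fun n => ∑ i ∈ Finset.range n, z n i) Filter.atTop (nhds s)) :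
    Filter.Tendsto (fun n => ∏ i ∈ Finset.range n, (1 + z n i)) Filter.atTop
      (nhds (Complex.exp s)) := by
  have hev : ∀ᶠ n in Filter.atTop, ∀ i ∈ Finset.range n, ‖z n i‖ ≤ 1 / 2 := by
    filter_upwards [hsq.eventually (gt_mem_nhds (show (0 : ℝ) < 1 / 4 by norm_num))] with n hn i hi
    have h1 : ‖z n i‖ ^ 2 ≤ ∑ i ∈ Finset.range n, ‖z n i‖ ^ 2 :=
      Finset.single_le_sum (f := fun i => ‖z n i‖ ^ 2) (fun _ _ => by positivity) hi
    nlinarith [norm_nonneg (z n i)]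
  have hlog : Filter.Tendsto (fun n => ∑ i ∈ Finset.range n, Complex.log (1 + z n i))
      Filter.atTop (nhds s) := by
    have hd : Filter.Tendsto (fun n => ∑ i ∈ Finset.range n, (Complex.log (1 + z n i) - z n i))
        Filter.atTop (nhds 0) := by
      refine squeeze_zero_norm' ?_ hsq
      filter_upwards [hev] with n hn
      refine (norm_sum_le _ _).trans (Finset.sum_le_sum fun i hi => ?_)
      have h1 := hn i hi
      have h2 := Complex.norm_log_one_add_sub_self_le (z := z n i) (by linarith)
      have h3 : (1 - ‖z n i‖)⁻¹ ≤ 2 := by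
        rw [inv_le_comm₀ (by linarith) two_pos]; linarith
      have h4 := mul_le_mul_of_nonneg_left h3 (sq_nonneg ‖z n i‖)
      linarith
    have h := hd.add hs
    rw [zero_add] at h
    refine h.congr fun n => ?_
    rw [← Finset.sum_add_distrib]
    exact Finset.sum_congr rfl fun i _ => sub_add_cancel _ _
  refine ((Complex.continuous_exp.tendsto s).comp hlog).congr' ?_
  filter_upwards [hev] with n hn
  simp only [Function.comp_apply]
  rw [Complex.exp_sum]
  refine Finset.prod_congr rfl fun i hi => Complex.exp_log fun h0 => ?_
  have h1 := hn i hi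
  have h2 : z n i = -1 := by linear_combination h0
  rw [h2, norm_neg, norm_one] at h1
  norm_num at h1

/-! ### First-order symbols of an operator on Fock space -/

section Symbols

variable {K : Type u} [NormedAddCommGroup K] [InnerProductSpace ℂ K]

/-- The vacuum expectation of an operator. -/
noncomputable def vacEl (A : Fock K →L[ℂ] Fock K) : ℂ := inner ℂ (expVec 0) (A (expVec 0))

theorem vacEl_one : vacEl (1 : Fock K →L[ℂ] Fock K) = 1 := inner_vac_expVec 0

theorem vacEl_adjoint (A : Fock K →L[ℂ] Fock K) :
    vacEl (ContinuousLinearMap.adjoint A) = starRingEnd ℂ (vacEl A) := by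
  unfold vacEl
  rw [ContinuousLinearMap.adjoint_inner_right, inner_conj_symm]

variable [CompleteSpace K]

/-- The projection of `Γ(K)` onto the one-particle space `K`. -/
noncomputable def onePartAdj : Fock K →L[ℂ] K :=
  ContinuousLinearMap.adjoint (onePart (K := K)).toContinuousLinearMap

theorem inner_onePartAdj (ξ : K) (f : Fock K) :
    (inner ℂ ξ (onePartAdj f) : ℂ) = inner ℂ (onePart ξ) f :=
  ContinuousLinearMap.adjoint_inner_right _ _ _

theorem onePartAdj_expVec (v : K) : onePartAdj (expVec v) = v :=
  ext_inner_left ℂ fun ξ => by rw [inner_onePartAdj, inner_onePart_expVec]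

/-- The one-particle component of `A e(0)`, normalized by the vacuum expectation. For
`A = W(h) Γ(w)` it is `h`. If the vacuum expectation vanishes, it is `0`. -/
noncomputable def shiftVec (A : Fock K →L[ℂ] Fock K) : K :=
  (vacEl A)⁻¹ • onePartAdj (A (expVec 0))

/-- The connected part of the one-particle block of an operator: the contribution of the
one-particle components of `A e(0)` and `A* e(0)` is subtracted. For `A = W(h) Γ(w)` it is `w`. -/
noncomputable def linPart (A : Fock K →L[ℂ] Fock K) : K →L[ℂ] K :=
  (vacEl A)⁻¹ • (onePartAdj ∘L A ∘L (onePart (K := K)).toContinuousLinearMap) -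
    (innerSL ℂ (shiftVec (ContinuousLinearMap.adjoint A))).smulRight (shiftVec A)

theorem inner_shiftVec (A : Fock K →L[ℂ] Fock K) (ξ : K) :
    (inner ℂ ξ (shiftVec A) : ℂ) = (vacEl A)⁻¹ * inner ℂ (onePart ξ) (A (expVec 0)) := by
  unfold shiftVec
  rw [inner_smul_right, inner_onePartAdj]

theorem inner_shiftVec_adjoint (A : Fock K →L[ℂ] Fock K) (η : K) :
    (inner ℂ (shiftVec (ContinuousLinearMap.adjoint A)) η : ℂ) =
      (vacEl A)⁻¹ * inner ℂ (expVec 0) (A (onePart η)) := by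
  rw [← inner_conj_symm, inner_shiftVec, vacEl_adjoint, map_mul, map_inv₀, Complex.conj_conj,
    inner_conj_symm, ContinuousLinearMap.adjoint_inner_left]

theorem inner_linPart (A : Fock K →L[ℂ] Fock K) (ξ η : K) :
    (inner ℂ ξ (linPart A η) : ℂ) = (vacEl A)⁻¹ * inner ℂ (onePart ξ) (A (onePart η)) -
      inner ℂ ξ (shiftVec A) * inner ℂ (shiftVec (ContinuousLinearMap.adjoint A)) η := by
  unfold linPart
  rw [sub_apply, inner_sub_right, ContinuousLinearMap.smulRight_apply,
    inner_smul_right, innerSL_apply_apply, smul_apply, inner_smul_right]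
  have h : (onePartAdj ∘L A ∘L (onePart (K := K)).toContinuousLinearMap) η =
    onePartAdj (A (onePart η)) := rfl
  rw [h, inner_onePartAdj]
  ring

theorem shiftVec_one : shiftVec (1 : Fock K →L[ℂ] Fock K) = 0 :=
  ext_inner_left ℂ fun ξ => by
    rw [inner_shiftVec, inner_zero_right, one_apply_eq_self, inner_onePart_vac, mul_zero]

theorem linPart_one : linPart (1 : Fock K →L[ℂ] Fock K) = 1 :=
  ContinuousLinearMap.ext fun η => ext_inner_left ℂ fun ξ => by
    rw [inner_linPart, vacEl_one, shiftVec_one, inner_zero_right, one_apply_eq_self,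
      one_apply_eq_self, inner_onePart]
    simp

end Symbols

/-! ### Operators commuting with the range of the flow -/

namespace IsometricRep

variable {d : ℕ} {P : PointedCone ℝ (EuclideanSpace ℝ (Fin d))}
variable {K : Type u} [NormedAddCommGroup K] [InnerProductSpace ℂ K]
variable (V : IsometricRep P K)

theorem norm_map (x : P) (ξ : K) : ‖V x ξ‖ = ‖ξ‖ :=
  (AddMonoidHomClass.isometry_iff_norm (V x)).1 (V.isometry' x) ξ

variable [CompleteSpace K]

theorem proj_apply (x : P) (ξ : K) :
    V.proj x ξ = ξ - V x (ContinuousLinearMap.adjoint (V x) ξ) := rfl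

theorem proj_add_map_adjoint (x : P) (ξ : K) :
    V.proj x ξ + V x (ContinuousLinearMap.adjoint (V x) ξ) = ξ := by
  rw [proj_apply, sub_add_cancel]

theorem adjoint_proj (x : P) (ξ : K) : ContinuousLinearMap.adjoint (V x) (V.proj x ξ) = 0 := by
  rw [proj_apply, map_sub, adjoint_map, sub_self]

theorem proj_map (x : P) (ξ : K) : V.proj x (V x ξ) = 0 := by
  rw [proj_apply, adjoint_map, sub_self]

theorem proj_of_adjoint_eq_zero {x : P} {ξ : K} (h : ContinuousLinearMap.adjoint (V x) ξ = 0) :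
    V.proj x ξ = ξ := by
  rw [proj_apply, h, map_zero, sub_zero]

theorem inner_map_of_adjoint_eq_zero {x : P} {a : K}
    (h : ContinuousLinearMap.adjoint (V x) a = 0) (b : K) : (inner ℂ (V x b) a : ℂ) = 0 := by
  rw [← ContinuousLinearMap.adjoint_inner_right, h, inner_zero_right]

theorem inner_of_adjoint_eq_zero_map {x : P} {a : K}
    (h : ContinuousLinearMap.adjoint (V x) a = 0) (b : K) : (inner ℂ a (V x b) : ℂ) = 0 := by
  rw [← ContinuousLinearMap.adjoint_inner_left, h, inner_zero_left]

theorem norm_sq_proj (x : P) (ξ : K) :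
    ‖V.proj x ξ‖ ^ 2 = ‖ξ‖ ^ 2 - ‖ContinuousLinearMap.adjoint (V x) ξ‖ ^ 2 := by
  have h := norm_add_sq_eq_norm_sq_add_norm_sq_of_inner_eq_zero (𝕜 := ℂ) _ _
    (V.inner_of_adjoint_eq_zero_map (V.adjoint_proj x ξ) (ContinuousLinearMap.adjoint (V x) ξ))
  rw [proj_add_map_adjoint, norm_map] at h
  linarith

theorem adjoint_add (x y : P) (ξ : K) : ContinuousLinearMap.adjoint (V (x + y)) ξ =
    ContinuousLinearMap.adjoint (V y) (ContinuousLinearMap.adjoint (V x) ξ) := by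
  rw [V.map_add, ← ContinuousLinearMap.star_eq_adjoint, star_mul]
  rfl

theorem proj_add (x y : P) (ξ : K) : V.proj (x + y) ξ =
    V.proj x ξ + V x (V.proj y (ContinuousLinearMap.adjoint (V x) ξ)) := by
  rw [proj_apply, proj_apply, proj_apply, adjoint_add, V.map_add, mul_apply_eq_comp, map_sub]
  abel

/-- The component of a vector in `ker V_x*`. -/
noncomputable def kerPart (x : P) (ξ : K) : V.kerAdj x := ⟨V.proj x ξ, V.adjoint_proj x ξ⟩

theorem coe_kerPart (x : P) (ξ : K) : (V.kerPart x ξ : K) = V.proj x ξ := rfl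

theorem fockDecomp_expVec_vac (x : P) (a : V.kerAdj x) :
    V.fockDecomp x (htmul (expVec a) (expVec 0)) = expVec (a : K) := by
  rw [fockDecomp_htmul, map_zero, add_zero]

theorem fockDecomp_vac_expVec (x : P) (b : K) :
    V.fockDecomp x (htmul (expVec 0) (expVec b)) = expVec (V x b) := by
  rw [fockDecomp_htmul, Submodule.coe_zero, zero_add]

theorem fockDecomp_vac_vac (x : P) :
    V.fockDecomp x (htmul (expVec 0) (expVec 0)) = expVec (0 : K) := by
  rw [fockDecomp_vac_expVec, map_zero]

theorem expVec_eq_fockDecomp (x : P) (ξ : K) :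
    expVec ξ = V.fockDecomp x (htmul (expVec (V.kerPart x ξ))
      (expVec (ContinuousLinearMap.adjoint (V x) ξ))) := by
  rw [fockDecomp_htmul, coe_kerPart, proj_add_map_adjoint]

theorem fockDecomp_onePart_vac (x : P) (a : V.kerAdj x) :
    V.fockDecomp x (htmul (onePart a) (expVec 0)) = onePart (a : K) :=
  ext_inner_expVec fun v => by
    rw [inner_expVec_onePart, V.expVec_eq_fockDecomp x v, LinearIsometryEquiv.inner_map_map,
      inner_htmul, inner_expVec_onePart, inner_expVec _ (0 : K), inner_zero_right,
      Complex.exp_zero, mul_one, Submodule.coe_inner, coe_kerPart, proj_apply, inner_sub_left,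
      V.inner_map_of_adjoint_eq_zero a.2, sub_zero]

theorem fockDecomp_vac_onePart (x : P) (b : K) :
    V.fockDecomp x (htmul (expVec 0) (onePart b)) = onePart (V x b) :=
  ext_inner_expVec fun v => by
    rw [inner_expVec_onePart, V.expVec_eq_fockDecomp x v, LinearIsometryEquiv.inner_map_map,
      inner_htmul, inner_expVec_onePart, inner_expVec _ (0 : V.kerAdj x), inner_zero_right,
      Complex.exp_zero, one_mul, ContinuousLinearMap.adjoint_inner_left]

theorem ccrFlow_htmul (x : P) (T : Fock K →L[ℂ] Fock K) (p : Fock (V.kerAdj x)) (q : Fock K) :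
    V.ccrFlow x T (V.fockDecomp x (htmul p q)) = V.fockDecomp x (htmul p (T q)) := by
  rw [ccrFlow_fockDecomp]
  exact congrArg _ (idTensorCLM_htmul _ _ _ _)

theorem htmul_smul_right {E F : Type u} [NormedAddCommGroup E] [InnerProductSpace ℂ E]
    [NormedAddCommGroup F] [InnerProductSpace ℂ F] (z : ℂ) (p : E) (q : F) :
    htmul p (z • q) = z • htmul p q := by
  unfold htmul
  rw [TensorProduct.tmul_smul, map_smul]

variable {V}

/-- An operator commuting with `1 ⊗ B(Γ(K))` has the form `A ⊗ 1`; expressed on matrix elements. -/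
theorem inner_fockDecomp_of_commute {x : P} {U : Fock K →L[ℂ] Fock K}
    (hU : ∀ T, U * V.ccrFlow x T = V.ccrFlow x T * U) (p p' : Fock (V.kerAdj x)) (q q' : Fock K) :
    (inner ℂ (V.fockDecomp x (htmul p q)) (U (V.fockDecomp x (htmul p' q'))) : ℂ) =
      inner ℂ (V.fockDecomp x (htmul p (expVec 0))) (U (V.fockDecomp x (htmul p' (expVec 0)))) *
        inner ℂ q q' := by
  -- the rank one operator `|q'⟩⟨e(0)|`
  set R : Fock K →L[ℂ] Fock K := (innerSL ℂ (expVec (0 : K))).smulRight q' with hR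
  have h1 : R (expVec 0) = q' := by
    rw [hR, ContinuousLinearMap.smulRight_apply, innerSL_apply_apply, inner_vac_expVec, one_smul]
  have h2 : ContinuousLinearMap.adjoint R q = (inner ℂ q' q : ℂ) • expVec (0 : K) :=
    ext_inner_right ℂ fun f => by
      rw [ContinuousLinearMap.adjoint_inner_left, hR, ContinuousLinearMap.smulRight_apply,
        innerSL_apply_apply, inner_smul_right, inner_smul_left, inner_conj_symm, mul_comm]
  have h3 : U (V.ccrFlow x R (V.fockDecomp x (htmul p' (expVec 0)))) =
      V.ccrFlow x R (U (V.fockDecomp x (htmul p' (expVec 0)))) :=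
    congrArg (fun A : Fock K →L[ℂ] Fock K => A (V.fockDecomp x (htmul p' (expVec 0)))) (hU R)
  rw [ccrFlow_htmul, h1] at h3
  rw [h3, ← ContinuousLinearMap.adjoint_inner_left, ← ContinuousLinearMap.star_eq_adjoint,
    ← map_star, ContinuousLinearMap.star_eq_adjoint, ccrFlow_htmul, h2, htmul_smul_right,
    map_smul, inner_smul_left, inner_conj_symm, mul_comm]

theorem inner_fockDecomp_mul {x : P} {U : Fock K →L[ℂ] Fock K}
    (hU : ∀ T, U * V.ccrFlow x T = V.ccrFlow x T * U) (A : Fock K →L[ℂ] Fock K)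
    (p p' : Fock (V.kerAdj x)) (q q' : Fock K) :
    (inner ℂ (V.fockDecomp x (htmul p q))
      ((U * V.ccrFlow x A) (V.fockDecomp x (htmul p' q'))) : ℂ) =
      inner ℂ (V.fockDecomp x (htmul p (expVec 0))) (U (V.fockDecomp x (htmul p' (expVec 0)))) *
        inner ℂ q (A q') := by
  rw [mul_apply_eq_comp, ccrFlow_htmul, inner_fockDecomp_of_commute hU]

section

variable {x : P} {U : Fock K →L[ℂ] Fock K} (hU : ∀ T, U * V.ccrFlow x T = V.ccrFlow x T * U)

include hU

theorem commute_adjoint (T : Fock K →L[ℂ] Fock K) :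
    ContinuousLinearMap.adjoint U * V.ccrFlow x T =
      V.ccrFlow x T * ContinuousLinearMap.adjoint U := by
  have h := congrArg star (hU (star T))
  rw [star_mul, star_mul, ← map_star, star_star] at h
  exact h.symm

theorem adjoint_mul_ccrFlow (A : Fock K →L[ℂ] Fock K) :
    ContinuousLinearMap.adjoint (U * V.ccrFlow x A) =
      ContinuousLinearMap.adjoint U * V.ccrFlow x (ContinuousLinearMap.adjoint A) := by
  rw [← ContinuousLinearMap.star_eq_adjoint, star_mul, ← map_star]
  exact (commute_adjoint hU _).symm

theorem inner_expVec_mul (A : Fock K →L[ℂ] Fock K) (ξ η : K) :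
    (inner ℂ (expVec ξ) ((U * V.ccrFlow x A) (expVec η)) : ℂ) =
      inner ℂ (expVec (V.proj x ξ)) (U (expVec (V.proj x η))) *
        inner ℂ (expVec (ContinuousLinearMap.adjoint (V x) ξ))
          (A (expVec (ContinuousLinearMap.adjoint (V x) η))) := by
  rw [V.expVec_eq_fockDecomp x ξ, V.expVec_eq_fockDecomp x η, inner_fockDecomp_mul hU,
    fockDecomp_expVec_vac, fockDecomp_expVec_vac]
  rfl

theorem vacEl_mul (A : Fock K →L[ℂ] Fock K) :
    vacEl (U * V.ccrFlow x A) = vacEl U * vacEl A := by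
  have h := inner_expVec_mul hU A 0 0
  rwa [map_zero, map_zero] at h

theorem inner_onePart_map (b : K) :
    (inner ℂ (onePart (V x b)) (U (expVec 0)) : ℂ) = 0 := by
  rw [← V.fockDecomp_vac_onePart, ← V.fockDecomp_vac_vac x, inner_fockDecomp_of_commute hU,
    inner_onePart_vac, mul_zero]

theorem adjoint_shiftVec : ContinuousLinearMap.adjoint (V x) (shiftVec U) = 0 :=
  ext_inner_left ℂ fun ξ => by
    rw [ContinuousLinearMap.adjoint_inner_right, inner_shiftVec, inner_onePart_map hU, mul_zero,
      inner_zero_right]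

theorem inner_onePart_mul_vac (A : Fock K →L[ℂ] Fock K) (a : V.kerAdj x) (b : K) :
    (inner ℂ (onePart ((a : K) + V x b)) ((U * V.ccrFlow x A) (expVec 0)) : ℂ) =
      inner ℂ (onePart (a : K)) (U (expVec 0)) * vacEl A +
        vacEl U * inner ℂ (onePart b) (A (expVec 0)) := by
  rw [_root_.map_add, inner_add_left, ← V.fockDecomp_vac_onePart x b,
    ← V.fockDecomp_onePart_vac x a]
  conv_lhs => rw [← V.fockDecomp_vac_vac x]
  rw [inner_fockDecomp_mul hU, inner_fockDecomp_mul hU, V.fockDecomp_vac_vac]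
  rfl

/-- For `U` in the commutant of the range of the endomorphism of the flow at `x`, the passage from
`A` to `U α_x(A)` adds the vector of `U`, which lies in `ker V_x*`, to the translate of that of
`A`. -/
theorem shiftVec_mul (A : Fock K →L[ℂ] Fock K) (hUc : vacEl U ≠ 0) (hAc : vacEl A ≠ 0) :
    shiftVec (U * V.ccrFlow x A) = shiftVec U + V x (shiftVec A) :=
  ext_inner_left ℂ fun ξ => by
    have h1 : (inner ℂ ξ (shiftVec U) : ℂ) = inner ℂ (V.proj x ξ) (shiftVec U) := by
      conv_lhs => rw [← V.proj_add_map_adjoint x ξ]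
      rw [inner_add_left, V.inner_map_of_adjoint_eq_zero (adjoint_shiftVec hU), add_zero]
    rw [inner_shiftVec, inner_add_right, h1,
      ← ContinuousLinearMap.adjoint_inner_left (V x) (shiftVec A),
      inner_shiftVec, inner_shiftVec, vacEl_mul hU]
    conv_lhs => rw [← V.proj_add_map_adjoint x ξ, ← V.coe_kerPart]
    rw [inner_onePart_mul_vac hU, V.coe_kerPart]
    field_simp

theorem inner_onePart_mul_onePart (A : Fock K →L[ℂ] Fock K) (a a' : V.kerAdj x) (b b' : K) :
    (inner ℂ (onePart ((a : K) + V x b))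
      ((U * V.ccrFlow x A) (onePart ((a' : K) + V x b'))) : ℂ) =
      inner ℂ (onePart (a : K)) (U (onePart (a' : K))) * vacEl A +
      inner ℂ (onePart (a : K)) (U (expVec 0)) * inner ℂ (expVec 0) (A (onePart b')) +
      (inner ℂ (expVec 0) (U (onePart (a' : K))) * inner ℂ (onePart b) (A (expVec 0)) +
      vacEl U * inner ℂ (onePart b) (A (onePart b'))) := by
  rw [_root_.map_add, _root_.map_add, _root_.map_add, inner_add_left, inner_add_right,
    inner_add_right, ← V.fockDecomp_vac_onePart x b, ← V.fockDecomp_onePart_vac x a,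
    ← V.fockDecomp_vac_onePart x b', ← V.fockDecomp_onePart_vac x a',
    inner_fockDecomp_mul hU, inner_fockDecomp_mul hU, inner_fockDecomp_mul hU,
    inner_fockDecomp_mul hU, V.fockDecomp_vac_vac]
  rfl

/-- The companion of `shiftVec_mul`: along `K = ker V_x* ⊕ V_x K` the operator of `U α_x(A)` is the
orthogonal sum of those of `U` and of `A`. -/
theorem inner_linPart_mul (A : Fock K →L[ℂ] Fock K) (hUc : vacEl U ≠ 0) (hAc : vacEl A ≠ 0)
    (a a' : V.kerAdj x) (b b' : K) :
    (inner ℂ ((a : K) + V x b) (linPart (U * V.ccrFlow x A) ((a' : K) + V x b')) : ℂ) =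
      inner ℂ (a : K) (linPart U (a' : K)) + inner ℂ b (linPart A b') := by
  have hU' := commute_adjoint hU
  have hUc' : vacEl (ContinuousLinearMap.adjoint U) ≠ 0 := by
    rw [vacEl_adjoint]; exact (map_ne_zero _).2 hUc
  have hAc' : vacEl (ContinuousLinearMap.adjoint A) ≠ 0 := by
    rw [vacEl_adjoint]; exact (map_ne_zero _).2 hAc
  rw [inner_linPart, inner_linPart, inner_linPart, adjoint_mul_ccrFlow hU,
    shiftVec_mul hU A hUc hAc, shiftVec_mul hU' _ hUc' hAc', inner_onePart_mul_onePart hU,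
    vacEl_mul hU]
  simp only [inner_add_left, inner_add_right, V.inner_map_map,
    V.inner_map_of_adjoint_eq_zero (adjoint_shiftVec hU),
    V.inner_of_adjoint_eq_zero_map (adjoint_shiftVec hU'),
    V.inner_of_adjoint_eq_zero_map a.2, V.inner_map_of_adjoint_eq_zero a'.2]
  simp only [inner_shiftVec, inner_shiftVec_adjoint]
  field_simp
  ring

end

end IsometricRep

/-! ### Subdivision of a ray -/

section Subdivision

variable {d : ℕ} {P : PointedCone ℝ (EuclideanSpace ℝ (Fin d))}

/-- The point `x / n` of the cone. -/
noncomputable def divPt (x : P) (n : ℕ) : P :=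
  (⟨(n : ℝ)⁻¹, inv_nonneg.2 n.cast_nonneg⟩ : {t : ℝ // 0 ≤ t}) • x

/-- The point `t x` of the cone, with `t` replaced by `0` if it is negative. -/
noncomputable def rayPt (x : P) (t : ℝ) : P :=
  (⟨max t 0, le_max_right _ _⟩ : {t : ℝ // 0 ≤ t}) • x

theorem coe_rayPt (x : P) (t : ℝ) :
    (rayPt x t : EuclideanSpace ℝ (Fin d)) = (max t 0) • (x : EuclideanSpace ℝ (Fin d)) := rfl

theorem continuous_rayPt (x : P) : Continuous (rayPt x) :=
  Continuous.subtype_mk (f := fun t : ℝ => (max t 0) • (x : EuclideanSpace ℝ (Fin d)))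
    ((continuous_id.max continuous_const).smul continuous_const) _

theorem rayPt_zero (x : P) : rayPt x 0 = 0 :=
  Subtype.ext (by rw [coe_rayPt, max_self, zero_smul]; rfl)

theorem rayPt_one (x : P) : rayPt x 1 = x :=
  Subtype.ext (by rw [coe_rayPt, max_eq_left zero_le_one, one_smul])

theorem nsmul_divPt (x : P) (n i : ℕ) : i • divPt x n = rayPt x ((i : ℝ) / n) :=
  Subtype.ext (by
    rw [coe_rayPt, max_eq_left (by positivity), div_eq_mul_inv, mul_smul, Nat.cast_smul_eq_nsmul]
    rfl)

theorem nsmul_divPt_self (x : P) {n : ℕ} (hn : n ≠ 0) : n • divPt x n = x := by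
  rw [nsmul_divPt, div_self (Nat.cast_ne_zero.2 hn), rayPt_one]

theorem tendsto_divPt (x : P) : Filter.Tendsto (divPt x) Filter.atTop (nhds 0) := by
  have h := ((continuous_rayPt x).tendsto 0).comp tendsto_inv_atTop_nhds_zero_nat
  rw [rayPt_zero] at h
  refine h.congr fun n => ?_
  have := nsmul_divPt x n 1
  rw [one_smul] at this
  rw [this, Function.comp_apply, Nat.cast_one, one_div]

end Subdivision

namespace IsometricRep

variable {d : ℕ} {P : PointedCone ℝ (EuclideanSpace ℝ (Fin d))}
variable {K : Type u} [NormedAddCommGroup K] [InnerProductSpace ℂ K]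

theorem map_zero_apply (V : IsometricRep P K) (ξ : K) : V 0 ξ = ξ := by
  refine (V.isometry' 0).injective ?_
  show V 0 (V 0 ξ) = V 0 ξ
  rw [← mul_apply_eq_comp, ← V.map_add, add_zero]

variable [CompleteSpace K] {V : IsometricRep P K}

theorem adjoint_zero_apply (V : IsometricRep P K) (ξ : K) :
    ContinuousLinearMap.adjoint (V 0) ξ = ξ := by
  conv_lhs => rw [← V.map_zero_apply ξ]
  rw [adjoint_map]

theorem proj_zero (V : IsometricRep P K) (ξ : K) : V.proj 0 ξ = 0 := by
  rw [proj_apply, adjoint_zero_apply, map_zero_apply, sub_self]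

theorem norm_sq_proj_nsmul (V : IsometricRep P K) (y : P) (i : ℕ) (ξ : K) :
    ‖V.proj y (ContinuousLinearMap.adjoint (V (i • y)) ξ)‖ ^ 2 =
      ‖ContinuousLinearMap.adjoint (V (i • y)) ξ‖ ^ 2 -
        ‖ContinuousLinearMap.adjoint (V ((i + 1) • y)) ξ‖ ^ 2 := by
  rw [norm_sq_proj, succ_nsmul, adjoint_add]

theorem sum_norm_sq_proj_le (V : IsometricRep P K) (y : P) (n : ℕ) (ξ : K) :
    ∑ i ∈ Finset.range n, ‖V.proj y (ContinuousLinearMap.adjoint (V (i • y)) ξ)‖ ^ 2 ≤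
      ‖ξ‖ ^ 2 := by
  rw [Finset.sum_congr rfl fun i _ => V.norm_sq_proj_nsmul y i ξ,
    Finset.sum_range_sub' (fun i => ‖ContinuousLinearMap.adjoint (V (i • y)) ξ‖ ^ 2), zero_nsmul,
    adjoint_zero_apply]
  linarith [sq_nonneg ‖ContinuousLinearMap.adjoint (V (n • y)) ξ‖]

/-- The components of a vector along a fine subdivision of the segment from `0` to `x` are
uniformly small. -/
theorem eventually_norm_proj_le (hcont : V.IsStrictlyContinuous) (x : P) (ξ : K) {μ : ℝ}
    (hμ : 0 < μ) : ∀ᶠ n in Filter.atTop, ∀ i ∈ Finset.range n,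
      ‖V.proj (divPt x n) (ContinuousLinearMap.adjoint (V (i • divPt x n)) ξ)‖ ≤ μ := by
  let g : ℝ → ℝ := fun t => ‖ContinuousLinearMap.adjoint (V (rayPt x t)) ξ‖ ^ 2
  have hg : Continuous g := (((hcont ξ).comp (continuous_rayPt x)).norm).pow 2
  have hu := (isCompact_Icc (a := (0 : ℝ)) (b := 1)).uniformContinuousOn_of_continuous
    hg.continuousOn
  obtain ⟨δ, hδ, hd⟩ := Metric.uniformContinuousOn_iff.1 hu (μ ^ 2) (by positivity)
  filter_upwards [tendsto_inv_atTop_nhds_zero_nat.eventually (gt_mem_nhds hδ),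
    Filter.eventually_gt_atTop 0] with n hn hn0 i hi
  have hi' : i + 1 ≤ n := Finset.mem_range.1 hi
  have hn' : (0 : ℝ) < n := Nat.cast_pos.2 hn0
  have hi2 : ((i + 1 : ℕ) : ℝ) ≤ n := Nat.cast_le.2 hi'
  have h1 : ((i : ℕ) : ℝ) / n ∈ Set.Icc (0 : ℝ) 1 :=
    ⟨by positivity, (div_le_one hn').2 (by push_cast at hi2; linarith)⟩
  have h2 : ((i + 1 : ℕ) : ℝ) / n ∈ Set.Icc (0 : ℝ) 1 := ⟨by positivity, (div_le_one hn').2 hi2⟩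
  have h3 := hd _ h1 _ h2 (by
    rw [dist_comm, Real.dist_eq, ← sub_div, Nat.cast_succ, add_sub_cancel_left, one_div,
      abs_of_pos (by positivity)]
    exact hn)
  have h4 : ‖V.proj (divPt x n) (ContinuousLinearMap.adjoint (V (i • divPt x n)) ξ)‖ ^ 2 =
      g ((i : ℝ) / n) - g (((i + 1 : ℕ) : ℝ) / n) := by
    rw [norm_sq_proj_nsmul, nsmul_divPt, nsmul_divPt]
  refine abs_le_of_sq_le_sq' ?_ hμ.le |>.2
  rw [h4]
  exact (le_abs_self _).trans h3.le

/-! ### Matrix elements of gauge cocycles -/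

/-- The exponent of the matrix elements of a gauge cocycle; see `inner_expVec_proj_gauge`. -/
noncomputable def gaugeExponent (V : IsometricRep P K) (U : P → unitary (Fock K →L[ℂ] Fock K))
    (x : P) (ξ η : K) : ℂ :=
  inner ℂ (V.proj x ξ) (shiftVec (U x : Fock K →L[ℂ] Fock K)) +
    inner ℂ (shiftVec (ContinuousLinearMap.adjoint (U x : Fock K →L[ℂ] Fock K))) (V.proj x η) +
    inner ℂ (V.proj x ξ) (linPart (U x : Fock K →L[ℂ] Fock K) (V.proj x η))

theorem gaugeExponent_zero (U : P → unitary (Fock K →L[ℂ] Fock K)) (ξ η : K) :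
    gaugeExponent V U 0 ξ η = 0 := by
  unfold gaugeExponent
  rw [proj_zero, proj_zero, map_zero, inner_zero_left, inner_zero_right, inner_zero_left, add_zero,
    add_zero]

section Cocycle

variable {U : P → unitary (Fock K →L[ℂ] Fock K)} (hU : IsGaugeCocycle V.ccrFlow U)

include hU

theorem gauge_commute (x : P) (T : Fock K →L[ℂ] Fock K) :
    (U x : Fock K →L[ℂ] Fock K) * V.ccrFlow x T = V.ccrFlow x T * (U x : Fock K →L[ℂ] Fock K) :=
  hU.commute x T

/-- The cocycle identity at `0` gives `α_0(U_0) = 1`, and `α_0` is injective. -/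
theorem gauge_zero : (U 0 : Fock K →L[ℂ] Fock K) = 1 := by
  have h := hU.mul_map 0 0
  rw [add_zero] at h
  have h1 : V.ccrFlow 0 (U 0 : Fock K →L[ℂ] Fock K) = 1 := by
    have h2 := congrArg (fun A => star (U 0 : Fock K →L[ℂ] Fock K) * A) h
    simp only [← mul_assoc] at h2
    rwa [Unitary.coe_star_mul_self, one_mul] at h2
  refine ContinuousLinearMap.ext fun q => ?_
  have h3 := congrArg (fun A : Fock K →L[ℂ] Fock K =>
    A (V.fockDecomp 0 (htmul (expVec 0) q))) h1
  simp only [ccrFlow_htmul, one_apply_eq_self] at h3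
  rw [one_apply_eq_self]
  refine ext_inner_left ℂ fun r => ?_
  have h4 := congrArg (fun f => (inner ℂ (V.fockDecomp 0 (htmul (expVec 0) r)) f : ℂ)) h3
  simpa only [LinearIsometryEquiv.inner_map_map, inner_htmul, inner_vac_expVec, one_mul] using h4

theorem vacEl_gauge_add (x y : P) : vacEl (U (x + y) : Fock K →L[ℂ] Fock K) =
    vacEl (U x : Fock K →L[ℂ] Fock K) * vacEl (U y : Fock K →L[ℂ] Fock K) := by
  rw [← hU.mul_map, vacEl_mul (gauge_commute hU x)]

theorem vacEl_gauge_nsmul (y : P) (n : ℕ) : vacEl (U (n • y) : Fock K →L[ℂ] Fock K) =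
    vacEl (U y : Fock K →L[ℂ] Fock K) ^ n := by
  induction n with
  | zero => rw [zero_nsmul, gauge_zero hU, vacEl_one, pow_zero]
  | succ n ih => rw [succ_nsmul, vacEl_gauge_add hU, ih, pow_succ]

theorem continuous_vacEl : Continuous fun x => vacEl (U x : Fock K →L[ℂ] Fock K) :=
  continuous_const.inner (hU.continuous _)

/-- `vacEl (U x)` is the `n`-th power of `vacEl (U (x / n))`, which tends to `1`. -/
theorem vacEl_gauge_ne_zero (x : P) : vacEl (U x : Fock K →L[ℂ] Fock K) ≠ 0 := by
  have h := ((continuous_vacEl hU).tendsto 0).comp (tendsto_divPt x)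
  rw [gauge_zero hU, vacEl_one] at h
  obtain ⟨n, hn, hn0⟩ := ((h.eventually_ne one_ne_zero).and (Filter.eventually_ne_atTop 0)).exists
  rw [← nsmul_divPt_self x hn0, vacEl_gauge_nsmul hU]
  exact pow_ne_zero _ hn

theorem inner_linPart_gauge_add (x y : P) (a a' : V.kerAdj x) (b b' : K) :
    (inner ℂ ((a : K) + V x b)
      (linPart (U (x + y) : Fock K →L[ℂ] Fock K) ((a' : K) + V x b')) : ℂ) =
      inner ℂ (a : K) (linPart (U x : Fock K →L[ℂ] Fock K) (a' : K)) +
        inner ℂ b (linPart (U y : Fock K →L[ℂ] Fock K) b') := by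
  rw [← hU.mul_map, inner_linPart_mul (gauge_commute hU x) _ (vacEl_gauge_ne_zero hU x)
    (vacEl_gauge_ne_zero hU y)]

theorem shiftVec_gauge_add (x y : P) : shiftVec (U (x + y) : Fock K →L[ℂ] Fock K) =
    shiftVec (U x : Fock K →L[ℂ] Fock K) + V x (shiftVec (U y : Fock K →L[ℂ] Fock K)) := by
  rw [← hU.mul_map, shiftVec_mul (gauge_commute hU x) _ (vacEl_gauge_ne_zero hU x)
    (vacEl_gauge_ne_zero hU y)]

theorem isGaugeCocycle_inv : IsGaugeCocycle V.ccrFlow U⁻¹ := (gaugeSubgroup V.ccrFlow).inv_mem hU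

theorem shiftVec_adjoint_gauge_add (x y : P) :
    shiftVec (ContinuousLinearMap.adjoint (U (x + y) : Fock K →L[ℂ] Fock K)) =
    shiftVec (ContinuousLinearMap.adjoint (U x : Fock K →L[ℂ] Fock K)) +
      V x (shiftVec (ContinuousLinearMap.adjoint (U y : Fock K →L[ℂ] Fock K))) :=
  shiftVec_gauge_add (isGaugeCocycle_inv hU) x y

theorem gaugeExponent_add (x y : P) (ξ η : K) : gaugeExponent V U (x + y) ξ η =
    gaugeExponent V U x ξ η + gaugeExponent V U y (ContinuousLinearMap.adjoint (V x) ξ)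
      (ContinuousLinearMap.adjoint (V x) η) := by
  have h1 := adjoint_shiftVec (gauge_commute hU x)
  have h2 := adjoint_shiftVec (gauge_commute (isGaugeCocycle_inv hU) x)
  change ContinuousLinearMap.adjoint (V x)
    (shiftVec (ContinuousLinearMap.adjoint (U x : Fock K →L[ℂ] Fock K))) = 0 at h2
  unfold gaugeExponent
  rw [shiftVec_gauge_add hU, shiftVec_adjoint_gauge_add hU, proj_add, proj_add,
    ← V.coe_kerPart x ξ, ← V.coe_kerPart x η, inner_linPart_gauge_add hU]
  simp only [inner_add_left, inner_add_right, V.inner_map_map,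
    V.inner_map_of_adjoint_eq_zero h1, V.inner_of_adjoint_eq_zero_map h2,
    V.inner_map_of_adjoint_eq_zero (V.kerPart x η).2,
    V.inner_of_adjoint_eq_zero_map (V.kerPart x ξ).2]
  ring

theorem gaugeExponent_nsmul (y : P) (ξ η : K) (n : ℕ) : gaugeExponent V U (n • y) ξ η =
    ∑ i ∈ Finset.range n, gaugeExponent V U y (ContinuousLinearMap.adjoint (V (i • y)) ξ)
      (ContinuousLinearMap.adjoint (V (i • y)) η) := by
  induction n with
  | zero => rw [zero_nsmul, gaugeExponent_zero, Finset.sum_range_zero]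
  | succ n ih => rw [succ_nsmul, gaugeExponent_add hU, ih, Finset.sum_range_succ]

theorem inner_expVec_proj_gauge_add (x y : P) (ξ η : K) :
    (inner ℂ (expVec (V.proj (x + y) ξ))
      ((U (x + y) : Fock K →L[ℂ] Fock K) (expVec (V.proj (x + y) η))) : ℂ) =
    inner ℂ (expVec (V.proj x ξ)) ((U x : Fock K →L[ℂ] Fock K) (expVec (V.proj x η))) *
    inner ℂ (expVec (V.proj y (ContinuousLinearMap.adjoint (V x) ξ)))
      ((U y : Fock K →L[ℂ] Fock K)
        (expVec (V.proj y (ContinuousLinearMap.adjoint (V x) η)))) := by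
  have e1 : ∀ ξ, V.proj x (V.proj (x + y) ξ) = V.proj x ξ := fun ξ => by
    rw [proj_add, _root_.map_add, proj_map, add_zero,
      V.proj_of_adjoint_eq_zero (V.adjoint_proj _ _)]
  have e2 : ∀ ξ, ContinuousLinearMap.adjoint (V x) (V.proj (x + y) ξ) =
      V.proj y (ContinuousLinearMap.adjoint (V x) ξ) := fun ξ => by
    rw [proj_add, _root_.map_add, adjoint_proj, zero_add, adjoint_map]
  rw [← hU.mul_map, inner_expVec_mul (gauge_commute hU x), e1, e1, e2, e2]

theorem inner_expVec_proj_gauge_nsmul (y : P) (ξ η : K) (n : ℕ) :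
    (inner ℂ (expVec (V.proj (n • y) ξ))
      ((U (n • y) : Fock K →L[ℂ] Fock K) (expVec (V.proj (n • y) η))) : ℂ) =
    ∏ i ∈ Finset.range n, inner ℂ (expVec (V.proj y (ContinuousLinearMap.adjoint (V (i • y)) ξ)))
      ((U y : Fock K →L[ℂ] Fock K)
        (expVec (V.proj y (ContinuousLinearMap.adjoint (V (i • y)) η)))) := by
  induction n with
  | zero =>
    rw [zero_nsmul, proj_zero, proj_zero, gauge_zero hU, Finset.prod_range_zero, one_apply_eq_self,
      inner_vac_expVec]
  | succ n ih => rw [succ_nsmul, inner_expVec_proj_gauge_add hU, ih, Finset.prod_range_succ]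

end Cocycle

/-- Over a short step, the matrix elements of a gauge cocycle are `vacEl` times `1` plus the
exponent, up to an error of higher order. -/
theorem gauge_step_estimate (U : P → unitary (Fock K →L[ℂ] Fock K)) (y : P) {μ : ℝ}
    (hμ : μ ≤ 1 / 2)
    (h0 : ‖(U y : Fock K →L[ℂ] Fock K) (expVec 0) - expVec 0‖ ≤ μ) (ξ η : K)
    (hξ : ‖V.proj y ξ‖ ≤ μ) (hη : ‖V.proj y η‖ ≤ μ) :
    ‖(vacEl (U y : Fock K →L[ℂ] Fock K))⁻¹ * inner ℂ (expVec (V.proj y ξ))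
        ((U y : Fock K →L[ℂ] Fock K) (expVec (V.proj y η))) - 1 - gaugeExponent V U y ξ η‖ ≤
      8 * μ * (‖V.proj y ξ‖ ^ 2 + ‖V.proj y η‖ ^ 2) ∧
    ‖(vacEl (U y : Fock K →L[ℂ] Fock K))⁻¹ * inner ℂ (expVec (V.proj y ξ))
        ((U y : Fock K →L[ℂ] Fock K) (expVec (V.proj y η))) - 1‖ ^ 2 ≤
      128 * μ * (‖V.proj y ξ‖ ^ 2 + ‖V.proj y η‖ ^ 2) := by
  have hμ0 : 0 ≤ μ := (norm_nonneg _).trans h0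
  unfold gaugeExponent
  rw [inner_linPart, inner_shiftVec, inner_shiftVec_adjoint]
  generalize V.proj y ξ = a at *
  generalize V.proj y η = b at *
  set A : Fock K →L[ℂ] Fock K := (U y : Fock K →L[ℂ] Fock K) with hA
  have hAn : ∀ f, ‖A f‖ = ‖f‖ := fun f => Unitary.norm_map (U y) f
  have h0' : ‖ContinuousLinearMap.adjoint A (expVec 0) - expVec 0‖ ≤ μ := by
    have h1 : A (ContinuousLinearMap.adjoint A (expVec 0)) = expVec 0 :=
      congrArg (fun B : Fock K →L[ℂ] Fock K => B (expVec 0)) (Unitary.coe_mul_star_self (U y))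
    rw [← hAn, map_sub, h1, norm_sub_rev]
    exact h0
  have herr := norm_inner_expVec_sub_le A (fun f => (hAn f).le) h0 h0'
    (a := a) (b := b) (by linarith) (by linarith)
  have hc1 : ‖vacEl A - 1‖ ≤ 1 / 2 := by
    rw [← inner_vac_expVec (0 : K)]
    unfold vacEl
    rw [← inner_sub_right]
    refine (norm_inner_le_norm _ _).trans ?_
    rw [norm_vac, one_mul]
    exact h0.trans hμ
  have hc2 : 1 / 2 ≤ ‖vacEl A‖ := by
    have h1 := norm_sub_norm_le (1 : ℂ) (vacEl A)
    rw [norm_sub_rev, norm_one] at h1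
    linarith
  have hc0 : vacEl A ≠ 0 := fun h => by rw [h, norm_zero] at hc2; linarith
  have hci : ‖(vacEl A)⁻¹‖ ≤ 2 := by
    rw [norm_inv, inv_le_comm₀ (by linarith) two_pos]; linarith
  have ha1 : ‖(inner ℂ (onePart a) (A (expVec 0)) : ℂ)‖ ≤ ‖a‖ * μ := by
    have h1 : (inner ℂ (onePart a) (A (expVec 0)) : ℂ) =
        inner ℂ (onePart a) (A (expVec 0) - expVec 0) := by
      rw [inner_sub_right, inner_onePart_vac, sub_zero]
    rw [h1]
    refine (norm_inner_le_norm _ _).trans ?_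
    rw [onePart.norm_map]
    gcongr
  have hb1 : ‖(inner ℂ (expVec 0) (A (onePart b)) : ℂ)‖ ≤ μ * ‖b‖ := by
    have h1 : (inner ℂ (expVec 0) (A (onePart b)) : ℂ) =
        inner ℂ (ContinuousLinearMap.adjoint A (expVec 0) - expVec 0) (onePart b) := by
      rw [inner_sub_left, inner_vac_onePart, sub_zero, ContinuousLinearMap.adjoint_inner_left]
    rw [h1]
    refine (norm_inner_le_norm _ _).trans ?_
    rw [onePart.norm_map]
    gcongr
  have hab : ‖(inner ℂ (onePart a) (A (onePart b)) : ℂ)‖ ≤ ‖a‖ * ‖b‖ := by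
    refine (norm_inner_le_norm _ _).trans ?_
    rw [hAn, onePart.norm_map, onePart.norm_map]
  have hvac : (inner ℂ (expVec 0) (A (expVec 0)) : ℂ) = vacEl A := rfl
  rw [hvac] at herr
  generalize (inner ℂ (onePart a) (A (expVec 0)) : ℂ) = p at *
  generalize (inner ℂ (expVec 0) (A (onePart b)) : ℂ) = q at *
  generalize (inner ℂ (onePart a) (A (onePart b)) : ℂ) = r at *
  generalize (inner ℂ (expVec a) (A (expVec b)) : ℂ) = F at *
  generalize vacEl A = c at *
  have hE : ∀ E : ℂ, ‖E‖ ≤ ‖a‖ ^ 2 * (μ + 2 * ‖b‖) + ‖b‖ ^ 2 * (μ + ‖a‖) →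
      ‖c⁻¹ * E‖ ≤ 2 * (‖a‖ ^ 2 * (3 * μ) + ‖b‖ ^ 2 * (2 * μ)) := fun E hE => by
    rw [norm_mul]
    refine mul_le_mul hci (hE.trans ?_) (norm_nonneg _) two_pos.le
    gcongr <;> linarith
  have hE' := hE _ herr
  have hp : ‖c⁻¹ * p‖ ≤ 2 * (‖a‖ * μ) := by
    rw [norm_mul]; exact mul_le_mul hci ha1 (norm_nonneg _) two_pos.le
  have hq : ‖c⁻¹ * q‖ ≤ 2 * (μ * ‖b‖) := by
    rw [norm_mul]; exact mul_le_mul hci hb1 (norm_nonneg _) two_pos.le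
  have hr : ‖c⁻¹ * r‖ ≤ 2 * (‖a‖ * ‖b‖) := by
    rw [norm_mul]; exact mul_le_mul hci hab (norm_nonneg _) two_pos.le
  have na := norm_nonneg a
  have nb := norm_nonneg b
  constructor
  · -- the product of the one-particle components is the part removed in the connected block
    have e : c⁻¹ * F - 1 - (c⁻¹ * p + c⁻¹ * q + (c⁻¹ * r - c⁻¹ * p * (c⁻¹ * q))) =
        (c⁻¹ * p) * (c⁻¹ * q) + c⁻¹ * (F - (c + p + q + r)) := by
      field_simp
      ring
    rw [e]
    refine (norm_add_le _ _).trans ?_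
    rw [norm_mul]
    have h1 := mul_le_mul hp hq (norm_nonneg _) (by positivity)
    have h2 : 2 * (‖a‖ * μ) * (2 * (μ * ‖b‖)) ≤ 2 * μ * (‖a‖ ^ 2 + ‖b‖ ^ 2) := by
      nlinarith [mul_nonneg hμ0 (sq_nonneg (‖a‖ - ‖b‖)), mul_nonneg hμ0 (mul_nonneg na nb),
        mul_nonneg (mul_nonneg hμ0 (sub_nonneg.2 hμ)) (mul_nonneg na nb)]
    nlinarith [mul_nonneg hμ0 (sq_nonneg ‖a‖), mul_nonneg hμ0 (sq_nonneg ‖b‖)]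
  · have e : c⁻¹ * F - 1 = c⁻¹ * p + c⁻¹ * q + c⁻¹ * r + c⁻¹ * (F - (c + p + q + r)) := by
      field_simp
      ring
    have h1 : ‖c⁻¹ * F - 1‖ ≤ 8 * μ * (‖a‖ + ‖b‖) := by
      rw [e]
      refine (norm_add_le _ _).trans ?_
      have h2 := norm_add₃_le (a := c⁻¹ * p) (b := c⁻¹ * q) (c := c⁻¹ * r)
      have h3 : ‖a‖ * ‖b‖ ≤ μ * ‖b‖ := mul_le_mul_of_nonneg_right hξ nb
      have h4 : ‖a‖ ^ 2 * μ ≤ ‖a‖ * μ := by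
        refine mul_le_mul_of_nonneg_right ?_ hμ0
        nlinarith
      have h5 : ‖b‖ ^ 2 * μ ≤ ‖b‖ * μ := by
        refine mul_le_mul_of_nonneg_right ?_ hμ0
        nlinarith
      nlinarith
    calc ‖c⁻¹ * F - 1‖ ^ 2 ≤ (8 * μ * (‖a‖ + ‖b‖)) ^ 2 := by gcongr
      _ = 64 * μ * μ * (‖a‖ + ‖b‖) ^ 2 := by ring
      _ ≤ 64 * μ * 1 * (2 * (‖a‖ ^ 2 + ‖b‖ ^ 2)) := by
        gcongr
        · linarith
        · nlinarith [sq_nonneg (‖a‖ - ‖b‖)]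
      _ = 128 * μ * (‖a‖ ^ 2 + ‖b‖ ^ 2) := by ring

end IsometricRep

namespace IsometricRep

variable {d : ℕ} {P : PointedCone ℝ (EuclideanSpace ℝ (Fin d))}
variable {K : Type u} [NormedAddCommGroup K] [InnerProductSpace ℂ K] [CompleteSpace K]
variable {V : IsometricRep P K}

section Cocycle

variable {U : P → unitary (Fock K →L[ℂ] Fock K)} (hU : IsGaugeCocycle V.ccrFlow U)
  (hcont : V.IsStrictlyContinuous)

include hU hcont

/-- The matrix elements of a gauge cocycle between exponential vectors over `ker V_x*` are
exponentials of expressions of degree one in each variable: subdividing `x` into `n` steps turns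
them into products of `n` factors to which the short step estimate applies. -/
theorem inner_expVec_proj_gauge (x : P) (ξ η : K) :
    (inner ℂ (expVec (V.proj x ξ)) ((U x : Fock K →L[ℂ] Fock K) (expVec (V.proj x η))) : ℂ) =
      vacEl (U x : Fock K →L[ℂ] Fock K) * Complex.exp (gaugeExponent V U x ξ η) := by
  set M : ℝ := ‖ξ‖ ^ 2 + ‖η‖ ^ 2 with hM
  have hM0 : 0 ≤ M := by positivity
  let ξi : ℕ → ℕ → K := fun n i => ContinuousLinearMap.adjoint (V (i • divPt x n)) ξ
  let ηi : ℕ → ℕ → K := fun n i => ContinuousLinearMap.adjoint (V (i • divPt x n)) η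
  let z : ℕ → ℕ → ℂ := fun n i => (vacEl (U (divPt x n) : Fock K →L[ℂ] Fock K))⁻¹ *
    inner ℂ (expVec (V.proj (divPt x n) (ξi n i)))
      ((U (divPt x n) : Fock K →L[ℂ] Fock K) (expVec (V.proj (divPt x n) (ηi n i)))) - 1
  have hsum : ∀ n, ∑ i ∈ Finset.range n, (‖V.proj (divPt x n) (ξi n i)‖ ^ 2 +
      ‖V.proj (divPt x n) (ηi n i)‖ ^ 2) ≤ M := fun n => by
    rw [Finset.sum_add_distrib]
    exact add_le_add (V.sum_norm_sq_proj_le _ _ _) (V.sum_norm_sq_proj_le _ _ _)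
  have hev : ∀ μ : ℝ, 0 < μ → μ ≤ 1 / 2 → ∀ᶠ n in Filter.atTop,
      ‖∑ i ∈ Finset.range n, z n i - gaugeExponent V U x ξ η‖ ≤ 8 * μ * M ∧
      ∑ i ∈ Finset.range n, ‖z n i‖ ^ 2 ≤ 128 * μ * M := by
    intro μ hμ hμ2
    have hU0 := ((hU.continuous (expVec 0)).tendsto 0).comp (tendsto_divPt x)
    rw [gauge_zero hU, one_apply_eq_self, tendsto_iff_norm_sub_tendsto_zero] at hU0
    filter_upwards [eventually_norm_proj_le hcont x ξ hμ, eventually_norm_proj_le hcont x η hμ,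
      hU0.eventually (ge_mem_nhds hμ), Filter.eventually_ne_atTop 0] with n h1 h2 h3 hn0
    have hstep := fun i (hi : i ∈ Finset.range n) =>
      gauge_step_estimate (V := V) U (divPt x n) hμ2 h3 (ξi n i) (ηi n i) (h1 i hi) (h2 i hi)
    constructor
    · have e : gaugeExponent V U x ξ η =
          ∑ i ∈ Finset.range n, gaugeExponent V U (divPt x n) (ξi n i) (ηi n i) := by
        conv_lhs => rw [← nsmul_divPt_self x hn0]
        exact gaugeExponent_nsmul hU _ _ _ _
      rw [e, ← Finset.sum_sub_distrib]
      refine (norm_sum_le _ _).trans ((Finset.sum_le_sum fun i hi => (hstep i hi).1).trans ?_)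
      rw [← Finset.mul_sum]
      exact mul_le_mul_of_nonneg_left (hsum n) (by positivity)
    · refine (Finset.sum_le_sum fun i hi => (hstep i hi).2).trans ?_
      rw [← Finset.mul_sum]
      exact mul_le_mul_of_nonneg_left (hsum n) (by positivity)
  have hsmall : ∀ C ε : ℝ, 0 ≤ C → 0 < ε → ∃ μ : ℝ, 0 < μ ∧ μ ≤ 1 / 2 ∧ C * μ < ε := by
    intro C ε hC hε
    refine ⟨min (1 / 2) (ε / (C + 1)), by positivity, min_le_left _ _, ?_⟩
    calc C * min (1 / 2) (ε / (C + 1)) ≤ C * (ε / (C + 1)) := by gcongr; exact min_le_right _ _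
      _ = ε * (C / (C + 1)) := by ring
      _ < ε * 1 := by gcongr; rw [div_lt_one (by positivity)]; linarith
      _ = ε := mul_one ε
  have hlim := tendsto_prod_one_add_of_tendsto_sum (z := z) (s := gaugeExponent V U x ξ η)
    (by
      rw [Metric.tendsto_nhds]
      intro ε hε
      obtain ⟨μ, h0, h1, h2⟩ := hsmall (128 * M) ε (by positivity) hε
      filter_upwards [hev μ h0 h1] with n hn
      rw [dist_zero_right, Real.norm_of_nonneg (Finset.sum_nonneg fun _ _ => by positivity)]
      exact hn.2.trans_lt (by linarith))
    (by
      rw [Metric.tendsto_nhds]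
      intro ε hε
      obtain ⟨μ, h0, h1, h2⟩ := hsmall (8 * M) ε (by positivity) hε
      filter_upwards [hev μ h0 h1] with n hn
      rw [dist_eq_norm]
      exact hn.1.trans_lt (by linarith))
  have hconst : ∀ᶠ n in Filter.atTop, ∏ i ∈ Finset.range n, (1 + z n i) =
      (vacEl (U x : Fock K →L[ℂ] Fock K))⁻¹ *
        inner ℂ (expVec (V.proj x ξ)) ((U x : Fock K →L[ℂ] Fock K) (expVec (V.proj x η))) := by
    filter_upwards [Filter.eventually_ne_atTop 0] with n hn0
    have e1 := inner_expVec_proj_gauge_nsmul hU (divPt x n) ξ η n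
    have e2 := vacEl_gauge_nsmul hU (divPt x n) n
    rw [nsmul_divPt_self x hn0] at e1 e2
    rw [e1, e2, ← inv_pow]
    simp only [z, add_sub_cancel]
    rw [Finset.prod_mul_distrib, Finset.prod_const, Finset.card_range]
  have h := tendsto_nhds_unique (hlim.congr' hconst) tendsto_const_nhds
  rw [h, mul_inv_cancel_left₀ (vacEl_gauge_ne_zero hU x)]

theorem inner_expVec_gauge (x : P) (ξ η : K) :
    (inner ℂ (expVec ξ) ((U x : Fock K →L[ℂ] Fock K) (expVec η)) : ℂ) =
      vacEl (U x : Fock K →L[ℂ] Fock K) *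
        Complex.exp (inner ℂ ξ (shiftVec (U x : Fock K →L[ℂ] Fock K)) +
          inner ℂ (shiftVec (ContinuousLinearMap.adjoint (U x : Fock K →L[ℂ] Fock K))) η +
          inner ℂ ξ (linPart (U x : Fock K →L[ℂ] Fock K) η)) := by
  have h1 := inner_expVec_mul (gauge_commute hU x) 1 ξ η
  have h2 := inner_linPart_mul (gauge_commute hU x) 1 (vacEl_gauge_ne_zero hU x)
    (by rw [vacEl_one]; exact one_ne_zero) (V.kerPart x ξ) (V.kerPart x η)
    (ContinuousLinearMap.adjoint (V x) ξ) (ContinuousLinearMap.adjoint (V x) η)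
  rw [map_one, mul_one] at h1 h2
  rw [one_apply_eq_self, inner_expVec] at h1
  rw [V.coe_kerPart, V.coe_kerPart, proj_add_map_adjoint, proj_add_map_adjoint, linPart_one,
    one_apply_eq_self] at h2
  have h3 : (inner ℂ ξ (shiftVec (U x : Fock K →L[ℂ] Fock K)) : ℂ) =
      inner ℂ (V.proj x ξ) (shiftVec (U x : Fock K →L[ℂ] Fock K)) := by
    conv_lhs => rw [← V.proj_add_map_adjoint x ξ]
    rw [inner_add_left, V.inner_map_of_adjoint_eq_zero (adjoint_shiftVec (gauge_commute hU x)),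
      add_zero]
  have h4 : (inner ℂ (shiftVec (ContinuousLinearMap.adjoint (U x : Fock K →L[ℂ] Fock K))) η : ℂ) =
      inner ℂ (shiftVec (ContinuousLinearMap.adjoint (U x : Fock K →L[ℂ] Fock K)))
        (V.proj x η) := by
    conv_lhs => rw [← V.proj_add_map_adjoint x η]
    rw [inner_add_right, V.inner_of_adjoint_eq_zero_map
      (adjoint_shiftVec (commute_adjoint (gauge_commute hU x))), add_zero]
  rw [h1, inner_expVec_proj_gauge hU hcont, mul_assoc, ← Complex.exp_add, h2, h3, h4]
  unfold gaugeExponent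
  congr 2
  ring

/-- A gauge cocycle acts on exponential vectors by affine maps of `K`. -/
theorem gauge_apply_expVec (x : P) (η : K) :
    (U x : Fock K →L[ℂ] Fock K) (expVec η) =
      (vacEl (U x : Fock K →L[ℂ] Fock K) *
        Complex.exp (inner ℂ (shiftVec (ContinuousLinearMap.adjoint
          (U x : Fock K →L[ℂ] Fock K))) η)) •
      expVec (shiftVec (U x : Fock K →L[ℂ] Fock K) +
        linPart (U x : Fock K →L[ℂ] Fock K) η) :=
  ext_inner_expVec fun ξ => by
    rw [inner_expVec_gauge hU hcont, inner_smul_right, inner_expVec, mul_assoc, ← Complex.exp_add,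
      inner_add_right]
    congr 2
    ring

end Cocycle

end IsometricRep

/-! ### Isometries acting affinely on exponential vectors -/

section Affine

variable {K : Type u} [NormedAddCommGroup K] [InnerProductSpace ℂ K]

theorem eq_zero_of_forall_exp_mul_eq_one {κ : ℂ} (h : ∀ z : ℂ, Complex.exp (z * κ) = 1) :
    κ = 0 := by
  by_contra hκ
  have h1 := h κ⁻¹
  rw [inv_mul_cancel₀ hκ, Complex.exp_eq_one_iff] at h1
  have h2 := h (κ⁻¹ * (Real.log 2 : ℝ))
  rw [mul_right_comm, inv_mul_cancel₀ hκ, one_mul, ← Complex.ofReal_exp,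
    Real.exp_log two_pos] at h2
  norm_num at h2

/-- An isometry of the form `e(η) ↦ c exp⟨k|η⟩ e(h + w η)`: the operator `w` is isometric, `k` is
determined by `h` and `w`, and `c` is determined by `h` up to a phase. -/
theorem affine_isometry {A : Fock K → Fock K} {c : ℂ} {k h : K} {w : K →L[ℂ] K}
    (hA : ∀ f g, (inner ℂ (A f) (A g) : ℂ) = inner ℂ f g)
    (hAe : ∀ η, A (expVec η) = (c * Complex.exp (inner ℂ k η)) • expVec (h + w η)) :
    ‖c‖ * Real.exp (‖h‖ ^ 2 / 2) = 1 ∧ (∀ η, (inner ℂ k η : ℂ) = -inner ℂ h (w η)) ∧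
      ∀ ξ η, (inner ℂ (w ξ) (w η) : ℂ) = inner ℂ ξ η := by
  have key : ∀ ξ η, Complex.exp (inner ℂ ξ η) = (starRingEnd ℂ c * c) *
      Complex.exp (starRingEnd ℂ (inner ℂ k ξ) + inner ℂ k η + inner ℂ (h + w ξ) (h + w η)) := by
    intro ξ η
    rw [← inner_expVec, ← hA, hAe, hAe, inner_smul_left, inner_smul_right, inner_expVec, map_mul,
      ← Complex.exp_conj, Complex.exp_add, Complex.exp_add]
    ring
  have h00 := key 0 0
  simp only [map_zero, inner_zero_right, add_zero, Complex.exp_zero, zero_add] at h00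
  have hk : ∀ η, (inner ℂ k η : ℂ) = -inner ℂ h (w η) := by
    intro η
    refine eq_neg_of_add_eq_zero_left (eq_zero_of_forall_exp_mul_eq_one fun z => ?_)
    have h1 := key 0 (z • η)
    rw [inner_zero_left, inner_zero_right, map_zero, map_zero, add_zero, zero_add, inner_add_right,
      map_smul, inner_smul_right, inner_smul_right, Complex.exp_zero] at h1
    have h2 : z * ((inner ℂ k η : ℂ) + inner ℂ h (w η)) + inner ℂ h h =
      z * inner ℂ k η + (inner ℂ h h + z * inner ℂ h (w η)) := by ring
    rw [← h2, Complex.exp_add, mul_left_comm, ← h00, mul_one] at h1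
    exact h1.symm
  refine ⟨?_, hk, fun ξ η => ?_⟩
  · have h1 := congrArg (‖·‖) h00
    simp only [norm_mul, RCLike.norm_conj, norm_one, Complex.norm_exp] at h1
    have h2 : ((inner ℂ h h : ℂ)).re = ‖h‖ ^ 2 := by
      rw [inner_self_eq_ofReal_norm_sq, Complex.ofReal_re]
    rw [h2] at h1
    have h3 : (‖c‖ * Real.exp (‖h‖ ^ 2 / 2)) ^ 2 = 1 := by
      rw [mul_pow, ← Real.exp_nat_mul]
      rw [h1]
      push_cast
      rw [mul_div_cancel₀ _ (two_ne_zero)]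
      ring
    exact (pow_eq_one_iff_of_nonneg (by positivity) two_ne_zero).1 h3
  · refine (sub_eq_zero.1 (eq_zero_of_forall_exp_mul_eq_one fun z => ?_)).symm
    have h1 := key ξ (z • η)
    rw [hk, hk, inner_smul_right, map_smul, inner_add_left, inner_add_right, inner_add_right,
      inner_smul_right, inner_smul_right, map_neg, inner_conj_symm] at h1
    have h2 : -(inner ℂ (w ξ) h : ℂ) + -(z * inner ℂ h (w η)) + (inner ℂ h h +
        z * inner ℂ h (w η) + (inner ℂ (w ξ) h + z * inner ℂ (w ξ) (w η))) =
        inner ℂ h h + z * inner ℂ (w ξ) (w η) := by ring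
    rw [h2, Complex.exp_add, ← mul_assoc, ← h00, one_mul] at h1
    rw [mul_sub, Complex.exp_sub, h1, div_self (Complex.exp_ne_zero _)]

end Affine

/-! ### Characters of a cone -/

section Character

/-- A unimodular one-parameter group that stays close to `1` on `[0, 1]` has a small frequency. -/
theorem abs_le_of_norm_exp_sub_one_le {s ε : ℝ} (hε : ε ≤ 1 / 2)
    (h : ∀ t ∈ Set.Icc (0 : ℝ) 1, ‖Complex.exp (Complex.I * (t * s : ℝ)) - 1‖ ≤ ε) :
    |s| ≤ 2 * ε := by
  have key : ∀ a : ℝ, 0 ≤ a → a ≤ 1 → 1 / 2 * a ≤ ‖Complex.exp (Complex.I * (a : ℝ)) - 1‖ := by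
    intro a ha ha1
    rw [Complex.norm_exp_I_mul_ofReal_sub_one]
    have h1 := Real.mul_le_sin (x := a / 2) (by linarith) (by linarith [Real.two_le_pi])
    have h2 : 1 / 2 ≤ 2 / Real.pi := by
      rw [div_le_div_iff₀ two_pos Real.pi_pos]; linarith [Real.pi_le_four]
    have h3 : 1 / 2 * (a / 2) ≤ 2 / Real.pi * (a / 2) := by gcongr
    refine le_trans ?_ (le_abs_self _)
    linarith
  have hsym : ∀ a : ℝ, ‖Complex.exp (Complex.I * (a : ℝ)) - 1‖ =
      ‖Complex.exp (Complex.I * (|a| : ℝ)) - 1‖ := by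
    intro a
    rw [Complex.norm_exp_I_mul_ofReal_sub_one, Complex.norm_exp_I_mul_ofReal_sub_one]
    rcases abs_choice a with h | h
    · rw [h]
    · rw [h, neg_div, Real.sin_neg, mul_neg, norm_neg]
  by_cases hs : |s| ≤ 1
  · have h1 := h 1 ⟨zero_le_one, le_rfl⟩
    rw [one_mul, hsym] at h1
    linarith [key _ (abs_nonneg s) hs]
  · -- at the time `1 / |s|` the argument is `±1`, and `e^{±i}` is too far from `1`
    push Not at hs
    have h0 : 0 < |s| := by linarith
    have h1 := h |s|⁻¹ ⟨by positivity, inv_le_one_of_one_le₀ hs.le⟩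
    rw [hsym, abs_mul, abs_inv, abs_abs, inv_mul_cancel₀ h0.ne',
      Complex.norm_exp_I_mul_ofReal_sub_one] at h1
    have h2 : Real.sin (1 / 2) ≤ 1 / 4 := by
      have := (le_abs_self _).trans (h1.trans hε)
      linarith
    have h3 := Real.sin_gt_sub_cube (x := 1 / 2) (by norm_num)
    norm_num at h3
    linarith

/-- Lift the one-parameter group through the covering `ℝ → Circle`; the lift is additive and
continuous, hence linear. -/
theorem exists_frequency {f : ℝ → ℂ} (hf : Continuous f) (hadd : ∀ s t, f (s + t) = f s * f t)
    (hn : ∀ t, ‖f t‖ = 1) : ∃ s : ℝ, ∀ t : ℝ, f t = Complex.exp (Complex.I * (t * s : ℝ)) := by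
  let F : C(ℝ, Circle) := ⟨fun t => ⟨f t, mem_sphere_zero_iff_norm.2 (hn t)⟩, hf.subtype_mk _⟩
  have hF : ∀ s t, F (s + t) = F s * F t := fun s t => Subtype.ext (hadd s t)
  have hF0 : F 0 = 1 := by
    have h := hF 0 0
    rw [add_zero] at h
    exact (mul_eq_left.1 h.symm)
  obtain ⟨Γ, ⟨h0, hΓ⟩, -⟩ := Circle.isCoveringMap_exp.existsUnique_continuousMap_lifts F
    (a₀ := 0) (e₀ := 0) (by rw [Circle.exp_zero, hF0])
  have hΓ' : ∀ t, Circle.exp (Γ t) = F t := fun t => congrFun hΓ t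
  let G : ℝ →+ ℝ :=
    { toFun := Γ
      map_zero' := h0
      map_add' := fun s t => by
        have h1 : (fun t => Γ (s + t)) = fun t => Γ s + Γ t := by
          refine Circle.isCoveringMap_exp.eq_of_comp_eq
            (Γ.continuous.comp (continuous_const.add continuous_id))
            (continuous_const.add Γ.continuous) ?_ 0 (by rw [add_zero, h0, add_zero])
          funext t
          simp only [Function.comp_apply]
          rw [hΓ', Circle.exp_add, hΓ', hΓ', hF]
        exact congrFun h1 t }
  refine ⟨Γ 1, fun t => ?_⟩
  have h1 := map_real_smul G Γ.continuous t 1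
  rw [smul_eq_mul, mul_one, smul_eq_mul] at h1
  change Γ t = t * Γ 1 at h1
  have h2 := congrArg (fun z : Circle => (z : ℂ)) (hΓ' t)
  simp only [Circle.coe_exp, h1] at h2
  rw [mul_comm]
  exact h2.symm

variable {d : ℕ} {P : PointedCone ℝ (EuclideanSpace ℝ (Fin d))}

theorem rayPt_add_left (x y : P) (t : ℝ) : rayPt (x + y) t = rayPt x t + rayPt y t :=
  smul_add _ _ _

theorem rayPt_smul (x : P) (c : {t : ℝ // 0 ≤ t}) {t : ℝ} (ht : 0 ≤ t) :
    rayPt (c • x) t = rayPt x (t * c) :=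
  Subtype.ext (by
    rw [coe_rayPt, coe_rayPt, max_eq_left ht, max_eq_left (mul_nonneg ht c.2), mul_smul]
    rfl)

theorem rayPt_max (x : P) (t : ℝ) : rayPt x (max t 0) = rayPt x t :=
  Subtype.ext (by rw [coe_rayPt, coe_rayPt, max_eq_left (le_max_right _ _)])

/-- A continuous multiplicative function on the cone with values in the unit circle is a character
on each ray. -/
theorem exists_frequency_ray {χ : P → ℂ} (hc : Continuous χ) (hmul : ∀ x y, χ (x + y) = χ x * χ y)
    (hn : ∀ x, ‖χ x‖ = 1) (x : P) :
    ∃ s : ℝ, ∀ t : ℝ, 0 ≤ t → χ (rayPt x t) = Complex.exp (Complex.I * (t * s : ℝ)) := by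
  have hconj : ∀ y, χ y * starRingEnd ℂ (χ y) = 1 := fun y => by
    rw [Complex.mul_conj, Complex.normSq_eq_norm_sq, hn]; norm_num
  have hz : χ 0 = 1 := by
    have h := hmul 0 0
    rw [add_zero] at h
    have h0 : χ 0 ≠ 0 := fun h => by have := hn 0; rw [h, norm_zero] at this; exact zero_ne_one this
    exact (mul_eq_left₀ h0).1 h.symm
  -- the multiplicative extension of `χ` from the ray to the line
  let f : ℝ → ℂ := fun t => χ (rayPt x t) * starRingEnd ℂ (χ (rayPt x (-t)))
  have hm : ∀ s t, f (s + t) = f s * f t := by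
    intro s t
    have h1 : rayPt x (s + t) + (rayPt x (-s) + rayPt x (-t)) =
        rayPt x (-(s + t)) + (rayPt x s + rayPt x t) := by
      apply Subtype.ext
      simp only [Submodule.coe_add, coe_rayPt, ← add_smul]
      congr 1
      have e : ∀ z : ℝ, max z 0 = z + max (-z) 0 := fun z => by
        rcases le_total z 0 with h | h
        · rw [max_eq_right h, max_eq_left (neg_nonneg.2 h)]; ring
        · rw [max_eq_left h, max_eq_right (neg_nonpos.2 h)]; ring
      rw [e (s + t), e s, e t]
      ring
    have h2 := congrArg χ h1
    simp only [hmul] at h2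
    have a1 := hconj (rayPt x (-s))
    have a2 := hconj (rayPt x (-t))
    have a3 := hconj (rayPt x (-(s + t)))
    simp only [f]
    linear_combination (starRingEnd ℂ (χ (rayPt x (-s))) * starRingEnd ℂ (χ (rayPt x (-t))) *
      starRingEnd ℂ (χ (rayPt x (-(s + t))))) * h2 -
      χ (rayPt x (s + t)) * starRingEnd ℂ (χ (rayPt x (-(s + t)))) *
        (χ (rayPt x (-t)) * starRingEnd ℂ (χ (rayPt x (-t)))) * a1 -
      χ (rayPt x (s + t)) * starRingEnd ℂ (χ (rayPt x (-(s + t)))) * a2 +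
      χ (rayPt x s) * χ (rayPt x t) * starRingEnd ℂ (χ (rayPt x (-s))) *
        starRingEnd ℂ (χ (rayPt x (-t))) * a3
  obtain ⟨s, hs⟩ := exists_frequency (f := f)
    ((hc.comp (continuous_rayPt x)).mul
      (Complex.continuous_conj.comp (hc.comp ((continuous_rayPt x).comp continuous_neg)))) hm
    (fun t => by simp only [f, norm_mul, RCLike.norm_conj, hn, mul_one])
  refine ⟨s, fun t ht => ?_⟩
  rw [← hs t]
  have h1 : rayPt x (-t) = 0 := by
    rw [← rayPt_max, max_eq_right (neg_nonpos.2 ht), rayPt_zero]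
  simp only [f, h1, hz, map_one, mul_one]

theorem frequency_unique {s s' : ℝ} (h : ∀ t : ℝ, 0 ≤ t →
    Complex.exp (Complex.I * (t * s : ℝ)) = Complex.exp (Complex.I * (t * s' : ℝ))) : s = s' := by
  have h1 := abs_le_of_norm_exp_sub_one_le (s := s - s') (ε := 0) (by norm_num) fun t ht => by
    rw [mul_sub, Complex.ofReal_sub, mul_sub, Complex.exp_sub, h t ht.1,
      div_self (Complex.exp_ne_zero _), sub_self, norm_zero]
  rw [mul_zero] at h1
  exact sub_eq_zero.1 (abs_eq_zero.1 (le_antisymm h1 (abs_nonneg _)))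

/-- An additive positively homogeneous function on a spanning cone is given by a vector. -/
theorem exists_inner_eq [hP : IsSolidCone P] (l : P → ℝ) (hadd : ∀ x y, l (x + y) = l x + l y)
    (hsmul : ∀ (c : {t : ℝ // 0 ≤ t}) x, l (c • x) = c * l x) :
    ∃ v : EuclideanSpace ℝ (Fin d), ∀ x : P, l x = inner ℝ v (x : EuclideanSpace ℝ (Fin d)) := by
  choose p hp q hq hpq using hP.spanning
  have key : ∀ a b c e : P, (a : EuclideanSpace ℝ (Fin d)) - b = c - e → l a - l b = l c - l e := by
    intro a b c e h
    have h1 : a + e = c + b := Subtype.ext (by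
      rw [Submodule.coe_add, Submodule.coe_add]
      exact sub_eq_sub_iff_add_eq_add.1 h)
    have h2 := congrArg l h1
    rw [hadd, hadd] at h2
    linarith
  let L : EuclideanSpace ℝ (Fin d) →ₗ[ℝ] ℝ :=
    { toFun := fun x => l ⟨p x, hp x⟩ - l ⟨q x, hq x⟩
      map_add' := fun x y => by
        have h1 := key ⟨p (x + y), hp _⟩ ⟨q (x + y), hq _⟩ (⟨p x, hp x⟩ + ⟨p y, hp y⟩)
          (⟨q x, hq x⟩ + ⟨q y, hq y⟩) (by
            show p (x + y) - q (x + y) = (p x + p y) - (q x + q y)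
            rw [← hpq, add_sub_add_comm, ← hpq, ← hpq])
        rw [h1, hadd, hadd]
        ring
      map_smul' := fun c x => by
        rw [RingHom.id_apply, smul_eq_mul]
        rcases le_total 0 c with hc | hc
        · have h1 := key ⟨p (c • x), hp _⟩ ⟨q (c • x), hq _⟩
            ((⟨c, hc⟩ : {t : ℝ // 0 ≤ t}) • ⟨p x, hp x⟩)
            ((⟨c, hc⟩ : {t : ℝ // 0 ≤ t}) • ⟨q x, hq x⟩) (by
              show p (c • x) - q (c • x) = c • p x - c • q x
              rw [← hpq, ← smul_sub, ← hpq])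
          rw [h1, hsmul, hsmul]
          ring
        · have h1 := key ⟨p (c • x), hp _⟩ ⟨q (c • x), hq _⟩
            ((⟨-c, neg_nonneg.2 hc⟩ : {t : ℝ // 0 ≤ t}) • ⟨q x, hq x⟩)
            ((⟨-c, neg_nonneg.2 hc⟩ : {t : ℝ // 0 ≤ t}) • ⟨p x, hp x⟩) (by
              show p (c • x) - q (c • x) = (-c) • q x - (-c) • p x
              rw [← hpq, ← smul_sub, neg_smul, ← smul_neg, neg_sub, ← hpq])
          rw [h1, hsmul, hsmul]
          ring }
  refine ⟨(InnerProductSpace.toDual ℝ _).symm (LinearMap.toContinuousLinearMap L), fun x => ?_⟩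
  rw [InnerProductSpace.toDual_symm_apply]
  show l x = l ⟨p x, hp x⟩ - l ⟨q x, hq x⟩
  have h1 := key x 0 ⟨p x, hp x⟩ ⟨q x, hq x⟩ (by
    rw [Submodule.coe_zero, sub_zero]; exact hpq x)
  have h2 := hadd 0 0
  rw [add_zero] at h2
  linarith

theorem exists_character [IsSolidCone P] {χ : P → ℂ} (hc : Continuous χ)
    (hmul : ∀ x y, χ (x + y) = χ x * χ y) (hn : ∀ x, ‖χ x‖ = 1) :
    ∃ v : EuclideanSpace ℝ (Fin d), ∀ x : P,
      χ x = Complex.exp (Complex.I * (inner ℝ v (x : EuclideanSpace ℝ (Fin d)) : ℝ)) := by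
  choose l hl using exists_frequency_ray hc hmul hn
  obtain ⟨v, hv⟩ := exists_inner_eq l
    (fun x y => frequency_unique fun t ht => by
      rw [← hl _ t ht, rayPt_add_left, hmul, hl _ t ht, hl _ t ht, ← Complex.exp_add]
      push_cast
      ring_nf)
    (fun c x => frequency_unique fun t ht => by
      rw [← hl _ t ht, rayPt_smul x c ht, hl _ _ (mul_nonneg ht c.2), mul_assoc])
  refine ⟨v, fun x => ?_⟩
  have h1 := hl x 1 zero_le_one
  rwa [rayPt_one, one_mul, hv] at h1

theorem exists_interior [hP : IsSolidCone P] :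
    ∃ a : P, (a : EuclideanSpace ℝ (Fin d)) ∈ interior (P : Set (EuclideanSpace ℝ (Fin d))) := by
  have hconv : Convex ℝ (P : Set (EuclideanSpace ℝ (Fin d))) := fun x hx y hy a b ha hb _ =>
    P.add_mem (P.smul_mem ha hx) (P.smul_mem hb hy)
  have h : (interior (P : Set (EuclideanSpace ℝ (Fin d)))).Nonempty := by
    rw [hconv.interior_nonempty_iff_affineSpan_eq_top, eq_top_iff]
    intro x _
    obtain ⟨p, hp, q, hq, rfl⟩ := hP.spanning x
    have h1 := AffineSubspace.vadd_mem_of_mem_direction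
      (AffineSubspace.vsub_mem_direction (subset_affineSpan ℝ _ hp) (subset_affineSpan ℝ _ hq))
      (subset_affineSpan ℝ _ P.zero_mem)
    simpa using h1
  obtain ⟨a, ha⟩ := h
  exact ⟨⟨a, interior_subset ha⟩, ha⟩

end Character

/-! ### The unitary of the commutant attached to a gauge cocycle -/

namespace IsometricRep

variable {d : ℕ} {P : PointedCone ℝ (EuclideanSpace ℝ (Fin d))}
variable {K : Type u} [NormedAddCommGroup K] [InnerProductSpace ℂ K] [CompleteSpace K]

theorem norm_adjoint_le (V : IsometricRep P K) (x : P) (ξ : K) :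
    ‖ContinuousLinearMap.adjoint (V x) ξ‖ ≤ ‖ξ‖ := by
  have h := V.norm_sq_proj x ξ
  exact abs_le_of_sq_le_sq' (by linarith [sq_nonneg ‖V.proj x ξ‖]) (norm_nonneg _) |>.2

theorem norm_adjoint_nsmul_antitone (V : IsometricRep P K) (a : P) (ξ : K) :
    Antitone fun n : ℕ => ‖ContinuousLinearMap.adjoint (V (n • a)) ξ‖ :=
  antitone_nat_of_succ_le fun n => by
    rw [succ_nsmul, adjoint_add]
    exact V.norm_adjoint_le _ _

/-- For a pure representation, `V_{na}* → 0` strongly for every interior point `a`. -/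
theorem tendsto_adjoint_nsmul {V : IsometricRep P K} (hpure : V.IsPure) {a : P}
    (ha : (a : EuclideanSpace ℝ (Fin d)) ∈ interior (P : Set (EuclideanSpace ℝ (Fin d)))) (ξ : K) :
    Filter.Tendsto (fun n : ℕ => ContinuousLinearMap.adjoint (V (n • a)) ξ) Filter.atTop
      (nhds 0) := by
  let S : Submodule ℂ K :=
    { carrier := {ξ | Filter.Tendsto (fun n : ℕ => ContinuousLinearMap.adjoint (V (n • a)) ξ)
        Filter.atTop (nhds 0)}
      zero_mem' := by
        show Filter.Tendsto _ _ _
        simp only [map_zero]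
        exact tendsto_const_nhds
      add_mem' := fun {ξ η} hξ hη => by
        have h := Filter.Tendsto.add hξ hη
        rw [add_zero] at h
        refine h.congr fun n => ?_
        rw [_root_.map_add]
      smul_mem' := fun c ξ hξ => by
        have h := Filter.Tendsto.const_smul hξ c
        rw [smul_zero] at h
        refine h.congr fun n => ?_
        rw [map_smul] }
  have hclosed : IsClosed (S : Set K) := by
    refine isClosed_of_closure_subset fun ξ hξ => ?_
    show Filter.Tendsto _ _ _
    rw [Metric.tendsto_atTop]
    intro ε hε
    obtain ⟨η, hη, hd⟩ := Metric.mem_closure_iff.1 hξ (ε / 2) (half_pos hε)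
    obtain ⟨N, hN⟩ := Metric.tendsto_atTop.1 (show Filter.Tendsto _ _ _ from hη) (ε / 2)
      (half_pos hε)
    refine ⟨N, fun n hn => ?_⟩
    have h1 := hN n hn
    rw [dist_zero_right] at h1 ⊢
    have h2 := V.norm_adjoint_le (n • a) (ξ - η)
    rw [map_sub, ← dist_eq_norm ξ η] at h2
    have h3 := norm_sub_norm_le (ContinuousLinearMap.adjoint (V (n • a)) ξ)
      (ContinuousLinearMap.adjoint (V (n • a)) η)
    linarith
  have hker : ∀ (n : ℕ) (ξ : K), ContinuousLinearMap.adjoint (V (n • a)) ξ = 0 → ξ ∈ S := by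
    intro n ξ h0
    refine tendsto_const_nhds.congr' ?_
    filter_upwards [Filter.eventually_ge_atTop n] with m hm
    have h1 := V.norm_adjoint_nsmul_antitone a ξ hm
    simp only [h0, norm_zero] at h1
    exact (norm_le_zero_iff.1 h1).symm
  -- a vector orthogonal to all `ker V_{na}*` is in the range of all `V_{na}`, hence of all `V_{ta}`
  have horth : Sᗮ = ⊥ := by
    rw [Submodule.eq_bot_iff]
    intro η hη
    have hr : ∀ n : ℕ, V (n • a) (ContinuousLinearMap.adjoint (V (n • a)) η) = η := by
      intro n
      have h1 := (Submodule.mem_orthogonal _ _).1 hη _ (hker n _ (V.adjoint_proj (n • a) η))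
      have h2 : (inner ℂ (V.proj (n • a) η) (V.proj (n • a) η) : ℂ) = 0 := by
        conv_lhs => enter [3]; rw [V.proj_apply (n • a) η]
        rw [inner_sub_right, h1, V.inner_of_adjoint_eq_zero_map (V.adjoint_proj _ _), sub_zero]
      have h3 := inner_self_eq_zero.1 h2
      rw [proj_apply] at h3
      exact (sub_eq_zero.1 h3).symm
    have h4 : η ∈ ⋂ t : {t : ℝ // 0 ≤ t}, Set.range (V (t • a)) := by
      refine Set.mem_iInter.2 fun t => ?_
      obtain ⟨n, hn⟩ := exists_nat_ge (t : ℝ)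
      have h5 : n • a = t • a + (⟨n - t, sub_nonneg.2 hn⟩ : {t : ℝ // 0 ≤ t}) • a :=
        Subtype.ext (by
          show (n • a : EuclideanSpace ℝ (Fin d)) =
            (t : ℝ) • (a : EuclideanSpace ℝ (Fin d)) +
              ((n : ℝ) - t) • (a : EuclideanSpace ℝ (Fin d))
          rw [← add_smul, add_sub_cancel, Nat.cast_smul_eq_nsmul])
      rw [← hr n, h5, V.map_add, mul_apply_eq_comp]
      exact ⟨_, rfl⟩
    rw [hpure a ha] at h4
    exact h4
  have htop := S.topologicalClosure_eq_top_iff.2 horth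
  rw [hclosed.submodule_topologicalClosure_eq] at htop
  have : ξ ∈ S := htop ▸ Submodule.mem_top
  exact this

theorem tendsto_proj_nsmul {V : IsometricRep P K} (hpure : V.IsPure) {a : P}
    (ha : (a : EuclideanSpace ℝ (Fin d)) ∈ interior (P : Set (EuclideanSpace ℝ (Fin d)))) (ξ : K) :
    Filter.Tendsto (fun n : ℕ => V.proj (n • a) ξ) Filter.atTop (nhds ξ) := by
  rw [tendsto_iff_norm_sub_tendsto_zero]
  have h := (tendsto_adjoint_nsmul hpure ha ξ).norm
  rw [norm_zero] at h
  refine h.congr fun n => ?_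
  rw [proj_apply, sub_sub_cancel_left, norm_neg, norm_map]

/-- Isometries `w_x` that act trivially on the range of `V_x` and are compatible with addition in
`P` agree on `ker V_x*` with one isometry `u` commuting with all `V_x`: the strong limit of `w_{na}`
for an interior point `a`. -/
theorem exists_limit_isometry [IsSolidCone P] {V : IsometricRep P K} (hpure : V.IsPure)
    (w : P → K →L[ℂ] K) (hw : ∀ x ξ η, (inner ℂ (w x ξ) (w x η) : ℂ) = inner ℂ ξ η)
    (hV : ∀ x b, w x (V x b) = V x b)
    (hadd : ∀ x y ξ, w (x + y) ξ = w x (V.proj x ξ) +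
      V x (w y (ContinuousLinearMap.adjoint (V x) ξ))) :
    ∃ u : K →L[ℂ] K, (∀ ξ η, (inner ℂ (u ξ) (u η) : ℂ) = inner ℂ ξ η) ∧
      (∀ x ξ, u (V x ξ) = V x (u ξ)) ∧ ∀ x ξ, w x (V.proj x ξ) = u (V.proj x ξ) := by
  obtain ⟨a, ha⟩ := exists_interior (P := P)
  have hn : ∀ x ξ, ‖w x ξ‖ = ‖ξ‖ := fun x ξ => by
    rw [norm_eq_sqrt_re_inner (𝕜 := ℂ), hw, ← norm_eq_sqrt_re_inner (𝕜 := ℂ)]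
  have hdiff : ∀ x y ξ, ‖w (x + y) ξ - w x ξ‖ ≤ 2 * ‖ContinuousLinearMap.adjoint (V x) ξ‖ := by
    intro x y ξ
    have h1 : w x ξ = w x (V.proj x ξ) + V x (ContinuousLinearMap.adjoint (V x) ξ) := by
      conv_lhs => rw [← V.proj_add_map_adjoint x ξ]
      rw [_root_.map_add, hV]
    rw [hadd, h1, add_sub_add_left_eq_sub, ← map_sub, norm_map]
    refine (norm_sub_le _ _).trans ?_
    rw [hn]
    linarith
  have hV0 : ∀ ξ, Filter.Tendsto
      (fun n : ℕ => 2 * ‖ContinuousLinearMap.adjoint (V (n • a)) ξ‖) Filter.atTop (nhds 0) := by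
    intro ξ
    have h := ((tendsto_adjoint_nsmul hpure ha ξ).norm).const_mul 2
    rwa [norm_zero, mul_zero] at h
  have hge : ∀ (N n : ℕ), N ≤ n → ∀ ξ,
      ‖w (n • a) ξ - w (N • a) ξ‖ ≤ 2 * ‖ContinuousLinearMap.adjoint (V (N • a)) ξ‖ := by
    intro N n h ξ
    obtain ⟨k, rfl⟩ := Nat.exists_eq_add_of_le h
    rw [add_nsmul]
    exact hdiff _ _ _
  have hex : ∀ ξ, ∃ l, Filter.Tendsto (fun n : ℕ => w (n • a) ξ) Filter.atTop (nhds l) := by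
    intro ξ
    refine cauchySeq_tendsto_of_complete (cauchySeq_of_le_tendsto_0
      (fun N => 2 * ‖ContinuousLinearMap.adjoint (V (N • a)) ξ‖ +
        2 * ‖ContinuousLinearMap.adjoint (V (N • a)) ξ‖) (fun n m N hn hm => ?_) ?_)
    · refine (dist_triangle_right _ _ (w (N • a) ξ)).trans ?_
      rw [dist_eq_norm, dist_eq_norm]
      exact add_le_add (hge _ _ hn _) (hge _ _ hm _)
    · have := (hV0 ξ).add (hV0 ξ)
      rwa [add_zero] at this
  choose l hl using hex
  have hln : ∀ ξ, ‖l ξ‖ = ‖ξ‖ := fun ξ =>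
    tendsto_nhds_unique (hl ξ).norm (tendsto_const_nhds.congr fun n => (hn _ _).symm)
  let L : K →ₗ[ℂ] K :=
    { toFun := l
      map_add' := fun ξ η => tendsto_nhds_unique (hl _)
        (((hl ξ).add (hl η)).congr fun n => (_root_.map_add _ _ _).symm)
      map_smul' := fun c ξ => tendsto_nhds_unique (hl _)
        (((hl ξ).const_smul c).congr fun n => (map_smul _ _ _).symm) }
  let u : K →L[ℂ] K := (⟨L, hln⟩ : K →ₗᵢ[ℂ] K).toContinuousLinearMap
  have hu : ∀ ξ, u ξ = l ξ := fun ξ => rfl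
  have hlim : ∀ (x : P) ξ, Filter.Tendsto (fun n : ℕ => w (x + n • a) ξ) Filter.atTop
      (nhds (u ξ)) := by
    intro x ξ
    have h1 : Filter.Tendsto (fun n : ℕ => w (x + n • a) ξ - w (n • a) ξ) Filter.atTop
        (nhds 0) := by
      refine squeeze_zero_norm (fun n => ?_) (hV0 ξ)
      rw [add_comm]
      exact hdiff _ _ _
    have h2 := h1.add (hl ξ)
    rw [zero_add] at h2
    exact h2.congr fun n => sub_add_cancel _ _
  refine ⟨u, fun ξ η => ?_, fun x ξ => ?_, fun x ξ => ?_⟩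
  · exact tendsto_nhds_unique (((hl ξ).inner (hl η)))
      (tendsto_const_nhds.congr fun n => (hw _ _ _).symm)
  · refine tendsto_nhds_unique (hlim x (V x ξ)) ?_
    refine (((V x).continuous.tendsto _).comp (hl ξ)).congr fun n => ?_
    rw [hadd, proj_map, map_zero, zero_add, adjoint_map]
    rfl
  · refine tendsto_nhds_unique ?_ (hlim x (V.proj x ξ))
    refine tendsto_const_nhds.congr fun n => ?_
    rw [hadd, adjoint_proj, map_zero, map_zero, add_zero,
      V.proj_of_adjoint_eq_zero (V.adjoint_proj _ _)]

/-- Two mutually inverse families as in `exists_limit_isometry` give a unitary of `M_V`. -/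
theorem exists_unitary_commutant [IsSolidCone P] {V : IsometricRep P K} (hpure : V.IsPure)
    (w w' : P → K →L[ℂ] K) (hw : ∀ x ξ η, (inner ℂ (w x ξ) (w x η) : ℂ) = inner ℂ ξ η)
    (hV : ∀ x b, w x (V x b) = V x b)
    (hadd : ∀ x y ξ, w (x + y) ξ = w x (V.proj x ξ) +
      V x (w y (ContinuousLinearMap.adjoint (V x) ξ)))
    (hw' : ∀ x ξ η, (inner ℂ (w' x ξ) (w' x η) : ℂ) = inner ℂ ξ η)
    (hV' : ∀ x b, w' x (V x b) = V x b)
    (hadd' : ∀ x y ξ, w' (x + y) ξ = w' x (V.proj x ξ) +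
      V x (w' y (ContinuousLinearMap.adjoint (V x) ξ)))
    (hinv : ∀ x ξ, w x (w' x ξ) = ξ) :
    ∃ u : unitary V.commutant, ∀ x ξ, w x ξ = V.gaugeUnitary u x ξ := by
  obtain ⟨u, hu1, hu2, hu3⟩ := exists_limit_isometry hpure w hw hV hadd
  obtain ⟨u', hu1', hu2', hu3'⟩ := exists_limit_isometry hpure w' hw' hV' hadd'
  obtain ⟨a, ha⟩ := exists_interior (P := P)
  have hproj : ∀ x ξ, V.proj x (w' x (V.proj x ξ)) = w' x (V.proj x ξ) := fun x ξ =>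
    V.proj_of_adjoint_eq_zero (ext_inner_left ℂ fun b => by
      rw [ContinuousLinearMap.adjoint_inner_right, ← hV' x b, hw',
        V.inner_map_of_adjoint_eq_zero (V.adjoint_proj _ _), inner_zero_right])
  have huu' : ∀ ξ, u (u' ξ) = ξ := by
    intro ξ
    have h1 := tendsto_proj_nsmul hpure ha ξ
    refine tendsto_nhds_unique (((u.continuous.comp u'.continuous).tendsto ξ).comp h1) ?_
    refine h1.congr fun n => ?_
    simp only [Function.comp_apply]
    rw [← hu3', ← hproj, ← hu3, hproj, hinv]
  have hsu : star u * u = 1 := ContinuousLinearMap.ext fun ξ => ext_inner_left ℂ fun η => by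
    rw [mul_apply_eq_comp, ContinuousLinearMap.star_eq_adjoint,
      ContinuousLinearMap.adjoint_inner_right, hu1]
    rfl
  have hmul' : u * u' = 1 := ContinuousLinearMap.ext huu'
  have hsu' : star u = u' := by
    rw [← mul_one (star u), ← hmul', ← mul_assoc, hsu, one_mul]
  have hus : u * star u = 1 := by rw [hsu', hmul']
  have hcomm : ∀ x, V x * u = u * V x := fun x =>
    ContinuousLinearMap.ext fun ξ => (hu2 x ξ).symm
  have hcomm' : ∀ x, V x * u' = u' * V x := fun x =>
    ContinuousLinearMap.ext fun ξ => (hu2' x ξ).symm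
  have hmem : u ∈ V.commutant := by
    refine (StarSubalgebra.mem_centralizer_iff ℂ).2 ?_
    rintro _ ⟨x, rfl⟩
    refine ⟨hcomm x, ?_⟩
    have h := congrArg star (hcomm' x)
    rw [star_mul, star_mul, ← hsu', star_star] at h
    exact h.symm
  refine ⟨⟨⟨u, hmem⟩, Unitary.mem_iff.2 ⟨Subtype.ext hsu, Subtype.ext hus⟩⟩, fun x ξ => ?_⟩
  show w x ξ = u (V.proj x ξ) + (ξ - V.proj x ξ)
  conv_lhs => rw [← V.proj_add_map_adjoint x ξ]
  rw [_root_.map_add, hu3, hV, V.proj_apply x ξ, sub_sub_cancel]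

end IsometricRep

/-! ### Classification of gauge cocycles -/

namespace IsometricRep

variable {d : ℕ} {P : PointedCone ℝ (EuclideanSpace ℝ (Fin d))}
variable {K : Type u} [NormedAddCommGroup K] [InnerProductSpace ℂ K] [CompleteSpace K]
variable {V : IsometricRep P K}

/-- The operator `e^{i⟨λ|x⟩} W(h_x) Γ(u E_x + 1 - E_x)` attached to `(λ, h, u)`. -/
noncomputable def gaugeOp (g : V.GV) (x : P) : Fock K →L[ℂ] Fock K :=
  Complex.exp (Complex.I * (inner ℝ g.lam (x : EuclideanSpace ℝ (Fin d)) : ℝ)) •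
    ((weyl (g.coc.1 x) : Fock K →L[ℂ] Fock K) *
      (secondQuant (V.gaugeUnitary g.uni x) : Fock K →L[ℂ] Fock K))

theorem gaugeOp_expVec (g : V.GV) (x : P) (η : K) : gaugeOp g x (expVec η) =
    (Complex.exp (Complex.I * (inner ℝ g.lam (x : EuclideanSpace ℝ (Fin d)) : ℝ)) *
      Complex.exp (-((‖g.coc.1 x‖ : ℂ) ^ 2 / 2) -
        inner ℂ (g.coc.1 x) (V.gaugeUnitary g.uni x η))) •
      expVec (g.coc.1 x + V.gaugeUnitary g.uni x η) := by
  have h : gaugeOp g x (expVec η) =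
      Complex.exp (Complex.I * (inner ℝ g.lam (x : EuclideanSpace ℝ (Fin d)) : ℝ)) •
        weyl (g.coc.1 x) (secondQuant (V.gaugeUnitary g.uni x) (expVec η)) := rfl
  rw [h, secondQuant_expVec, weyl_expVec, smul_smul]

theorem gaugeUnitary_apply (u : unitary V.commutant) (x : P) (ξ : K) :
    V.gaugeUnitary u x ξ = opOf u (V.proj x ξ) + V x (ContinuousLinearMap.adjoint (V x) ξ) := by
  show opOf u (V.proj x ξ) + (ξ - V.proj x ξ) = _
  rw [V.proj_apply x ξ, sub_sub_cancel]

section Cocycle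

variable {U : P → unitary (Fock K →L[ℂ] Fock K)} (hU : IsGaugeCocycle V.ccrFlow U)

include hU

theorem linPart_gauge_map (x : P) (b : K) :
    linPart (U x : Fock K →L[ℂ] Fock K) (V x b) = V x b :=
  ext_inner_left ℂ fun ξ => by
    have h := inner_linPart_mul (gauge_commute hU x) 1 (vacEl_gauge_ne_zero hU x)
      (by rw [vacEl_one]; exact one_ne_zero) (V.kerPart x ξ) 0
      (ContinuousLinearMap.adjoint (V x) ξ) b
    rwa [map_one, mul_one, V.coe_kerPart, proj_add_map_adjoint, linPart_one, one_apply_eq_self,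
      Submodule.coe_zero, zero_add, map_zero, inner_zero_right, zero_add,
      ContinuousLinearMap.adjoint_inner_left] at h

theorem continuous_shiftVec : Continuous fun x => shiftVec (U x : Fock K →L[ℂ] Fock K) :=
  ((continuous_vacEl hU).inv₀ (vacEl_gauge_ne_zero hU)).smul
    (onePartAdj.continuous.comp (hU.continuous _))

/-- The additive cocycle `x ↦ h_x` of a gauge cocycle. -/
noncomputable def gaugeShift : V.addCocycles :=
  ⟨⟨fun x => shiftVec (U x : Fock K →L[ℂ] Fock K), continuous_shiftVec hU⟩,
    fun x => adjoint_shiftVec (gauge_commute hU x), fun x y => (shiftVec_gauge_add hU x y).symm⟩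

variable (hcont : V.IsStrictlyContinuous)

include hcont

theorem affine_isometry_gauge (x : P) :
    ‖vacEl (U x : Fock K →L[ℂ] Fock K)‖ *
        Real.exp (‖shiftVec (U x : Fock K →L[ℂ] Fock K)‖ ^ 2 / 2) = 1 ∧
      (∀ η, (inner ℂ (shiftVec (ContinuousLinearMap.adjoint (U x : Fock K →L[ℂ] Fock K))) η : ℂ) =
        -inner ℂ (shiftVec (U x : Fock K →L[ℂ] Fock K))
          (linPart (U x : Fock K →L[ℂ] Fock K) η)) ∧
      ∀ ξ η, (inner ℂ (linPart (U x : Fock K →L[ℂ] Fock K) ξ)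
        (linPart (U x : Fock K →L[ℂ] Fock K) η) : ℂ) = inner ℂ ξ η :=
  affine_isometry (A := (U x : Fock K →L[ℂ] Fock K)) (fun f g => Unitary.inner_map_map (U x) f g)
    (gauge_apply_expVec hU hcont x)

theorem linPart_gauge_add (x y : P) (ξ : K) :
    linPart (U (x + y) : Fock K →L[ℂ] Fock K) ξ =
      linPart (U x : Fock K →L[ℂ] Fock K) (V.proj x ξ) +
      V x (linPart (U y : Fock K →L[ℂ] Fock K) (ContinuousLinearMap.adjoint (V x) ξ)) :=
  ext_inner_left ℂ fun η => by
    have h := inner_linPart_gauge_add hU x y (V.kerPart x η) (V.kerPart x ξ)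
      (ContinuousLinearMap.adjoint (V x) η) (ContinuousLinearMap.adjoint (V x) ξ)
    rw [V.coe_kerPart, V.coe_kerPart, proj_add_map_adjoint, proj_add_map_adjoint] at h
    have h2 : (inner ℂ (V x (ContinuousLinearMap.adjoint (V x) η))
        (linPart (U x : Fock K →L[ℂ] Fock K) (V.proj x ξ)) : ℂ) = 0 := by
      rw [← linPart_gauge_map hU, (affine_isometry_gauge hU hcont x).2.2,
        V.inner_map_of_adjoint_eq_zero (V.adjoint_proj _ _)]
    rw [h, inner_add_right, ← ContinuousLinearMap.adjoint_inner_left (V x)]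
    congr 1
    conv_rhs => rw [← V.proj_add_map_adjoint x η]
    rw [inner_add_left, h2, add_zero]

theorem linPart_gauge_inv (x : P) (ξ : K) :
    linPart (U x : Fock K →L[ℂ] Fock K) (linPart (U⁻¹ x : Fock K →L[ℂ] Fock K) ξ) = ξ := by
  have hinv := gauge_apply_expVec (isGaugeCocycle_inv hU) hcont x
  have hcoe : (U⁻¹ x : Fock K →L[ℂ] Fock K) =
    ContinuousLinearMap.adjoint (U x : Fock K →L[ℂ] Fock K) := rfl
  rw [hcoe] at hinv ⊢
  have key : ∀ η, η = shiftVec (U x : Fock K →L[ℂ] Fock K) + linPart (U x : Fock K →L[ℂ] Fock K)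
      (shiftVec (ContinuousLinearMap.adjoint (U x : Fock K →L[ℂ] Fock K)) +
        linPart (ContinuousLinearMap.adjoint (U x : Fock K →L[ℂ] Fock K)) η) := by
    intro η
    have h1 : (U x : Fock K →L[ℂ] Fock K)
        (ContinuousLinearMap.adjoint (U x : Fock K →L[ℂ] Fock K) (expVec η)) = expVec η :=
      congrArg (fun B : Fock K →L[ℂ] Fock K => B (expVec η)) (Unitary.coe_mul_star_self (U x))
    rw [hinv, map_smul, gauge_apply_expVec hU hcont, smul_smul] at h1
    exact (eq_of_expVec_eq_smul h1.symm).2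
  have h0 := key 0
  have h1 := key ξ
  rw [map_zero, add_zero] at h0
  rw [_root_.map_add, ← add_assoc, ← h0, zero_add] at h1
  exact h1.symm

theorem exists_gaugeUnitary [IsSolidCone P] (hpure : V.IsPure) :
    ∃ u : unitary V.commutant, ∀ x ξ,
      linPart (U x : Fock K →L[ℂ] Fock K) ξ = V.gaugeUnitary u x ξ :=
  exists_unitary_commutant hpure (fun x => linPart (U x : Fock K →L[ℂ] Fock K))
    (fun x => linPart (U⁻¹ x : Fock K →L[ℂ] Fock K))
    (fun x => (affine_isometry_gauge hU hcont x).2.2) (linPart_gauge_map hU)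
    (linPart_gauge_add hU hcont)
    (fun x => (affine_isometry_gauge (isGaugeCocycle_inv hU) hcont x).2.2)
    (linPart_gauge_map (isGaugeCocycle_inv hU))
    (linPart_gauge_add (isGaugeCocycle_inv hU) hcont) (linPart_gauge_inv hU hcont)

theorem exists_gaugePhase [IsSolidCone P] : ∃ v : EuclideanSpace ℝ (Fin d), ∀ x : P,
    vacEl (U x : Fock K →L[ℂ] Fock K) =
      Complex.exp (Complex.I * (inner ℝ v (x : EuclideanSpace ℝ (Fin d)) : ℝ)) *
        Complex.exp (-((‖shiftVec (U x : Fock K →L[ℂ] Fock K)‖ : ℂ) ^ 2 / 2)) := by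
  obtain ⟨v, hv⟩ := exists_character (P := P) (χ := fun x => vacEl (U x : Fock K →L[ℂ] Fock K) *
      Complex.exp ((‖shiftVec (U x : Fock K →L[ℂ] Fock K)‖ : ℂ) ^ 2 / 2))
    ((continuous_vacEl hU).mul (Complex.continuous_exp.comp
      (((Complex.continuous_ofReal.comp (continuous_shiftVec hU).norm).pow 2).div_const 2)))
    (fun x y => by
      have h := inner_cocycle_add (gaugeShift hU) (gaugeShift hU) x y
      have e : ∀ z, (inner ℂ ((gaugeShift hU).1 z) ((gaugeShift hU).1 z) : ℂ) =
          (‖shiftVec (U z : Fock K →L[ℂ] Fock K)‖ : ℂ) ^ 2 := fun z =>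
        inner_self_eq_norm_sq_to_K _
      rw [e, e, e] at h
      rw [vacEl_gauge_add hU, h, add_div, Complex.exp_add]
      ring)
    (fun x => by
      have h := (affine_isometry_gauge hU hcont x).1
      rw [norm_mul, Complex.norm_exp]
      have e : ((‖shiftVec (U x : Fock K →L[ℂ] Fock K)‖ : ℂ) ^ 2 / 2).re =
          ‖shiftVec (U x : Fock K →L[ℂ] Fock K)‖ ^ 2 / 2 := by
        have e2 : ((‖shiftVec (U x : Fock K →L[ℂ] Fock K)‖ : ℂ) ^ 2 / 2) =
          ((‖shiftVec (U x : Fock K →L[ℂ] Fock K)‖ ^ 2 / 2 : ℝ) : ℂ) := by push_cast; rfl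
        rw [e2, Complex.ofReal_re]
      rw [e, h])
  refine ⟨v, fun x => ?_⟩
  rw [← hv x, mul_assoc, ← Complex.exp_add, add_neg_cancel, Complex.exp_zero, mul_one]

/-- Every gauge cocycle is of the form `e^{i⟨λ|x⟩} W(h_x) Γ(u E_x + 1 - E_x)`. -/
theorem exists_gaugeOp_eq [IsSolidCone P] (hpure : V.IsPure) :
    ∃ g : V.GV, ∀ x, (U x : Fock K →L[ℂ] Fock K) = gaugeOp g x := by
  obtain ⟨u, hu⟩ := exists_gaugeUnitary hU hcont hpure
  obtain ⟨v, hv⟩ := exists_gaugePhase hU hcont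
  refine ⟨⟨v, gaugeShift hU, u⟩, fun x => clm_ext_expVec fun η => ?_⟩
  rw [gaugeOp_expVec, gauge_apply_expVec hU hcont, hv, ← hu,
    (affine_isometry_gauge hU hcont x).2.1, mul_assoc, ← Complex.exp_add, ← sub_eq_add_neg]
  rfl

end Cocycle

/-! ### The gauge cocycle of an element of `G_V` -/

theorem inner_gaugeUnitary (u : unitary V.commutant) (x : P) (ξ η : K) :
    (inner ℂ (V.gaugeUnitary u x ξ) (V.gaugeUnitary u x η) : ℂ) = inner ℂ ξ η :=
  (V.gaugeUnitary u x).inner_map_map ξ η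

theorem opOf_map (u : unitary V.commutant) (x : P) (ξ : K) : opOf u (V x ξ) = V x (opOf u ξ) :=
  commutant_apply _ _ _

theorem adjoint_opOf (u : unitary V.commutant) (x : P) (ξ : K) :
    ContinuousLinearMap.adjoint (V x) (opOf u ξ) = opOf u (ContinuousLinearMap.adjoint (V x) ξ) :=
  (commutant_adjoint_apply _ _ _).symm

theorem gaugeUnitary_map (u : unitary V.commutant) (x : P) (b : K) :
    V.gaugeUnitary u x (V x b) = V x b := by
  rw [gaugeUnitary_apply, proj_map, map_zero, zero_add, adjoint_map]

theorem gaugeUnitary_of_adjoint_eq_zero (u : unitary V.commutant) {x : P} {a : K}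
    (ha : ContinuousLinearMap.adjoint (V x) a = 0) : V.gaugeUnitary u x a = opOf u a := by
  rw [gaugeUnitary_apply, V.proj_of_adjoint_eq_zero ha, ha, map_zero, add_zero]

theorem gaugeUnitary_add (u : unitary V.commutant) (x y : P) (ξ : K) :
    V.gaugeUnitary u (x + y) ξ = opOf u (V.proj x ξ) +
      V x (V.gaugeUnitary u y (ContinuousLinearMap.adjoint (V x) ξ)) := by
  rw [gaugeUnitary_apply, gaugeUnitary_apply, proj_add, adjoint_add, V.map_add, mul_apply_eq_comp,
    _root_.map_add, _root_.map_add, opOf_map, add_assoc]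

theorem gaugeUnitary_mul (u v : unitary V.commutant) (x : P) (ξ : K) :
    V.gaugeUnitary (u * v) x ξ = V.gaugeUnitary u x (V.gaugeUnitary v x ξ) := by
  have h : ContinuousLinearMap.adjoint (V x) (opOf v (V.proj x ξ)) = 0 := by
    rw [adjoint_opOf, adjoint_proj, map_zero]
  rw [gaugeUnitary_apply v, _root_.map_add, gaugeUnitary_map, gaugeUnitary_of_adjoint_eq_zero u h,
    gaugeUnitary_apply (u * v)]
  rfl

theorem adjoint_coc (h : V.addCocycles) (x : P) : ContinuousLinearMap.adjoint (V x) (h.1 x) = 0 :=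
  h.2.1 x

/-- The operator `q ↦ p ⊗ q`. -/
noncomputable def htmulLeft {E F : Type u} [NormedAddCommGroup E] [InnerProductSpace ℂ E]
    [NormedAddCommGroup F] [InnerProductSpace ℂ F] (p : E) : F →L[ℂ] HTensor E F :=
  ⟨(HTensor.emb E F).toLinearMap ∘ₗ TensorProduct.mk ℂ E F p,
    (HTensor.emb E F).continuous.comp
      (TensorProduct.continuous_tmul.comp (continuous_const.prodMk continuous_id))⟩

/-- `U_x` acts on `e(a) ⊗ q` through its first factor. -/
theorem gaugeOp_fockDecomp (g : V.GV) (x : P) (a : V.kerAdj x) :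
    ∃ (z : ℂ) (a' : V.kerAdj x), ∀ q : Fock K,
      gaugeOp g x (V.fockDecomp x (htmul (expVec a) q)) =
        z • V.fockDecomp x (htmul (expVec a') q) := by
  have ha' : g.coc.1 x + opOf g.uni (a : K) ∈ V.kerAdj x := by
    rw [mem_kerAdj, _root_.map_add, adjoint_coc, adjoint_opOf, (V.mem_kerAdj x _).1 a.2, map_zero,
      add_zero]
  obtain ⟨z, hz⟩ : ∃ z : ℂ, z =
    Complex.exp (Complex.I * (inner ℝ g.lam (x : EuclideanSpace ℝ (Fin d)) : ℝ)) *
      Complex.exp (-((‖g.coc.1 x‖ : ℂ) ^ 2 / 2) - inner ℂ (g.coc.1 x) (opOf g.uni (a : K))) :=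
    ⟨_, rfl⟩
  refine ⟨z, ⟨_, ha'⟩, fun q => ?_⟩
  have hw : V.gaugeUnitary g.uni x (a : K) = opOf g.uni (a : K) :=
    gaugeUnitary_of_adjoint_eq_zero _ ((V.mem_kerAdj x _).1 a.2)
  -- both sides are continuous and linear in `q`, so exponential vectors suffice
  let L : V.kerAdj x → Fock K →L[ℂ] Fock K := fun a =>
    (V.fockDecomp x : HTensor (Fock (V.kerAdj x)) (Fock K) →L[ℂ] Fock K) ∘L
      htmulLeft (expVec a)
  have key : gaugeOp g x ∘L L a = z • L ⟨_, ha'⟩ := by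
    refine clm_ext_expVec fun b => ?_
    show gaugeOp g x (V.fockDecomp x (htmul (expVec a) (expVec b))) =
      z • V.fockDecomp x (htmul (expVec ⟨_, ha'⟩) (expVec b))
    rw [fockDecomp_htmul, fockDecomp_htmul, gaugeOp_expVec, _root_.map_add, gaugeUnitary_map,
      hw, inner_add_right, V.inner_of_adjoint_eq_zero_map (adjoint_coc _ _), add_zero, ← add_assoc,
      hz]
  exact congrArg (fun A : Fock K →L[ℂ] Fock K => A q) key

theorem gaugeOp_commute (g : V.GV) (x : P) (T : Fock K →L[ℂ] Fock K) :
    gaugeOp g x * V.ccrFlow x T = V.ccrFlow x T * gaugeOp g x := by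
  refine clm_ext_expVec fun ξ => ?_
  rw [mul_apply_eq_comp, mul_apply_eq_comp, V.expVec_eq_fockDecomp x ξ]
  obtain ⟨z, a', h⟩ := gaugeOp_fockDecomp g x (V.kerPart x ξ)
  rw [ccrFlow_htmul, h, h, map_smul, ccrFlow_htmul]

theorem gaugeOp_mul_ccrFlow (g : V.GV) (x y : P) :
    gaugeOp g x * V.ccrFlow x (gaugeOp g y) = gaugeOp g (x + y) := by
  refine clm_ext_expVec fun ξ => ?_
  set b := ContinuousLinearMap.adjoint (V x) ξ with hb
  have h1 : V.ccrFlow x (gaugeOp g y) (expVec ξ) =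
      (Complex.exp (Complex.I * (inner ℝ g.lam (y : EuclideanSpace ℝ (Fin d)) : ℝ)) *
        Complex.exp (-((‖g.coc.1 y‖ : ℂ) ^ 2 / 2) -
          inner ℂ (g.coc.1 y) (V.gaugeUnitary g.uni y b))) •
        expVec (V.proj x ξ + V x (g.coc.1 y + V.gaugeUnitary g.uni y b)) := by
    rw [V.expVec_eq_fockDecomp x ξ, ccrFlow_htmul, gaugeOp_expVec, htmul_smul_right, map_smul,
      fockDecomp_htmul]
    rfl
  have h2 : V.gaugeUnitary g.uni x (V.proj x ξ) = opOf g.uni (V.proj x ξ) :=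
    gaugeUnitary_of_adjoint_eq_zero _ (V.adjoint_proj _ _)
  have h3 : ContinuousLinearMap.adjoint (V x) (opOf g.uni (V.proj x ξ)) = 0 := by
    rw [adjoint_opOf, adjoint_proj, map_zero]
  have h4 : ((‖g.coc.1 (x + y)‖ : ℂ)) ^ 2 = (‖g.coc.1 x‖ : ℂ) ^ 2 + (‖g.coc.1 y‖ : ℂ) ^ 2 := by
    have h := inner_cocycle_add g.coc g.coc x y
    have e : ∀ z, (inner ℂ (g.coc.1 z) (g.coc.1 z) : ℂ) = (‖g.coc.1 z‖ : ℂ) ^ 2 := fun z =>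
      inner_self_eq_norm_sq_to_K _
    rwa [e, e, e] at h
  rw [mul_apply_eq_comp, h1, map_smul, gaugeOp_expVec, gaugeOp_expVec, smul_smul]
  have h5 : g.coc.1 (x + y) = g.coc.1 x + V x (g.coc.1 y) := (g.coc.2.2 x y).symm
  rw [h4, h5, gaugeUnitary_add, ← hb, _root_.map_add (V.gaugeUnitary g.uni x), gaugeUnitary_map, h2,
    _root_.map_add (V x)]
  congr 1
  · rw [← Complex.exp_add, ← Complex.exp_add, ← Complex.exp_add, ← Complex.exp_add]
    congr 1
    simp only [inner_add_left, inner_add_right, V.inner_map_map,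
      V.inner_of_adjoint_eq_zero_map (adjoint_coc _ _), V.inner_map_of_adjoint_eq_zero h3,
      Submodule.coe_add]
    push_cast
    ring
  · congr 1
    abel

/-- The gauge cocycles multiply by the group law of `G_V`: the term `-Im c(h, u g)` is the phase in
the Weyl relation `W(h) W(u g) = e^{-i Im⟨h|u g⟩} W(h + u g)`. -/
theorem gaugeOp_mul [IsSolidCone P] (g g' : V.GV) (x : P) :
    gaugeOp (g * g') x = gaugeOp g x * gaugeOp g' x := by
  refine clm_ext_expVec fun ξ => ?_
  have hlam : (g * g').lam = g.lam + g'.lam - imVec (pairing g.coc (actOn g.uni g'.coc)) := rfl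
  have hcoc : (g * g').coc.1 x = g.coc.1 x + opOf g.uni (g'.coc.1 x) := rfl
  have huni : (g * g').uni = g.uni * g'.uni := rfl
  have hw : V.gaugeUnitary g.uni x (g'.coc.1 x) = opOf g.uni (g'.coc.1 x) :=
    gaugeUnitary_of_adjoint_eq_zero _ (adjoint_coc _ _)
  have him : inner ℝ (imVec (pairing g.coc (actOn g.uni g'.coc)))
      (x : EuclideanSpace ℝ (Fin d)) = (inner ℂ (g.coc.1 x) (opOf g.uni (g'.coc.1 x)) : ℂ).im := by
    have h := pairing_spec g.coc (actOn g.uni g'.coc) x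
    rw [actOn_apply] at h
    rw [h, Complex.im_sum, PiLp.inner_apply]
    refine Finset.sum_congr rfl fun i _ => ?_
    rw [Complex.im_ofReal_mul]
    rfl
  have hself : ∀ v : K, (inner ℂ v v : ℂ) = (‖v‖ : ℂ) ^ 2 := fun v => inner_self_eq_norm_sq_to_K v
  have hnorm : (‖g.coc.1 x + opOf g.uni (g'.coc.1 x)‖ : ℂ) ^ 2 = (‖g.coc.1 x‖ : ℂ) ^ 2 +
      (‖g'.coc.1 x‖ : ℂ) ^ 2 + (inner ℂ (g.coc.1 x) (opOf g.uni (g'.coc.1 x)) +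
        starRingEnd ℂ (inner ℂ (g.coc.1 x) (opOf g.uni (g'.coc.1 x)))) := by
    rw [← hself, ← hself, ← hself, inner_conj_symm, inner_add_left, inner_add_right,
      inner_add_right, inner_opOf]
    ring
  have hpoly : (inner ℂ (g'.coc.1 x) (V.gaugeUnitary g'.uni x ξ) : ℂ) =
      inner ℂ (opOf g.uni (g'.coc.1 x))
        (V.gaugeUnitary g.uni x (V.gaugeUnitary g'.uni x ξ)) := by
    rw [← hw, inner_gaugeUnitary]
  rw [mul_apply_eq_comp, gaugeOp_expVec, gaugeOp_expVec, map_smul, gaugeOp_expVec, smul_smul,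
    hlam, hcoc, huni, gaugeUnitary_mul, _root_.map_add (V.gaugeUnitary g.uni x), hw, hnorm, hpoly,
    ← add_assoc, inner_sub_left, inner_add_left, him]
  congr 1
  · rw [← Complex.exp_add, ← Complex.exp_add, ← Complex.exp_add, ← Complex.exp_add]
    congr 1
    rw [inner_add_left, inner_add_right]
    generalize (inner ℂ (g.coc.1 x) (opOf g.uni (g'.coc.1 x)) : ℂ) = p
    have hp : p = (p.re : ℂ) + p.im * Complex.I := (Complex.re_add_im p).symm
    have hp' : starRingEnd ℂ p = (p.re : ℂ) - p.im * Complex.I := by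
      apply Complex.ext <;> simp
    rw [hp']
    push_cast
    linear_combination (1 / 2) * hp
  · rw [add_assoc]

theorem gaugeOp_mem_unitary (g : V.GV) (x : P) : gaugeOp g x ∈ unitary (Fock K →L[ℂ] Fock K) := by
  have h1 : ∀ e : Fock K ≃ₗᵢ[ℂ] Fock K,
      (e : Fock K →L[ℂ] Fock K) ∈ unitary (Fock K →L[ℂ] Fock K) := fun e =>
    (Unitary.linearIsometryEquiv.symm e).2
  have h2 := mul_mem (h1 (weyl (g.coc.1 x))) (h1 (secondQuant (V.gaugeUnitary g.uni x)))
  have h3 : Complex.exp (Complex.I * (inner ℝ g.lam (x : EuclideanSpace ℝ (Fin d)) : ℝ)) ∈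
      unitary ℂ := by
    rw [Unitary.mem_iff]
    constructor <;>
    · rw [Complex.star_def, ← Complex.exp_conj, ← Complex.exp_add, map_mul, Complex.conj_I,
        Complex.conj_ofReal]
      ring_nf
      exact Complex.exp_zero
  exact Unitary.smul_mem_of_mem h3 h2

theorem norm_gaugeOp (g : V.GV) (x : P) (f : Fock K) : ‖gaugeOp g x f‖ = ‖f‖ :=
  Unitary.norm_map ⟨_, gaugeOp_mem_unitary g x⟩ f

end IsometricRep

/-! ### Strong continuity of families of contractions -/

section Contractions

variable {X : Type*} [TopologicalSpace X]
variable {E F : Type*} [NormedAddCommGroup E] [NormedSpace ℂ E] [NormedAddCommGroup F]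
  [NormedSpace ℂ F]

/-- Strong continuity of a family of contractions is joint continuity. -/
theorem continuous_contraction_apply {A : X → E →L[ℂ] F} (hA : ∀ x f, ‖A x f‖ ≤ ‖f‖)
    (h : ∀ v, Continuous fun x => A x v) {φ : X → E} (hφ : Continuous φ) :
    Continuous fun x => A x (φ x) := by
  refine continuous_iff_continuousAt.2 fun x => ?_
  rw [ContinuousAt, tendsto_iff_norm_sub_tendsto_zero]
  have h1 := (tendsto_iff_norm_sub_tendsto_zero.1 (hφ.tendsto x)).add
    (tendsto_iff_norm_sub_tendsto_zero.1 ((h (φ x)).tendsto x))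
  rw [add_zero] at h1
  refine squeeze_zero (fun _ => norm_nonneg _) (fun y => ?_) h1
  have h2 : A y (φ y) - A x (φ x) = A y (φ y - φ x) + (A y (φ x) - A x (φ x)) := by
    rw [map_sub, sub_add_sub_cancel]
  rw [h2]
  exact (norm_add_le _ _).trans (add_le_add_left (hA _ _) _)

theorem continuous_contraction_of_dense {A : X → E →L[ℂ] F} (hA : ∀ x f, ‖A x f‖ ≤ ‖f‖)
    {S : Set E} (hS : Dense S) (h : ∀ v ∈ S, Continuous fun x => A x v) (f : E) :
    Continuous fun x => A x f := by
  refine continuous_of_uniform_approx_of_continuous fun s hs => ?_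
  obtain ⟨ε, hε, hs⟩ := Metric.mem_uniformity_dist.1 hs
  obtain ⟨v, hv, hd⟩ := Metric.mem_closure_iff.1 (hS f) ε hε
  refine ⟨_, h v hv, fun x => hs ?_⟩
  rw [dist_eq_norm, ← map_sub]
  exact (hA _ _).trans_lt (by rwa [← dist_eq_norm])

variable {K : Type u} [NormedAddCommGroup K] [InnerProductSpace ℂ K]

theorem continuous_contraction_of_expVec {A : X → Fock K →L[ℂ] F} (hA : ∀ x f, ‖A x f‖ ≤ ‖f‖)
    (h : ∀ v, Continuous fun x => A x (expVec v)) (f : Fock K) : Continuous fun x => A x f := by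
  refine continuous_contraction_of_dense hA
    (Submodule.dense_iff_topologicalClosure_eq_top.2 span_expVec) (fun v hv => ?_) f
  induction hv using Submodule.span_induction with
  | mem w hw =>
    obtain ⟨v, rfl⟩ := hw
    exact h v
  | zero => simp only [map_zero]; exact continuous_const
  | add x y _ _ hx hy => simp only [map_add]; exact hx.add hy
  | smul c x _ hx => simp only [map_smul]; exact hx.const_smul c

theorem continuous_expVec : Continuous (expVec (K := K)) := by
  refine continuous_iff_continuousAt.2 fun w => ?_
  rw [ContinuousAt, tendsto_iff_norm_sub_tendsto_zero]
  have h : ∀ v : K, ‖expVec v - expVec w‖ = Real.sqrt (Complex.exp (inner ℂ v v) -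
      Complex.exp (inner ℂ v w) - (Complex.exp (inner ℂ w v) - Complex.exp (inner ℂ w w))).re := by
    intro v
    rw [norm_eq_sqrt_re_inner (𝕜 := ℂ), inner_sub_left, inner_sub_right, inner_sub_right,
      inner_expVec, inner_expVec, inner_expVec, inner_expVec]
    rfl
  have hc : Continuous fun v : K => Real.sqrt (Complex.exp (inner ℂ v v) -
      Complex.exp (inner ℂ v w) - (Complex.exp (inner ℂ w v) - Complex.exp (inner ℂ w w))).re := by
    refine Real.continuous_sqrt.comp (Complex.continuous_re.comp ?_)
    have e : ∀ {f g : K → K}, Continuous f → Continuous g →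
        Continuous fun v => Complex.exp (inner ℂ (f v) (g v)) := fun hf hg =>
      Complex.continuous_exp.comp (hf.inner hg)
    exact ((e continuous_id continuous_id).sub (e continuous_id continuous_const)).sub
      ((e continuous_const continuous_id).sub continuous_const)
  have h1 := hc.tendsto w
  simp only [sub_self, Complex.zero_re, Real.sqrt_zero] at h1
  exact h1.congr fun v => (h v).symm

end Contractions

/-! ### The topologies of the gauge group and of `G_V` -/

section Topologies

variable {d : ℕ} {P : PointedCone ℝ (EuclideanSpace ℝ (Fin d))}

theorem locallyCompactSpace_cone [hP : IsSolidCone P] : LocallyCompactSpace P :=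
  hP.isClosed.locallyCompactSpace

namespace GaugeGroup

variable {H : Type u} [NormedAddCommGroup H] [InnerProductSpace ℂ H] [CompleteSpace H]
variable {α : P → (H →L[ℂ] H) →⋆ₐ[ℂ] (H →L[ℂ] H)}

theorem isGaugeCocycle (U : GaugeGroup α) :
    IsGaugeCocycle α (show gaugeSubgroup α from U).1 := (show gaugeSubgroup α from U).2

theorem op_injective : Function.Injective (op : GaugeGroup α → P → H →L[ℂ] H) := fun _ _ h =>
  Subtype.ext (funext fun x => Subtype.ext (congrFun h x))

/-- A gauge cocycle as a continuous map to the operators with the strong operator topology. -/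
noncomputable def toContinuousMap (U : GaugeGroup α) : C(P, H →Lₚₜ[ℂ] H) where
  toFun x := ContinuousLinearMap.toPointwiseConvergenceCLM ℂ (RingHom.id ℂ) H H (U.op x)
  continuous_toFun := PointwiseConvergenceCLM.continuous_of_continuous_eval
    U.isGaugeCocycle.continuous

theorem isInducing_toContinuousMap :
    Topology.IsInducing (toContinuousMap : GaugeGroup α → C(P, H →Lₚₜ[ℂ] H)) :=
  ContinuousMap.isUniformEmbedding_toUniformOnFunIsCompact.isInducing.of_comp_iff.1 ⟨rfl⟩

theorem continuous_of_continuous_op {X : Type*} [TopologicalSpace X] {Φ : X → GaugeGroup α}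
    (h : ∀ f, Continuous fun p : X × P => (Φ p.1).op p.2 f) : Continuous Φ :=
  isInducing_toContinuousMap.continuous_iff.2
    (ContinuousMap.continuous_of_continuous_uncurry _
      (PointwiseConvergenceCLM.continuous_of_continuous_eval h))

theorem continuous_op [IsSolidCone P] (f : H) :
    Continuous fun p : GaugeGroup α × P => p.1.op p.2 f := by
  have := locallyCompactSpace_cone (P := P)
  have h : Continuous fun p : GaugeGroup α × P => p.1.toContinuousMap p.2 :=
    (isInducing_toContinuousMap.continuous.comp continuous_fst).eval continuous_snd
  exact (continuous_eval_const (F := H →Lₚₜ[ℂ] H) f).comp h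

end GaugeGroup

namespace IsometricRep

variable {K : Type u} [NormedAddCommGroup K] [InnerProductSpace ℂ K] [CompleteSpace K]
variable {V : IsometricRep P K}

/-- The factor `𝒰(M_V)` enters only through its orbits, by the definition of the strong operator
topology. -/
theorem GV.continuous_iff {X : Type*} [TopologicalSpace X] {φ : X → V.GV} :
    Continuous φ ↔ Continuous (fun p => (φ p).lam) ∧ Continuous (fun p => (φ p).coc) ∧
      ∀ ξ, Continuous fun p => opOf (φ p).uni ξ := by
  have h : Topology.IsInducing fun a : V.GV => (a.lam, a.coc,
      ContinuousLinearMap.toPointwiseConvergenceCLM ℂ (RingHom.id ℂ) K K (opOf a.uni)) := ⟨rfl⟩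
  rw [h.continuous_iff]
  refine ⟨fun h => ⟨continuous_fst.comp h, (continuous_fst.comp continuous_snd).comp h,
    fun ξ => ?_⟩, fun h => h.1.prodMk (h.2.1.prodMk
      (PointwiseConvergenceCLM.continuous_of_continuous_eval h.2.2))⟩
  exact (continuous_eval_const (F := K →Lₚₜ[ℂ] K) ξ).comp
    ((continuous_snd.comp continuous_snd).comp h)

theorem norm_opOf (u : unitary V.commutant) (ξ : K) : ‖opOf u ξ‖ = ‖ξ‖ := by
  rw [norm_eq_sqrt_re_inner (𝕜 := ℂ), inner_opOf, ← norm_eq_sqrt_re_inner (𝕜 := ℂ)]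

theorem opOf_injective {u v : unitary V.commutant} (h : ∀ ξ, opOf u ξ = opOf v ξ) : u = v :=
  Subtype.ext (Subtype.ext (ContinuousLinearMap.ext h))

theorem continuous_coc [IsSolidCone P] : Continuous fun p : V.GV × P => p.1.coc.1 p.2 := by
  have := locallyCompactSpace_cone (P := P)
  exact ((continuous_subtype_val.comp
    (GV.continuous_iff.1 continuous_id).2.1).comp continuous_fst).eval continuous_snd

theorem continuous_gaugeUnitary (hcont : V.IsStrictlyContinuous) (η : K) :
    Continuous fun p : V.GV × P => V.gaugeUnitary p.1.uni p.2 η := by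
  have h1 : Continuous fun x : P => V x (ContinuousLinearMap.adjoint (V x) η) :=
    continuous_contraction_apply (fun x f => (V.norm_map x f).le) V.continuous' (hcont η)
  have h2 : Continuous fun x : P => V.proj x η := continuous_const.sub h1
  have h3 : Continuous fun p : V.GV × P => opOf p.1.uni (V.proj p.2 η) :=
    continuous_contraction_apply (A := fun p : V.GV × P => opOf p.1.uni)
      (fun p f => (norm_opOf _ f).le)
      (fun v => ((GV.continuous_iff.1 continuous_id).2.2 v).comp continuous_fst)
      (h2.comp continuous_snd)
  simp only [gaugeUnitary_apply]
  exact h3.add (h1.comp continuous_snd)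

theorem continuous_gaugeOp [IsSolidCone P] (hcont : V.IsStrictlyContinuous) (f : Fock K) :
    Continuous fun p : V.GV × P => gaugeOp p.1 p.2 f := by
  refine continuous_contraction_of_expVec (A := fun p : V.GV × P => gaugeOp p.1 p.2)
    (fun p f => (norm_gaugeOp _ _ f).le) (fun η => ?_) f
  simp only [gaugeOp_expVec]
  have hl : Continuous fun p : V.GV × P =>
      (inner ℝ p.1.lam (p.2 : EuclideanSpace ℝ (Fin d)) : ℝ) :=
    ((GV.continuous_iff.1 continuous_id).1.comp continuous_fst).inner
      (continuous_subtype_val.comp continuous_snd)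
  have hh := continuous_coc (V := V)
  have hw := continuous_gaugeUnitary hcont η
  have h1 : Continuous fun p : V.GV × P => Complex.exp (Complex.I *
      (inner ℝ p.1.lam (p.2 : EuclideanSpace ℝ (Fin d)) : ℝ)) :=
    Complex.continuous_exp.comp (continuous_const.mul (Complex.continuous_ofReal.comp hl))
  exact (h1.mul (Complex.continuous_exp.comp
      ((((Complex.continuous_ofReal.comp hh.norm).pow 2).div_const 2).neg.sub (hh.inner hw)))).smul
    (continuous_expVec.comp (hh.add hw))

end IsometricRep

end Topologies

/-! ### Recovering an element of `G_V` from its gauge cocycle -/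

/-- The phase is controlled uniformly for `t ∈ [0, 1]`, which bounds the variation of the
frequency `φ`, and not only modulo `2π`. -/
theorem continuous_of_continuous_exp {X : Type*} [TopologicalSpace X] {φ : X → ℝ}
    (h : Continuous fun p : X × ℝ => Complex.exp (Complex.I * (max p.2 0 * φ p.1 : ℝ))) :
    Continuous φ := by
  refine continuous_iff_continuousAt.2 fun s₀ => Metric.tendsto_nhds.2 fun ε hε => ?_
  obtain ⟨δ, hδ, hδ1, hδ2⟩ : ∃ δ : ℝ, 0 < δ ∧ δ ≤ 1 / 2 ∧ 2 * δ < ε :=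
    ⟨min (1 / 2) (ε / 4), by positivity, min_le_left _ _, by
      linarith [min_le_right (1 / 2) (ε / 4)]⟩
  have hd : Continuous fun p : X × ℝ => ‖Complex.exp (Complex.I * (max p.2 0 * φ p.1 : ℝ)) -
      Complex.exp (Complex.I * (max p.2 0 * φ s₀ : ℝ))‖ :=
    (h.sub (h.comp (continuous_const.prodMk continuous_snd))).norm
  have h0 : ∀ᶠ s in nhds s₀, ∀ t ∈ Set.Icc (0 : ℝ) 1,
      ‖Complex.exp (Complex.I * (max t 0 * φ s : ℝ)) -
        Complex.exp (Complex.I * (max t 0 * φ s₀ : ℝ))‖ < δ :=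
    isCompact_Icc.eventually_forall_of_forall_eventually fun t _ =>
      (hd.tendsto (s₀, t)).eventually_lt_const (by rw [sub_self, norm_zero]; exact hδ)
  filter_upwards [h0] with s hs
  rw [Real.dist_eq]
  refine lt_of_le_of_lt (abs_le_of_norm_exp_sub_one_le hδ1 fun t ht => ?_) hδ2
  refine le_trans (le_of_eq ?_) (hs t ht).le
  have h1 : ‖Complex.exp (Complex.I * (t * φ s₀ : ℝ))‖ = 1 := by
    rw [mul_comm Complex.I, Complex.norm_exp_ofReal_mul_I]
  have h2 : Complex.exp (Complex.I * (t * φ s : ℝ)) = Complex.exp (Complex.I * (t * φ s₀ : ℝ)) *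
      Complex.exp (Complex.I * (t * (φ s - φ s₀) : ℝ)) := by
    rw [← Complex.exp_add, ← mul_add, ← Complex.ofReal_add, mul_sub, add_sub_cancel]
  rw [max_eq_left ht.1, h2, ← mul_sub_one, norm_mul, h1, one_mul]

namespace IsometricRep

variable {d : ℕ} {P : PointedCone ℝ (EuclideanSpace ℝ (Fin d))}
variable {K : Type u} [NormedAddCommGroup K] [InnerProductSpace ℂ K] [CompleteSpace K]
variable {V : IsometricRep P K}

theorem inner_vac_gaugeOp_ne_zero (g : V.GV) (x : P) (η : K) :
    (inner ℂ (expVec 0) (gaugeOp g x (expVec η)) : ℂ) ≠ 0 := by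
  rw [gaugeOp_expVec, inner_smul_right, inner_vac_expVec, mul_one]
  exact mul_ne_zero (Complex.exp_ne_zero _) (Complex.exp_ne_zero _)

/-- The affine action `η ↦ h_x + (u E_x + 1 - E_x) η` in terms of the operator. -/
theorem affine_eq_gaugeOp (g : V.GV) (x : P) (η : K) :
    g.coc.1 x + V.gaugeUnitary g.uni x η =
      (inner ℂ (expVec 0) (gaugeOp g x (expVec η)) : ℂ)⁻¹ •
        onePartAdj (gaugeOp g x (expVec η)) := by
  have h := inner_vac_gaugeOp_ne_zero g x η
  rw [gaugeOp_expVec, inner_smul_right, inner_vac_expVec, mul_one] at h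
  rw [gaugeOp_expVec, inner_smul_right, inner_vac_expVec, mul_one, map_smul, onePartAdj_expVec,
    inv_smul_smul₀ h]

theorem coc_eq_gaugeOp (g : V.GV) (x : P) :
    g.coc.1 x = (inner ℂ (expVec 0) (gaugeOp g x (expVec 0)) : ℂ)⁻¹ •
      onePartAdj (gaugeOp g x (expVec 0)) := by
  rw [← affine_eq_gaugeOp, map_zero, add_zero]

theorem opOf_eq_gaugeOp (g : V.GV) {x : P} {a : K}
    (ha : ContinuousLinearMap.adjoint (V x) a = 0) :
    opOf g.uni a = (inner ℂ (expVec 0) (gaugeOp g x (expVec a)) : ℂ)⁻¹ •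
      onePartAdj (gaugeOp g x (expVec a)) - g.coc.1 x := by
  rw [← affine_eq_gaugeOp, add_sub_cancel_left, gaugeUnitary_of_adjoint_eq_zero _ ha]

theorem phase_eq_gaugeOp (g : V.GV) (x : P) :
    Complex.exp (Complex.I * (inner ℝ g.lam (x : EuclideanSpace ℝ (Fin d)) : ℝ)) =
      inner ℂ (expVec 0) (gaugeOp g x (expVec 0)) *
        Complex.exp ((‖g.coc.1 x‖ : ℂ) ^ 2 / 2) := by
  rw [gaugeOp_expVec, inner_smul_right, inner_vac_expVec, mul_one, map_zero, inner_zero_right,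
    sub_zero, mul_assoc, ← Complex.exp_add, neg_add_cancel, Complex.exp_zero, mul_one]

/-- By purity the kernels of the `V_x*` exhaust the space. -/
theorem dense_adjoint_eq_zero [IsSolidCone P] (hpure : V.IsPure) :
    Dense {a : K | ∃ x : P, ContinuousLinearMap.adjoint (V x) a = 0} := fun ξ => by
  obtain ⟨a, ha⟩ := exists_interior (P := P)
  exact mem_closure_of_tendsto (tendsto_proj_nsmul hpure ha ξ)
    (Filter.Eventually.of_forall fun n => ⟨n • a, V.adjoint_proj _ _⟩)

/-- As the cone is spanning, a vector is determined by its inner products with points of the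
cone. -/
theorem exists_coord_eq_inner [hP : IsSolidCone P] (i : Fin d) :
    ∃ p q : P, ∀ v : EuclideanSpace ℝ (Fin d), v i =
      (inner ℝ v (p : EuclideanSpace ℝ (Fin d)) : ℝ) -
        inner ℝ v (q : EuclideanSpace ℝ (Fin d)) := by
  obtain ⟨p, hp, q, hq, h⟩ := hP.spanning (EuclideanSpace.single i 1)
  refine ⟨⟨p, hp⟩, ⟨q, hq⟩, fun v => ?_⟩
  show v i = inner ℝ v p - inner ℝ v q
  rw [← inner_sub_right, ← h, EuclideanSpace.inner_single_right]
  simp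

theorem inner_coe_rayPt (v : EuclideanSpace ℝ (Fin d)) (x : P) {t : ℝ} (ht : 0 ≤ t) :
    (inner ℝ v (rayPt x t : EuclideanSpace ℝ (Fin d)) : ℝ) =
      t * inner ℝ v (x : EuclideanSpace ℝ (Fin d)) := by
  rw [coe_rayPt, max_eq_left ht, inner_smul_right]

theorem gaugeOp_injective [IsSolidCone P] (hpure : V.IsPure) {g g' : V.GV}
    (h : ∀ x, gaugeOp g x = gaugeOp g' x) : g = g' := by
  have hcoc : g.coc = g'.coc := Subtype.ext (ContinuousMap.ext fun x => by
    rw [coc_eq_gaugeOp, coc_eq_gaugeOp, h])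
  refine GV.ext ?_ hcoc (opOf_injective fun ξ => ?_)
  · have hl : ∀ x : P, (inner ℝ g.lam (x : EuclideanSpace ℝ (Fin d)) : ℝ) =
        inner ℝ g'.lam (x : EuclideanSpace ℝ (Fin d)) := fun x =>
      frequency_unique fun t ht => by
        rw [← inner_coe_rayPt _ x ht, ← inner_coe_rayPt _ x ht, phase_eq_gaugeOp,
          phase_eq_gaugeOp, h, hcoc]
    ext i
    obtain ⟨p, q, hpq⟩ := exists_coord_eq_inner (P := P) i
    rw [hpq, hpq, hl, hl]
  · refine congrFun ((opOf g.uni).continuous.ext_on (dense_adjoint_eq_zero hpure)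
      (opOf g'.uni).continuous ?_) ξ
    rintro a ⟨x, ha⟩
    rw [opOf_eq_gaugeOp _ ha, opOf_eq_gaugeOp _ ha, h, hcoc]

section Continuity

variable {X : Type*} [TopologicalSpace X] {ψ : X → V.GV}
  (hψ : ∀ f, Continuous fun p : X × P => gaugeOp (ψ p.1) p.2 f)

include hψ

theorem continuous_affine_of_gaugeOp (η : K) : Continuous fun p : X × P =>
    (inner ℂ (expVec 0) (gaugeOp (ψ p.1) p.2 (expVec η)) : ℂ)⁻¹ •
      onePartAdj (gaugeOp (ψ p.1) p.2 (expVec η)) :=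
  ((continuous_const.inner (hψ _)).inv₀ fun _ => inner_vac_gaugeOp_ne_zero _ _ _).smul
    (onePartAdj.continuous.comp (hψ _))

theorem continuous_coc_of_gaugeOp : Continuous fun p : X × P => (ψ p.1).coc.1 p.2 := by
  simp only [coc_eq_gaugeOp]
  exact continuous_affine_of_gaugeOp hψ 0

theorem continuous_opOf_of_gaugeOp [IsSolidCone P] (hpure : V.IsPure) (ξ : K) :
    Continuous fun s => opOf (ψ s).uni ξ := by
  refine continuous_contraction_of_dense (A := fun s => opOf (ψ s).uni)
    (fun s f => (norm_opOf _ f).le) (dense_adjoint_eq_zero hpure) ?_ ξ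
  rintro a ⟨x, ha⟩
  simp only [opOf_eq_gaugeOp _ ha]
  have h : Continuous fun s : X => (s, x) := continuous_id.prodMk continuous_const
  exact ((continuous_affine_of_gaugeOp hψ a).comp h).sub ((continuous_coc_of_gaugeOp hψ).comp h)

theorem continuous_phase_of_gaugeOp : Continuous fun p : X × P =>
    Complex.exp (Complex.I * (inner ℝ (ψ p.1).lam (p.2 : EuclideanSpace ℝ (Fin d)) : ℝ)) := by
  simp only [phase_eq_gaugeOp]
  exact (continuous_const.inner (hψ _)).mul (Complex.continuous_exp.comp
    (((Complex.continuous_ofReal.comp (continuous_coc_of_gaugeOp hψ).norm).pow 2).div_const 2))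

theorem continuous_inner_lam_of_gaugeOp (x : P) :
    Continuous fun s => (inner ℝ (ψ s).lam (x : EuclideanSpace ℝ (Fin d)) : ℝ) := by
  refine continuous_of_continuous_exp ?_
  have h := (continuous_phase_of_gaugeOp hψ).comp
    (continuous_fst.prodMk ((continuous_rayPt x).comp continuous_snd))
  refine h.congr fun p => ?_
  simp only [Function.comp_apply, coe_rayPt, inner_smul_right]

/-- Continuity of the inverse isomorphism: `ψ` is continuous as soon as its gauge cocycles are
jointly continuous. -/
theorem continuous_of_gaugeOp [IsSolidCone P] (hpure : V.IsPure) : Continuous ψ := by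
  refine GV.continuous_iff.2 ⟨?_, ?_, continuous_opOf_of_gaugeOp hψ hpure⟩
  · have h : Continuous fun s => fun i => (ψ s).lam i := continuous_pi fun i => by
      obtain ⟨p, q, hpq⟩ := exists_coord_eq_inner (P := P) i
      simp only [hpq]
      exact (continuous_inner_lam_of_gaugeOp hψ p).sub (continuous_inner_lam_of_gaugeOp hψ q)
    exact (PiLp.continuous_toLp 2 fun _ : Fin d => ℝ).comp h
  · exact (ContinuousMap.continuous_of_continuous_uncurry _
      (continuous_coc_of_gaugeOp hψ)).subtype_mk _

end Continuity

/-! ### The isomorphism -/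

theorem isGaugeCocycle_gaugeOp [IsSolidCone P] (hcont : V.IsStrictlyContinuous) (g : V.GV) :
    IsGaugeCocycle V.ccrFlow fun x => ⟨gaugeOp g x, gaugeOp_mem_unitary g x⟩ where
  continuous f := (continuous_gaugeOp hcont f).along_snd
  mul_map := gaugeOp_mul_ccrFlow g
  commute := gaugeOp_commute g

/-- The gauge cocycle of an element of `G_V`. -/
noncomputable def toGaugeGroup [IsSolidCone P] (hcont : V.IsStrictlyContinuous) (g : V.GV) :
    GaugeGroup V.ccrFlow :=
  (⟨_, isGaugeCocycle_gaugeOp hcont g⟩ : gaugeSubgroup V.ccrFlow)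

theorem op_toGaugeGroup [IsSolidCone P] (hcont : V.IsStrictlyContinuous) (g : V.GV) (x : P) :
    (toGaugeGroup hcont g).op x = gaugeOp g x := rfl

theorem toGaugeGroup_bijective [IsSolidCone P] (hpure : V.IsPure)
    (hcont : V.IsStrictlyContinuous) : Function.Bijective (toGaugeGroup (V := V) hcont) := by
  refine ⟨fun g g' h => gaugeOp_injective hpure fun x => ?_, fun U => ?_⟩
  · rw [← op_toGaugeGroup hcont, h, op_toGaugeGroup]
  · obtain ⟨g, hg⟩ := exists_gaugeOp_eq U.isGaugeCocycle hcont hpure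
    exact ⟨g, GaugeGroup.op_injective (funext fun x => (hg x).symm)⟩

/-- The isomorphism of topological groups from `G_V` onto the gauge group of the CCR flow. -/
noncomputable def gaugeGroupEquiv [IsSolidCone P] (hpure : V.IsPure)
    (hcont : V.IsStrictlyContinuous) : V.GV ≃ₜ* GaugeGroup V.ccrFlow :=
  let e : V.GV ≃* GaugeGroup V.ccrFlow :=
    { Equiv.ofBijective _ (toGaugeGroup_bijective hpure hcont) with
      map_mul' := fun g g' => GaugeGroup.op_injective (funext (gaugeOp_mul g g')) }
  have he : ∀ U x, gaugeOp (e.symm U) x = U.op x := fun U x => by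
    rw [← op_toGaugeGroup hcont]
    exact congrArg (fun W : GaugeGroup V.ccrFlow => W.op x) (e.apply_symm_apply U)
  { e with
    continuous_toFun := GaugeGroup.continuous_of_continuous_op (continuous_gaugeOp hcont)
    continuous_invFun := continuous_of_gaugeOp (ψ := e.symm)
      (fun f => by simp only [he]; exact GaugeGroup.continuous_op f) hpure }

end IsometricRep

theorem mainTheorem2 {d : ℕ} (P : PointedCone ℝ (EuclideanSpace ℝ (Fin d))) [IsSolidCone P]
    {K : Type u} [NormedAddCommGroup K] [InnerProductSpace ℂ K] [CompleteSpace K]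
    [TopologicalSpace.SeparableSpace K]
    (V : IsometricRep P K) (hpure : V.IsPure) (hcont : V.IsStrictlyContinuous) :
    ∃ Φ : V.GV ≃ₜ* GaugeGroup V.ccrFlow, ∀ (g : V.GV) (x : P),
      (Φ g).op x =
        Complex.exp (Complex.I * (inner ℝ g.lam (x : EuclideanSpace ℝ (Fin d)) : ℝ)) •
          ((weyl (g.coc.1 x) : Fock K →L[ℂ] Fock K) *
            (secondQuant (V.gaugeUnitary g.uni x) : Fock K →L[ℂ] Fock K)) :=
  ⟨IsometricRep.gaugeGroupEquiv hpure hcont, fun _ _ => rfl⟩
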